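/- **Lemma 3.4.** Let $N,M\ge 1$ be integers, and let $A=(A_{i,j})_{1\le i,j\le N}$, $A_{i,j}\in\mathbf R^{M\times M}$, be a random block matrix sampled according to the probability density $a\mapsto Z^{-1}e^{-\frac M4\operatorname{tr}a^*a}$ on the space of block matrices $a\in(\mathbf R^{M\times M})^{N\times N}$ that satisfy $a^*=a$ and $a_{i,j}=0$ for $|i-j|>1$. For $\lambda\in\mathbf R$ define $$D_1=A_{1,1}-\lambda,\qquad B_k=-A_{k,k+1},\qquad D_{k+1}=A_{k+1,k+1}-\lambda-B_k^*D_k^{-1}B_k\qquad(1\le k<N),$$ where the inverses exist almost surely. Let $S_k=\|D_k\|$ (operator norm), which is almost surely positive, let $\|X\|_F=(\operatorname{tr}X^*X)^{1/2}$, and for $1<k<N$ let $\phi_k:(0,\infty)\to\mathbf R$ be the (random) function given by $$\phi_k(sS_k)=\frac M4\big\|sD_k+\lambda+B_{k-1}^*D_{k-1}^{-1}B_{k-1}\big\|_F^2+\frac M4\big\|D_{k+1}+\lambda+s^{-1}B_k^*D_k^{-1}B_k\big\|_F^2-\frac{M^2+M-2}{2}\log(sS_k),\qquad s>0.$$ (Up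 to normalization, $e^{-\phi_k}$ is the density of the conditional law of $S_k$ given $D_{k-1},\|D_k\|^{-1}D_k,D_{k+1},B_{k-1},B_k$.) For every $\varepsilon>0$ there are constants $C_\varepsilon>1>c_\varepsilon>0$, depending only on $\varepsilon$, such that for all real $\lambda$ with $|\lambda|<\varepsilon^{-1}$ and all integers $M\ge C_\varepsilon$ and $1<k<N$, with probability at least $1-M^{-c_\varepsilon}$ all of the following hold: - $S_k\,\phi_k'(S_ks)\ge M^{2-\varepsilon}s$ for all $s\ge M^{\varepsilon}$; - $S_k\,\phi_k'(S_ks)\le -M^{2-\varepsilon}s^{-3}$ for all $0<s\le M^{-\varepsilon}$; - $|S_k^2\,\phi_k''(S_ks)|\le M^{3+\varepsilon}(1+s^{-4})$ for all $s>0$. -/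

import Mathlib

open MeasureTheory Matrix

namespace BandMatrix

noncomputable section

/-- Block matrices with `N × N` blocks, each block a real `M × M` matrix. -/
abbrev BlockMatrix (N M : ℕ) : Type := Matrix (Fin N) (Fin N) (Matrix (Fin M) (Fin M) ℝ)

/-- The space of block matrices `a` with `a* = a`, that is `a j i = (a i j)ᵀ` for all blocks,
and `a i j = 0` whenever `|i - j| > 1`. -/
def bandSpace (N M : ℕ) : Submodule ℝ (BlockMatrix N M) where
  carrier := {a | (∀ i j, a j i = (a i j)ᵀ) ∧
    ∀ i j : Fin N, 1 < |((i : ℕ) : ℤ) - ((j : ℕ) : ℤ)| → a i j = 0}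
  add_mem' := by
    rintro a b ⟨ha, ha'⟩ ⟨hb, hb'⟩
    refine ⟨fun i j => ?_, fun i j h => ?_⟩
    · rw [Matrix.add_apply, Matrix.add_apply, Matrix.transpose_add, ha i j, hb i j]
    · rw [Matrix.add_apply, ha' i j h, hb' i j h, add_zero]
  zero_mem' := ⟨fun i j => by simp, fun i j _ => rfl⟩
  smul_mem' := by
    rintro r a ⟨ha, ha'⟩
    refine ⟨fun i j => ?_, fun i j h => ?_⟩
    · rw [Matrix.smul_apply, Matrix.smul_apply, Matrix.transpose_smul, ha i j]
    · rw [Matrix.smul_apply, ha' i j h, smul_zero]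

/-- `tr (a* a)` for a block matrix `a`: the sum of `tr ((a i j)ᵀ (a i j))` over all blocks. -/
def trSq {N M : ℕ} (a : BlockMatrix N M) : ℝ := ∑ i, ∑ j, ((a i j)ᵀ * a i j).trace

instance {N M : ℕ} : MeasurableSpace (bandSpace N M) := borel _

instance {N M : ℕ} : BorelSpace (bandSpace N M) := ⟨rfl⟩

instance {N M : ℕ} : LocallyCompactSpace (BlockMatrix N M) :=
  inferInstanceAs (LocallyCompactSpace (Fin N → Fin N → Fin M → Fin M → ℝ))

instance {N M : ℕ} : T2Space (BlockMatrix N M) :=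
  inferInstanceAs (T2Space (Fin N → Fin N → Fin M → Fin M → ℝ))

instance {N M : ℕ} : LocallyCompactSpace (bandSpace N M) :=
  (Submodule.closed_of_finiteDimensional
    (bandSpace N M)).isClosedEmbedding_subtypeVal.locallyCompactSpace

/-- The unnormalized measure `e^{-(M/4) tr (a* a)} da` on the space of symmetric block tridiagonal
matrices; `da` is Lebesgue measure on that finite-dimensional vector space, which is its Haar
measure and is determined up to a constant factor that disappears in the normalization. -/
def bandWeight (N M : ℕ) : Measure (bandSpace N M) :=
  (Measure.addHaar : Measure (bandSpace N M)).withDensity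
    fun a => ENNReal.ofReal (Real.exp (-((M : ℝ) / 4) * trSq (a : BlockMatrix N M)))

/-- The law of the random block tridiagonal matrix: the probability measure with density
`Z⁻¹ e^{-(M/4) tr (a* a)}`. -/
def bandLaw (N M : ℕ) : Measure (bandSpace N M) :=
  (bandWeight N M Set.univ)⁻¹ • bandWeight N M

/-- The block in row `i` and column `j`, where rows and columns are numbered `1, …, N`
(zero outside that range). -/
def block {N M : ℕ} (a : BlockMatrix N M) (i j : ℕ) : Matrix (Fin M) (Fin M) ℝ :=
  if h : (1 ≤ i ∧ i ≤ N) ∧ (1 ≤ j ∧ j ≤ N) then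
    a ⟨i - 1, by omega⟩ ⟨j - 1, by omega⟩
  else 0

/-- `B_k = - A_{k,k+1}` for `k = 1, …, N - 1`. -/
def B {N M : ℕ} (a : BlockMatrix N M) (k : ℕ) : Matrix (Fin M) (Fin M) ℝ :=
  -block a k (k + 1)

/-- The matrices `D_k`, `k = 1, …, N`, of the block Gaussian elimination of `a - lam`:
`D_1 = A_{1,1} - lam` and `D_{k+1} = A_{k+1,k+1} - lam - B_k* D_k⁻¹ B_k`.
The value at `k = 0` is not used. -/
def D {N M : ℕ} (a : BlockMatrix N M) (lam : ℝ) : ℕ → Matrix (Fin M) (Fin M) ℝ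
  | 0 => 0
  | 1 => block a 1 1 - lam • (1 : Matrix (Fin M) (Fin M) ℝ)
  | k + 2 => block a (k + 2) (k + 2) - lam • (1 : Matrix (Fin M) (Fin M) ℝ)
      - (B a (k + 1))ᵀ * (D a lam (k + 1))⁻¹ * B a (k + 1)

/-- The operator norm of a matrix with respect to the Euclidean norm. -/
def opNorm {M : ℕ} (X : Matrix (Fin M) (Fin M) ℝ) : ℝ :=
  ‖Matrix.toEuclideanCLM (n := Fin M) (𝕜 := ℝ) X‖

/-- The Frobenius norm `(tr X* X)^{1/2}`. -/
def frobNorm {M : ℕ} (X : Matrix (Fin M) (Fin M) ℝ) : ℝ := Real.sqrt ((Xᵀ * X).trace)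

/-- `S_k = ‖D_k‖`. -/
def S {N M : ℕ} (a : BlockMatrix N M) (lam : ℝ) (k : ℕ) : ℝ := opNorm (D a lam k)

/-- The logarithmic density `φ_k` of the conditional law of `S_k` given
`D_{k-1}, ‖D_k‖⁻¹ D_k, D_{k+1}, B_{k-1}, B_k`, as a function of `t > 0`:
for `t = s S_k`,
`φ_k(t) = (M/4) ‖s D_k + lam + B_{k-1}* D_{k-1}⁻¹ B_{k-1}‖_F² +
(M/4) ‖D_{k+1} + lam + s⁻¹ B_k* D_k⁻¹ B_k‖_F² - ((M² + M - 2)/2) log t`. -/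
def phi {N M : ℕ} (a : BlockMatrix N M) (lam : ℝ) (k : ℕ) (t : ℝ) : ℝ :=
  (M : ℝ) / 4 * frobNorm ((t / S a lam k) • D a lam k + lam • (1 : Matrix (Fin M) (Fin M) ℝ)
      + (B a (k - 1))ᵀ * (D a lam (k - 1))⁻¹ * B a (k - 1)) ^ 2
    + (M : ℝ) / 4 * frobNorm (D a lam (k + 1) + lam • (1 : Matrix (Fin M) (Fin M) ℝ)
      + (t / S a lam k)⁻¹ • ((B a k)ᵀ * (D a lam k)⁻¹ * B a k)) ^ 2
    - ((M : ℝ) ^ 2 + (M : ℝ) - 2) / 2 * Real.log t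

section Probability

/-! The law defined above is a probability measure. -/

attribute [local instance] Matrix.normedAddCommGroup Matrix.normedSpace

lemma sq_norm_le_trSq {N M : ℕ} (a : BlockMatrix N M) : ‖a‖ ^ 2 ≤ trSq a := by
  have key : ∀ i j k l, (a i j k l) ^ 2 ≤ trSq a := by
    intro i j k l
    have h0 : ∀ i j, 0 ≤ ((a i j)ᵀ * a i j).trace := fun i j => by
      simp only [Matrix.trace, Matrix.diag, Matrix.mul_apply, Matrix.transpose_apply]
      exact Finset.sum_nonneg fun _ _ => Finset.sum_nonneg fun _ _ => mul_self_nonneg _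
    have h1 : (a i j k l) ^ 2 ≤ ((a i j)ᵀ * a i j).trace := by
      simp only [Matrix.trace, Matrix.diag, Matrix.mul_apply, Matrix.transpose_apply, ← sq]
      exact (Finset.single_le_sum (f := fun k => a i j k l ^ 2) (fun _ _ => sq_nonneg _)
        (Finset.mem_univ k)).trans (Finset.single_le_sum (f := fun l => ∑ k, a i j k l ^ 2)
        (fun _ _ => Finset.sum_nonneg fun _ _ => sq_nonneg _) (Finset.mem_univ l))
    exact h1.trans ((Finset.single_le_sum (f := fun j => ((a i j)ᵀ * a i j).trace)
      (fun _ _ => h0 _ _) (Finset.mem_univ j)).trans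
      (Finset.single_le_sum (f := fun i => ∑ j, ((a i j)ᵀ * a i j).trace)
      (fun _ _ => Finset.sum_nonneg fun _ _ => h0 _ _) (Finset.mem_univ i)))
  have hn : 0 ≤ trSq a := Finset.sum_nonneg fun i _ => Finset.sum_nonneg fun j _ => by
    simp only [Matrix.trace, Matrix.diag, Matrix.mul_apply, Matrix.transpose_apply]
    exact Finset.sum_nonneg fun _ _ => Finset.sum_nonneg fun _ _ => mul_self_nonneg _
  have : ‖a‖ ≤ Real.sqrt (trSq a) := by
    rw [Matrix.norm_le_iff (Real.sqrt_nonneg _)]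
    intro i j
    rw [Matrix.norm_le_iff (Real.sqrt_nonneg _)]
    intro k l
    exact Real.abs_le_sqrt (key i j k l)
  calc ‖a‖ ^ 2 ≤ Real.sqrt (trSq a) ^ 2 := by gcongr
    _ = _ := Real.sq_sqrt hn

lemma continuous_trSq {N M : ℕ} : Continuous (trSq : BlockMatrix N M → ℝ) := by
  unfold trSq Matrix.trace
  simp only [Matrix.diag, Matrix.mul_apply, Matrix.transpose_apply]
  refine continuous_finsetSum _ fun i _ => continuous_finsetSum _ fun j _ =>
    continuous_finsetSum _ fun k _ => continuous_finsetSum _ fun l _ => ?_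
  have : Continuous fun a : BlockMatrix N M => a i j l k := by
    have h1 : Continuous fun a : BlockMatrix N M => a i j := continuous_id.matrix_elem i j
    exact h1.matrix_elem l k
  exact this.mul this

lemma exp_neg_mul_le (n : ℕ) {b x y : ℝ} (hb : 0 < b) (hx : 0 ≤ x) (hy : x ^ 2 ≤ y) :
    Real.exp (-b * y) ≤ (Real.exp (2 * b) * n.factorial / b ^ n) * (1 + x) ^ (-(n : ℝ)) := by
  have h := Real.pow_div_factorial_le_exp (b * (1 + x)) (by positivity) n
  rw [Real.rpow_neg (by positivity), Real.rpow_natCast]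
  have h2 : Real.exp (-b * y) ≤ Real.exp (2 * b) * (Real.exp (b * (1 + x)))⁻¹ := by
    rw [← Real.exp_neg, ← Real.exp_add]
    apply Real.exp_le_exp.mpr
    nlinarith [sq_nonneg (x - 1), mul_nonneg hb.le hx, mul_le_mul_of_nonneg_left hy hb.le,
      mul_nonneg hb.le (sq_nonneg (x-1))]
  refine h2.trans ?_
  have h3 : (Real.exp (b * (1 + x)))⁻¹ ≤ ((b * (1 + x)) ^ n / n.factorial)⁻¹ := by
    apply inv_anti₀ (by positivity) h
  calc _ ≤ Real.exp (2 * b) * ((b * (1 + x)) ^ n / n.factorial)⁻¹ := by gcongr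
    _ = _ := by rw [mul_pow]; field_simp

instance {N M : ℕ} : IsProbabilityMeasure (bandLaw N M) := by
  have hm : Measurable fun a : bandSpace N M =>
      ENNReal.ofReal (Real.exp (-((M : ℝ) / 4) * trSq (a : BlockMatrix N M))) := by
    have : Continuous fun a : bandSpace N M => trSq (a : BlockMatrix N M) :=
      continuous_trSq.comp continuous_subtype_val
    exact (ENNReal.continuous_ofReal.comp
      (Real.continuous_exp.comp (continuous_const.mul this))).measurable
  have h0 : bandWeight N M Set.univ ≠ 0 := by
    intro h
    rw [Measure.measure_univ_eq_zero, bandWeight, withDensity_eq_zero_iff hm.aemeasurable] at h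
    have h' : ∀ᵐ a : bandSpace N M ∂Measure.addHaar, False := by
      filter_upwards [h] with a ha
      have : 0 < Real.exp (-((M : ℝ) / 4) * trSq (a : BlockMatrix N M)) := Real.exp_pos _
      exact absurd (ENNReal.ofReal_eq_zero.mp ha) (not_le.mpr this)
    simp at h'
    exact NeZero.ne _ h'
  have h1 : bandWeight N M Set.univ ≠ ⊤ := by
    rw [bandWeight, withDensity_apply _ MeasurableSet.univ, Measure.restrict_univ]
    rcases Nat.eq_zero_or_pos M with rfl | hM
    · have : Subsingleton (bandSpace N 0) := ⟨fun a b => Subtype.ext (by ext i j k; exact k.elim0)⟩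
      have hc : IsCompact (Set.univ : Set (bandSpace N 0)) := Set.subsingleton_univ.isCompact
      simp [hc.measure_lt_top.ne]
    · have hb : (0 : ℝ) < (M : ℝ) / 4 := by positivity
      have hH : (Measure.addHaar : Measure (bandSpace N M)).IsAddHaarMeasure := inferInstance
      revert hH
      generalize (Measure.addHaar : Measure (bandSpace N M)) = μ
      intro hH
      have hH' : @Measure.IsAddHaarMeasure (bandSpace N M) 
        NormedAddCommGroup.toAddCommGroup.toAddGroup
        (PseudoMetricSpace.toUniformSpace.toTopologicalSpace) _ μ := hH
      have : @BorelSpace (bandSpace N M) (PseudoMetricSpace.toUniformSpace.toTopologicalSpace) _ := ⟨rfl⟩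
      have hi := (integrable_one_add_norm (E := bandSpace N M) (μ := μ)
        (r := ((Module.finrank ℝ (bandSpace N M) + 1 : ℕ) : ℝ)) (by push_cast; linarith)).const_mul
        (Real.exp (2 * ((M : ℝ) / 4)) * (Module.finrank ℝ (bandSpace N M) + 1).factorial /
          ((M : ℝ) / 4) ^ (Module.finrank ℝ (bandSpace N M) + 1))
      refine (lt_of_le_of_lt (lintegral_mono fun a => ?_) hi.lintegral_lt_top).ne
      exact ENNReal.ofReal_le_ofReal (exp_neg_mul_le _ hb (norm_nonneg a) (sq_norm_le_trSq a.1))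
  constructor
  rw [bandLaw, Measure.smul_apply, smul_eq_mul, ENNReal.inv_mul_cancel h0 h1]

end Probability

end

end BandMatrix

/-! The function `φ_k` is, in the variable `s`, a Laurent polynomial with a logarithmic term. Write
`Z_k = B_k* D_k⁻¹ B_k`. As `λ + Z_{k-1} = A_{k,k} - D_k` and `D_{k+1} + λ = A_{k+1,k+1} - Z_k`, the
coefficients of `φ_k` other than the constant one are determined by `‖D_k‖_F²`, `‖Z_k‖_F²` and the
inner products of `D_k` with `A_{k,k}` and of `Z_k` with `A_{k+1,k+1}`. If, up to a small power of
`M`, the norms satisfy `‖A_{k,k}‖_F² ≲ M`, `‖A_{k+1,k+1}‖_F² ≲ M`, `M ≲ ‖D_k‖_F² ≲ M²` and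
`M ≲ ‖Z_k‖_F² ≲ M²`, then `M ‖D_k‖_F² s / 2` dominates `S_k φ_k'(S_k s)` for large `s`,
`-M ‖Z_k‖_F² s⁻³ / 2` dominates it for small `s`, and the bound of the second derivative is
immediate; this is `phi_bounds`. It remains to prove the bounds of the norms with high probability,
which is done in `bandLaw_goodSet`.

The random matrix is modelled by independent standard Gaussian arrays (`map_modelMatrix`). An
estimate is then proved by resampling one block with the others fixed (`modelLaw_real_le`): given
the past, `D_k` is a symmetric Gaussian matrix shifted by a fixed matrix, and `B_k` is Gaussian and
independent of `D_k`. The necessary facts about Gaussian matrices are uniform in the fixed matrices.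

* The bounds for the diagonal blocks and the lower bound for `D_k` come from second moments and from
  small ball estimates for the entries (`stdGauss_fsq_symMat_large`, `stdGauss_fsq_symMat_small`).
* `‖D_k⁻¹‖_F ≲ M` (`stdGauss_fsq_inv_large`). For the first column of the inverse, this follows from
  the Schur complement formula and a small ball estimate for quadratic forms of Gaussian vectors
  (`quadratic_form_small_ball`, `schur_small_ball`). Orthogonal invariance extends it to `D_k⁻¹ v`
  for each fixed vector `v`, and an independent Gaussian `v` detects the Frobenius norm.
* `‖Yᵀ T Y‖_F` is of order `M ‖T‖_F` for a Gaussian matrix `Y` (`stdGauss_fsq_congr_large` and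
  `stdGauss_fsq_congr_small`), which turns bounds for `D_k⁻¹` into bounds for `Z_k`. The upper bound
  for `D_k = A_{k,k} - λ - Z_{k-1}` follows.
* `‖D_k⁻¹‖_F² ≳ M`, for `k > 1`. This does not follow from the upper bound for `D_k`, which is too
  weak. Instead, there is a matrix `T` with `‖T‖_F² ≲ M` that inverts `D_{k-1}` on at least half of
  the first `M / 4` coordinate vectors, because these columns of `D_{k-1}`, restricted to the
  remaining rows, form a rectangular matrix (`stdGauss_partial_inverse`). On a subspace of dimension
  proportional to `M`, `D_k` agrees with `A_{k,k} - λ - B_{k-1}* T B_{k-1}`, whose squared Frobenius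
  norm is `≲ M`, and the Cauchy-Schwarz inequality for the trace over this subspace gives the claim
  (`card_sq_le_fsq_mul_fsq`). -/

open ProbabilityTheory

namespace BandMatrix

/-! ### Standard Gaussian vectors -/

section

/-- The standard Gaussian measure on `ι → ℝ`: independent coordinates with law `N(0, 1)`. -/
noncomputable abbrev stdGauss (ι : Type*) [Fintype ι] : Measure (ι → ℝ) :=
  Measure.pi fun _ : ι => gaussianReal 0 1

variable {ι ι' κ : Type*} [Fintype ι] [Fintype ι'] [Fintype κ]

lemma integral_cexp_stdGauss (c : ι → ℝ) :
    ∫ x, Complex.exp ((∑ i, c i * x i : ℝ) * Complex.I) ∂(stdGauss ι)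
      = Complex.exp (-(∑ i, c i ^ 2 : ℝ) / 2) := by
  have h := charFun_stdGaussian (E := EuclideanSpace ℝ ι) (WithLp.toLp 2 c)
  rw [← map_pi_eq_stdGaussian, charFun_apply, integral_map (by fun_prop)
    (Measurable.aestronglyMeasurable (by fun_prop))] at h
  rw [← Complex.ofReal_pow, EuclideanSpace.real_norm_sq_eq] at h
  simpa [PiLp.inner_apply, mul_comm] using h

lemma eq_stdGauss_of_charFun {μ : Measure (κ → ℝ)} [IsProbabilityMeasure μ]
    (h : ∀ c : κ → ℝ, ∫ x, Complex.exp ((∑ i, c i * x i : ℝ) * Complex.I) ∂μ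
      = Complex.exp (-(∑ i, c i ^ 2 : ℝ) / 2)) : μ = stdGauss κ := by
  have h1 : μ.map (WithLp.toLp 2) = stdGaussian (EuclideanSpace ℝ κ) := by
    have : IsProbabilityMeasure (μ.map (WithLp.toLp 2 : (κ → ℝ) → EuclideanSpace ℝ κ)) :=
      Measure.isProbabilityMeasure_map (by fun_prop)
    apply Measure.ext_of_charFun (E := EuclideanSpace ℝ κ)
    ext t
    rw [charFun_stdGaussian, charFun_apply, integral_map (by fun_prop)
      (Measurable.aestronglyMeasurable (by fun_prop)), ← Complex.ofReal_pow,
      EuclideanSpace.real_norm_sq_eq]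
    simpa [PiLp.inner_apply, mul_comm] using h (WithLp.ofLp t)
  rw [← map_pi_eq_stdGaussian] at h1
  have h2 := congrArg (Measure.map (WithLp.ofLp : EuclideanSpace ℝ κ → (κ → ℝ))) h1
  rw [Measure.map_map (by fun_prop) (by fun_prop),
    Measure.map_map (by fun_prop) (by fun_prop)] at h2
  simpa [Function.comp_def] using h2

/-- A linear image of a pair of independent standard Gaussian vectors under a map whose transpose
is isometric is again a standard Gaussian vector. -/
lemma map_prod_stdGauss {T : (ι → ℝ) × (ι' → ℝ) → κ → ℝ} (hT : Measurable T)
    (h : ∀ c : κ → ℝ, ∃ (a : ι → ℝ) (b : ι' → ℝ),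
      (∀ p, ∑ k, c k * T p k = ∑ i, a i * p.1 i + ∑ j, b j * p.2 j) ∧
        ∑ i, a i ^ 2 + ∑ j, b j ^ 2 = ∑ k, c k ^ 2) :
    ((stdGauss ι).prod (stdGauss ι')).map T = stdGauss κ := by
  have : IsProbabilityMeasure (((stdGauss ι).prod (stdGauss ι')).map T) :=
    Measure.isProbabilityMeasure_map hT.aemeasurable
  refine eq_stdGauss_of_charFun fun c => ?_
  obtain ⟨a, b, h1, h2⟩ := h c
  rw [integral_map hT.aemeasurable (Measurable.aestronglyMeasurable (by fun_prop))]
  simp_rw [h1, Complex.ofReal_add, add_mul, Complex.exp_add]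
  rw [integral_prod_mul (μ := stdGauss ι) (ν := stdGauss ι')
    (fun x : ι → ℝ => Complex.exp ((∑ i, a i * x i : ℝ) * Complex.I))
    (fun x : ι' → ℝ => Complex.exp ((∑ i, b i * x i : ℝ) * Complex.I)),
    integral_cexp_stdGauss, integral_cexp_stdGauss, ← Complex.exp_add, ← h2]
  push_cast
  ring_nf

lemma map_stdGauss {T : (ι → ℝ) → κ → ℝ} (hT : Measurable T)
    (h : ∀ c : κ → ℝ, ∃ a : ι → ℝ,
      (∀ x, ∑ k, c k * T x k = ∑ i, a i * x i) ∧ ∑ i, a i ^ 2 = ∑ k, c k ^ 2) :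
    (stdGauss ι).map T = stdGauss κ := by
  have : IsProbabilityMeasure ((stdGauss ι).map T) :=
    Measure.isProbabilityMeasure_map hT.aemeasurable
  refine eq_stdGauss_of_charFun fun c => ?_
  obtain ⟨a, h1, h2⟩ := h c
  rw [integral_map hT.aemeasurable (Measurable.aestronglyMeasurable (by fun_prop))]
  simp_rw [h1]
  rw [integral_cexp_stdGauss, ← h2]

/-- The law of an affine functional. For `c = 0` it is a Dirac mass, in accordance with
`gaussianReal m 0`. -/
lemma map_linear_stdGauss (m : ℝ) (c : ι → ℝ) :
    (stdGauss ι).map (fun x => m + ∑ i, c i * x i)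
      = gaussianReal m (Real.toNNReal (∑ i, c i ^ 2)) := by
  have h0 : 0 ≤ ∑ i, c i ^ 2 := Finset.sum_nonneg fun _ _ => sq_nonneg _
  have h1 : (stdGauss ι).map (fun x => ∑ i, c i * x i)
      = gaussianReal 0 (Real.toNNReal (∑ i, c i ^ 2)) := by
    have : IsProbabilityMeasure ((stdGauss ι).map (fun x => ∑ i, c i * x i)) :=
      Measure.isProbabilityMeasure_map (Measurable.aemeasurable (by fun_prop))
    apply Measure.ext_of_charFun
    ext t
    rw [charFun_gaussianReal, charFun_apply_real, integral_map
      (Measurable.aemeasurable (by fun_prop)) (Measurable.aestronglyMeasurable (by fun_prop))]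
    have := integral_cexp_stdGauss (fun i => t * c i)
    simp_rw [mul_pow, mul_assoc, ← Finset.mul_sum] at this
    rw [Complex.ofReal_mul] at this
    simp only [Complex.ofReal_mul] at this ⊢
    rw [this]
    rw [Real.coe_toNNReal _ h0]
    push_cast
    ring_nf
  have h2 : (fun x : ι → ℝ => m + ∑ i, c i * x i)
      = (fun y => m + y) ∘ fun x => ∑ i, c i * x i := rfl
  rw [h2, ← Measure.map_map (by fun_prop) (by fun_prop), h1, gaussianReal_map_const_add, zero_add]

/-! ### Small ball estimates -/

lemma gaussianReal_real_le {m : ℝ} {v : NNReal} (hv : v ≠ 0) {a b p : ℝ} (hab : a ≤ b)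
    {s : Set ℝ} (hs : s ⊆ Set.Icc a b) (hp : ∀ x ∈ Set.Icc a b, gaussianPDFReal m v x ≤ p) :
    (gaussianReal m v).real s ≤ p * (b - a) := by
  have hp0 : 0 ≤ p := (gaussianPDFReal_nonneg m v a).trans (hp a ⟨le_rfl, hab⟩)
  refine (measureReal_mono hs).trans ?_
  refine ENNReal.toReal_le_of_le_ofReal (mul_nonneg hp0 (by linarith)) ?_
  rw [gaussianReal_apply m hv, ENNReal.ofReal_mul hp0, ← Real.volume_Icc,
    ← setLIntegral_const]
  exact setLIntegral_mono measurable_const fun x hx => ENNReal.ofReal_le_ofReal (hp x hx)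

/-- The constant `1 / (2 √v)` replaces `1 / √(2 π v)`. -/
lemma gaussianPDFReal_le {m : ℝ} {v : NNReal} (x : ℝ) :
    gaussianPDFReal m v x ≤ 1 / (2 * √v) * Real.exp (-(x - m) ^ 2 / (2 * v)) := by
  rw [gaussianPDFReal_def]
  refine mul_le_mul_of_nonneg_right ?_ (Real.exp_pos _).le
  rcases eq_or_ne v 0 with rfl | hv
  · simp
  have hv' : (0 : ℝ) < v := by positivity
  rw [← one_div]
  refine one_div_le_one_div_of_le (by positivity) ?_
  rw [Real.sqrt_mul (by positivity : (0 : ℝ) ≤ 2 * Real.pi)]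
  refine mul_le_mul_of_nonneg_right ?_ (Real.sqrt_nonneg _)
  rw [Real.le_sqrt' (by norm_num)]
  nlinarith [Real.pi_gt_three]

lemma gaussianReal_small_ball {m : ℝ} {v : NNReal} {θ : ℝ} (hθ : 0 ≤ θ) :
    (gaussianReal m v).real {x | x ^ 2 < θ ^ 2 * v} ≤ θ := by
  rcases eq_or_ne v 0 with rfl | hv
  · have : {x : ℝ | x ^ 2 < θ ^ 2 * ((0 : NNReal) : ℝ)} = ∅ := by
      ext x; simp; positivity
    rw [this]
    simpa using hθ
  have hv' : (0 : ℝ) < √v := Real.sqrt_pos.2 (by positivity)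
  have h := gaussianReal_real_le (m := m) hv (a := -(θ * √v)) (b := θ * √v) (p := 1 / (2 * √v))
    (by nlinarith [mul_nonneg hθ hv'.le]) (s := {x | x ^ 2 < θ ^ 2 * v}) ?_ ?_
  · refine h.trans (le_of_eq ?_)
    field_simp
    ring
  · intro x hx
    rw [Set.mem_Icc, ← abs_le]
    refine abs_le_of_sq_le_sq ?_ (by positivity)
    rw [mul_pow, Real.sq_sqrt (by positivity)]
    exact le_of_lt hx
  · intro x _
    refine (gaussianPDFReal_le x).trans (mul_le_of_le_one_right (by positivity) ?_)
    rw [Real.exp_le_one_iff]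
    exact div_nonpos_of_nonpos_of_nonneg (by nlinarith [sq_nonneg (x - m)]) (by positivity)

/-- Small ball estimate relative to the mean `m`, uniform in the variance `v`: on `|x| ≤ |m| / 4`
the density is at most of order `v ^ (-1/2) exp (-9 m² / (32 v))`, hence of order `1 / |m|`. -/
lemma gaussianReal_small_ball_mean {m : ℝ} {v : NNReal} {θ : ℝ} (hθ : 0 ≤ θ) :
    (gaussianReal m v).real {x | x ^ 2 < θ ^ 2 * m ^ 2} ≤ 4 * θ := by
  rcases le_or_gt (1 / 4) θ with h4 | h4
  · exact measureReal_le_one.trans (by linarith)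
  rcases eq_or_ne v 0 with rfl | hv
  · have : m ∉ {x : ℝ | x ^ 2 < θ ^ 2 * m ^ 2} := by
      simp only [Set.mem_ofPred_eq, not_lt]
      nlinarith [sq_nonneg m, mul_nonneg (sq_nonneg m) (by nlinarith : 0 ≤ 1 - θ ^ 2)]
    rw [gaussianReal_zero_var]
    rw [measureReal_def, Measure.dirac_apply' _ (measurableSet_lt (by fun_prop) (by fun_prop))]
    simp only [Set.indicator_of_notMem this]
    simp [hθ]
  have hv' : (0 : ℝ) < √v := Real.sqrt_pos.2 (by positivity)
  set σ := √(v : ℝ) with hσ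
  have hvσ : (v : ℝ) = σ ^ 2 := (Real.sq_sqrt (by positivity)).symm
  -- The number of standard deviations between `0` and the mean.
  set t := |m| / σ with ht
  have ht0 : 0 ≤ t := by positivity
  have hm : |m| = t * σ := by rw [ht]; field_simp
  have h := gaussianReal_real_le (m := m) hv (a := -(θ * |m|)) (b := θ * |m|)
    (p := 1 / (2 * σ) * (1 + 9 / 32 * t ^ 2)⁻¹)
    (by nlinarith [mul_nonneg hθ (abs_nonneg m)]) (s := {x | x ^ 2 < θ ^ 2 * m ^ 2}) ?_ ?_
  · refine h.trans ?_
    rw [hm]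
    have : 1 / (2 * σ) * (1 + 9 / 32 * t ^ 2)⁻¹ * (θ * (t * σ) - -(θ * (t * σ)))
        = θ * (t / (1 + 9 / 32 * t ^ 2)) := by field_simp; ring
    rw [this]
    have : t / (1 + 9 / 32 * t ^ 2) ≤ 1 := by
      rw [div_le_one (by positivity)]
      nlinarith [sq_nonneg (t - 16 / 9)]
    nlinarith
  · intro x hx
    rw [Set.mem_Icc, ← abs_le]
    refine abs_le_of_sq_le_sq ?_ (by positivity)
    rw [mul_pow, sq_abs]
    exact le_of_lt hx
  · intro x hx
    rw [Set.mem_Icc, ← abs_le] at hx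
    refine (gaussianPDFReal_le x).trans (mul_le_mul_of_nonneg_left ?_ (by positivity))
    have h1 : 9 / 16 * (t * σ) ^ 2 ≤ (x - m) ^ 2 := by
      rw [← hm, ← sq_abs (x - m)]
      have : 3 / 4 * |m| ≤ |x - m| := by
        have := abs_sub_abs_le_abs_sub m x
        rw [abs_sub_comm] at this
        nlinarith [abs_nonneg m]
      nlinarith [abs_nonneg m]
    have h2 : 9 / 32 * t ^ 2 ≤ (x - m) ^ 2 / (2 * v) := by
      rw [hvσ, le_div_iff₀ (by positivity)]
      nlinarith
    rw [neg_div, Real.exp_neg]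
    refine inv_anti₀ (by positivity) ?_
    linarith [Real.add_one_le_exp ((x - m) ^ 2 / (2 * v))]

lemma stdGauss_real_linear (m : ℝ) (c : ι → ℝ) {s : Set ℝ} (hs : MeasurableSet s) :
    (stdGauss ι).real {x | m + ∑ i, c i * x i ∈ s}
      = (gaussianReal m (Real.toNNReal (∑ i, c i ^ 2))).real s := by
  rw [← map_linear_stdGauss, map_measureReal_apply (by fun_prop) hs]
  rfl

lemma stdGauss_small_ball {X : (ι → ℝ) → ℝ} {m : ℝ} {c : ι → ℝ}
    (hX : ∀ x, X x = m + ∑ i, c i * x i) {θ s : ℝ} (hθ : 0 ≤ θ) (hs : s ≤ ∑ i, c i ^ 2) :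
    (stdGauss ι).real {x | X x ^ 2 < θ ^ 2 * s} ≤ θ := by
  have h0 : 0 ≤ ∑ i, c i ^ 2 := Finset.sum_nonneg fun _ _ => sq_nonneg _
  have h := gaussianReal_small_ball (m := m) (v := Real.toNNReal (∑ i, c i ^ 2)) hθ
  rw [← stdGauss_real_linear m c (measurableSet_lt (by fun_prop) (by fun_prop)),
    Real.coe_toNNReal _ h0] at h
  refine (measureReal_mono fun x hx => ?_).trans h
  simp only [Set.mem_ofPred_eq] at hx ⊢
  rw [← hX]
  exact hx.trans_le (by gcongr)

lemma stdGauss_small_ball_mean {X : (ι → ℝ) → ℝ} {m : ℝ} {c : ι → ℝ}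
    (hX : ∀ x, X x = m + ∑ i, c i * x i) {θ : ℝ} (hθ : 0 ≤ θ) :
    (stdGauss ι).real {x | X x ^ 2 < θ ^ 2 * m ^ 2} ≤ 4 * θ := by
  have h := gaussianReal_small_ball_mean (m := m) (v := Real.toNNReal (∑ i, c i ^ 2)) hθ
  rw [← stdGauss_real_linear m c (measurableSet_lt (by fun_prop) (by fun_prop))] at h
  simpa only [Set.mem_ofPred_eq, ← hX] using h

/-- The combination of the two small ball estimates: the scale of an affine functional is its
`L²` norm. -/
lemma stdGauss_small_ball_both {X : (ι → ℝ) → ℝ} {m : ℝ} {c : ι → ℝ}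
    (hX : ∀ x, X x = m + ∑ i, c i * x i) {θ : ℝ} (hθ : 0 ≤ θ) :
    (stdGauss ι).real {x | X x ^ 2 < θ ^ 2 * (m ^ 2 + ∑ i, c i ^ 2)} ≤ 10 * θ := by
  have h1 := stdGauss_small_ball hX (θ := 2 * θ) (by positivity) le_rfl
  have h2 := stdGauss_small_ball_mean hX (θ := 2 * θ) (by positivity)
  have : {x | X x ^ 2 < θ ^ 2 * (m ^ 2 + ∑ i, c i ^ 2)} ⊆
      {x | X x ^ 2 < (2 * θ) ^ 2 * ∑ i, c i ^ 2} ∪ {x | X x ^ 2 < (2 * θ) ^ 2 * m ^ 2} := by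
    intro x hx
    simp only [Set.mem_ofPred_eq, Set.mem_union] at hx ⊢
    by_contra! hcon
    nlinarith [sq_nonneg (X x)]
  refine (measureReal_mono this).trans ((measureReal_union_le _ _).trans ?_)
  linarith

/-- If each of finitely many random variables exceeds its scale with probability at least `1 - p`,
then, without any independence, the sum of squares exceeds half of the sum of the squared scales
with probability at least `1 - 2 p`. -/
lemma sum_sq_small_ball {Ω : Type*} [MeasurableSpace Ω] {μ : Measure Ω} [IsFiniteMeasure μ]
    {α : Type*} (t : Finset α) {X : α → Ω → ℝ} (hX : ∀ i ∈ t, Measurable (X i)) {s : α → ℝ}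
    (hs : ∀ i ∈ t, 0 ≤ s i) {θ p : ℝ} (hp : 0 ≤ p)
    (h : ∀ i ∈ t, μ.real {x | X i x ^ 2 < θ ^ 2 * s i} ≤ p) :
    μ.real {x | ∑ i ∈ t, X i x ^ 2 < θ ^ 2 / 2 * ∑ i ∈ t, s i} ≤ 2 * p := by
  classical
  have hS : 0 ≤ ∑ i ∈ t, s i := Finset.sum_nonneg hs
  have hm : ∀ i ∈ t, MeasurableSet {x | X i x ^ 2 < θ ^ 2 * s i} := fun i hi =>
    measurableSet_lt ((hX i hi).pow_const 2) measurable_const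
  rcases hS.eq_or_lt with h0 | hpos
  · have : {x | ∑ i ∈ t, X i x ^ 2 < θ ^ 2 / 2 * ∑ i ∈ t, s i} = ∅ := by
      ext x
      simp only [← h0, mul_zero, Set.mem_ofPred_eq, Set.mem_empty_iff_false, iff_false, not_lt]
      positivity
    rw [this]
    simpa using hp
  -- `f` is the part of `∑ s i` lost to the indices below their scale; Markov's inequality for `f`.
  let f : Ω → ℝ := fun x => ∑ i ∈ t, s i * Set.indicator {x | X i x ^ 2 < θ ^ 2 * s i} 1 x
  have hfi : ∀ i ∈ t, Integrable
      (fun x => s i * Set.indicator {x | X i x ^ 2 < θ ^ 2 * s i} (1 : Ω → ℝ) x) μ := fun i hi =>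
    ((integrable_const (1 : ℝ)).indicator (hm i hi)).const_mul _
  have hf0 : 0 ≤ f := fun x => Finset.sum_nonneg fun i hi =>
    mul_nonneg (hs i hi) (Set.indicator_nonneg (fun _ _ => zero_le_one) x)
  have hfint : ∫ x, f x ∂μ ≤ p * ∑ i ∈ t, s i := by
    rw [integral_finsetSum _ hfi, Finset.mul_sum]
    refine Finset.sum_le_sum fun i hi => ?_
    rw [integral_const_mul, integral_indicator_one (hm i hi), mul_comm]
    exact mul_le_mul_of_nonneg_right (h i hi) (hs i hi)
  have hsub : {x | ∑ i ∈ t, X i x ^ 2 < θ ^ 2 / 2 * ∑ i ∈ t, s i}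
      ⊆ {x | (∑ i ∈ t, s i) / 2 ≤ f x} := by
    intro x hx
    simp only [Set.mem_ofPred_eq] at hx ⊢
    have h1 : θ ^ 2 * ∑ i ∈ t, s i ≤ ∑ i ∈ t, X i x ^ 2 + θ ^ 2 * f x := by
      simp only [f, Finset.mul_sum]
      rw [← Finset.sum_add_distrib]
      refine Finset.sum_le_sum fun i hi => ?_
      by_cases hc : X i x ^ 2 < θ ^ 2 * s i
      · rw [Set.indicator_of_mem (by exact hc)]
        simp only [Pi.one_apply, mul_one]
        linarith [sq_nonneg (X i x)]
      · rw [Set.indicator_of_notMem (by exact hc)]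
        simp only [mul_zero, add_zero]
        linarith
    have hθ : 0 < θ ^ 2 := by
      rcases (sq_nonneg θ).eq_or_lt with h0 | h0
      · rw [← h0] at hx
        have : 0 ≤ ∑ i ∈ t, X i x ^ 2 := Finset.sum_nonneg fun _ _ => sq_nonneg _
        linarith
      · exact h0
    by_contra! hcon
    nlinarith
  have hmk := mul_meas_ge_le_integral_of_nonneg (μ := μ) (Filter.Eventually.of_forall hf0)
    (integrable_finsetSum _ hfi) ((∑ i ∈ t, s i) / 2)
  have := measureReal_mono (μ := μ) hsub
  nlinarith

/-! ### Resampling part of the randomness -/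

section Resampling

variable {Ω Ω₁ Ω₂ : Type*} [MeasurableSpace Ω] [MeasurableSpace Ω₁] [MeasurableSpace Ω₂]
  {μ : Measure Ω} {μ₁ : Measure Ω₁} {μ₂ : Measure Ω₂} [IsProbabilityMeasure μ₁]
  [IsProbabilityMeasure μ₂]

/-- If a point of law `μ` is produced from two independent points by the map `T`, then the
probability of `E` is at most its conditional probability given the first point, up to an
exceptional set `S` (not assumed measurable) of first points. -/
lemma measureReal_le_of_sections_off {T : Ω₁ × Ω₂ → Ω} (hT : Measurable T)
    (hμ : (μ₁.prod μ₂).map T = μ) {E : Set Ω} (hE : MeasurableSet E) {p q : ℝ} (hp : 0 ≤ p)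
    {S : Set Ω₁} (hS : μ₁.real S ≤ q)
    (h : ∀ x ∉ S, μ₂.real {y | T (x, y) ∈ E} ≤ p) : μ.real E ≤ p + q := by
  have hq : 0 ≤ q := measureReal_nonneg.trans hS
  refine ENNReal.toReal_le_of_le_ofReal (by positivity) ?_
  rw [← hμ, Measure.map_apply hT hE, Measure.prod_apply (hT hE)]
  calc ∫⁻ x, μ₂ (Prod.mk x ⁻¹' (T ⁻¹' E)) ∂μ₁
      ≤ ∫⁻ x, (ENNReal.ofReal p + (toMeasurable μ₁ S).indicator 1 x) ∂μ₁ := by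
        refine lintegral_mono fun x => ?_
        by_cases hx : x ∈ toMeasurable μ₁ S
        · simp only [hx, Set.indicator_of_mem, Pi.one_apply]
          exact prob_le_one.trans le_add_self
        · have hx' : x ∉ S := fun h => hx (subset_toMeasurable _ _ h)
          refine le_trans ?_ le_self_add
          exact (ENNReal.le_ofReal_iff_toReal_le (measure_ne_top _ _) hp).2 (h x hx')
    _ = ENNReal.ofReal p + μ₁ S := by
        rw [lintegral_add_left measurable_const, lintegral_const, measure_univ, mul_one,
          lintegral_indicator_one (measurableSet_toMeasurable _ _), measure_toMeasurable]
    _ ≤ ENNReal.ofReal (p + q) := by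
        rw [ENNReal.ofReal_add hp hq]
        gcongr
        exact (ENNReal.le_ofReal_iff_toReal_le (measure_ne_top _ _) hq).2 hS

lemma measureReal_le_of_sections {T : Ω₁ × Ω₂ → Ω} (hT : Measurable T)
    (hμ : (μ₁.prod μ₂).map T = μ) {E : Set Ω} (hE : MeasurableSet E) {p : ℝ} (hp : 0 ≤ p)
    (h : ∀ x, μ₂.real {y | T (x, y) ∈ E} ≤ p) : μ.real E ≤ p := by
  have := measureReal_le_of_sections_off hT hμ hE hp (S := ∅) (q := 0) (by simp) (fun x _ => h x)
  simpa using this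

end Resampling

open Classical in
/-- Resampling the coordinates in `s`. -/
noncomputable def mix {ι : Type*} (s : Set ι) (p : (ι → ℝ) × (ι → ℝ)) : ι → ℝ :=
  fun i => if i ∈ s then p.2 i else p.1 i

lemma mix_of_mem {ι : Type*} {s : Set ι} {i : ι} (h : i ∈ s) (p : (ι → ℝ) × (ι → ℝ)) :
    mix s p i = p.2 i := by
  simp [mix, h]

lemma mix_of_notMem {ι : Type*} {s : Set ι} {i : ι} (h : i ∉ s) (p : (ι → ℝ) × (ι → ℝ)) :
    mix s p i = p.1 i := by
  simp [mix, h]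

@[fun_prop]
lemma measurable_mix {ι : Type*} (s : Set ι) :
    Measurable (mix s : (ι → ℝ) × (ι → ℝ) → ι → ℝ) := by
  refine measurable_pi_lambda _ fun i => ?_
  by_cases h : i ∈ s <;> simp only [mix, h, if_true, if_false] <;> fun_prop

lemma map_mix (s : Set ι) : ((stdGauss ι).prod (stdGauss ι)).map (mix s) = stdGauss ι := by
  classical
  refine map_prod_stdGauss (measurable_mix s) fun c =>
    ⟨fun i => if i ∈ s then 0 else c i, fun i => if i ∈ s then c i else 0, fun p => ?_, ?_⟩
  · rw [← Finset.sum_add_distrib]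
    refine Finset.sum_congr rfl fun i _ => ?_
    by_cases h : i ∈ s <;> simp [mix, h]
  · rw [← Finset.sum_add_distrib]
    refine Finset.sum_congr rfl fun i _ => ?_
    by_cases h : i ∈ s <;> simp [h]

lemma map_stdGauss_unit : (stdGauss Unit).map (fun t => t ()) = gaussianReal 0 1 := by
  have := map_linear_stdGauss (ι := Unit) 0 (fun _ => 1)
  simpa using this

/-- Resampling the component in the direction of a unit vector `y`. -/
lemma map_resample_direction {y : ι → ℝ} (hy : ∑ i, y i ^ 2 = 1) :
    ((stdGauss ι).prod (gaussianReal 0 1)).map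
      (fun p i => p.1 i - (∑ j, y j * p.1 j) * y i + p.2 * y i) = stdGauss ι := by
  rw [← map_stdGauss_unit]
  rw [show (stdGauss ι).prod ((stdGauss Unit).map fun t => t ())
    = ((stdGauss ι).prod (stdGauss Unit)).map (Prod.map id fun t => t ()) by
      rw [← Measure.map_prod_map _ _ measurable_id (by fun_prop), Measure.map_id]]
  rw [Measure.map_map (by fun_prop) (by fun_prop)]
  refine map_prod_stdGauss (by fun_prop) fun c =>
    ⟨fun i => c i - (∑ k, c k * y k) * y i, fun _ => ∑ k, c k * y k, fun p => ?_, ?_⟩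
  · simp only [Function.comp, Prod.map, id, mul_add, mul_sub, sub_mul, Finset.sum_add_distrib,
      Finset.sum_sub_distrib, Finset.univ_unique, Finset.sum_singleton]
    have e1 : ∑ x, c x * ((∑ j, y j * p.1 j) * y x)
        = (∑ k, c k * y k) * (∑ j, y j * p.1 j) := by
      rw [Finset.sum_mul]; exact Finset.sum_congr rfl fun _ _ => by ring
    have e2 : ∑ x, (∑ k, c k * y k) * y x * p.1 x
        = (∑ k, c k * y k) * (∑ j, y j * p.1 j) := by
      rw [Finset.mul_sum]; exact Finset.sum_congr rfl fun _ _ => by ring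
    have e3 : ∑ x, c x * (p.2 () * y x) = (∑ k, c k * y k) * p.2 () := by
      rw [Finset.sum_mul]; exact Finset.sum_congr rfl fun _ _ => by ring
    rw [e1, e2, e3]
  · set a := ∑ k, c k * y k with ha
    simp only [sub_sq, Finset.sum_add_distrib, Finset.sum_sub_distrib, mul_pow, ← Finset.mul_sum,
      hy, Finset.univ_unique, Finset.sum_singleton]
    have e2 : ∑ x, 2 * c x * (a * y x) = 2 * a * a := by
      conv_rhs => rw [ha, mul_assoc, Finset.sum_mul, Finset.mul_sum]
      exact Finset.sum_congr rfl fun _ _ => by ring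
    rw [e2]
    ring

/-- Replacing one coordinate of a product measure by an independent copy. -/
lemma map_pi_update {I : Type*} [Fintype I] [DecidableEq I] {α : I → Type*}
    [∀ i, MeasurableSpace (α i)] (μ : ∀ i, Measure (α i)) [∀ i, IsProbabilityMeasure (μ i)]
    (i : I) :
    ((Measure.pi μ).prod (μ i)).map (fun p => Function.update p.1 i p.2) = Measure.pi μ := by
  have hm : Measurable (fun p : (∀ i, α i) × α i => Function.update p.1 i p.2) := by
    refine measurable_pi_lambda _ fun j => ?_
    by_cases h : j = i
    · subst h; simpa using measurable_snd
    · simp only [Function.update_of_ne h]; fun_prop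
  refine (Measure.pi_eq fun s hs => ?_).symm
  rw [Measure.map_apply hm (MeasurableSet.univ_pi hs)]
  have : (fun p : (∀ i, α i) × α i => Function.update p.1 i p.2) ⁻¹' Set.univ.pi s
      = (Set.univ.pi (Function.update s i Set.univ)) ×ˢ s i := by
    ext p
    simp only [Set.mem_preimage, Set.mem_univ_pi, Set.mem_prod]
    constructor
    · intro h
      refine ⟨fun j => ?_, by simpa using h i⟩
      by_cases hj : j = i
      · subst hj; simp
      · simpa [Function.update_of_ne hj] using h j
    · rintro ⟨h1, h2⟩ j
      by_cases hj : j = i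
      · subst hj; simpa using h2
      · simpa [Function.update_of_ne hj] using h1 j
  rw [this, Measure.prod_prod, Measure.pi_pi, ← Finset.mul_prod_erase _ _ (Finset.mem_univ i),
    ← Finset.mul_prod_erase (a := i) _ (fun j => μ j (s j)) (Finset.mem_univ i)]
  simp only [Function.update_self, measure_univ, one_mul]
  rw [mul_comm]
  congr 1
  refine Finset.prod_congr rfl fun j hj => ?_
  rw [Function.update_of_ne (Finset.ne_of_mem_erase hj)]

end

/-! ### Second moments -/

section

variable {ι κ m : Type*} [Fintype ι] [Fintype κ] [Fintype m]

lemma markov_real {Ω : Type*} [MeasurableSpace Ω] {μ : Measure Ω}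
    {f : Ω → ℝ} (hf : 0 ≤ f) (hi : Integrable f μ) {a c : ℝ} (hc : 0 < c)
    (h : ∫ x, f x ∂μ ≤ a) : μ.real {x | c ≤ f x} ≤ a / c := by
  rw [le_div_iff₀ hc, mul_comm]
  exact (mul_meas_ge_le_integral_of_nonneg (Filter.Eventually.of_forall hf) hi c).trans h

lemma integrable_linear_sq (a : ℝ) (c : ι → ℝ) :
    Integrable (fun x => (a + ∑ i, c i * x i) ^ 2) (stdGauss ι) := by
  have h : Integrable (fun y : ℝ => y ^ 2)
      ((stdGauss ι).map (fun x => a + ∑ i, c i * x i)) := by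
    rw [map_linear_stdGauss]
    exact (memLp_id_gaussianReal' 2 (by simp)).integrable_sq
  exact h.comp_measurable (by fun_prop)

lemma integral_linear_sq (a : ℝ) (c : ι → ℝ) :
    ∫ x, (a + ∑ i, c i * x i) ^ 2 ∂(stdGauss ι) = a ^ 2 + ∑ i, c i ^ 2 := by
  have h0 : 0 ≤ ∑ i, c i ^ 2 := Finset.sum_nonneg fun _ _ => sq_nonneg _
  have h1 : ∫ x, (a + ∑ i, c i * x i) ^ 2 ∂(stdGauss ι)
      = ∫ y, y ^ 2 ∂(gaussianReal a (Real.toNNReal (∑ i, c i ^ 2))) := by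
    rw [← map_linear_stdGauss, integral_map (Measurable.aemeasurable (by fun_prop))
      (Measurable.aestronglyMeasurable (by fun_prop))]
  have h2 := variance_eq_sub
    (memLp_id_gaussianReal' (μ := a) (v := Real.toNNReal (∑ i, c i ^ 2)) 2 (by simp))
  rw [variance_id_gaussianReal, Real.coe_toNNReal _ h0] at h2
  simp only [Pi.pow_apply, id, integral_id_gaussianReal] at h2
  rw [h1]
  linarith

/-- Markov's inequality for a sum of squares of affine functionals of a Gaussian vector. -/
lemma sum_sq_large {α : Type*} (t : Finset α) {X : α → (ι → ℝ) → ℝ} {a : α → ℝ} {c : α → ι → ℝ}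
    (hX : ∀ i ∈ t, ∀ x, X i x = a i + ∑ j, c i j * x j) {S r : ℝ} (hS : 0 < S) (hr : 0 < r)
    (h : ∑ i ∈ t, (a i ^ 2 + ∑ j, c i j ^ 2) ≤ S) :
    (stdGauss ι).real {x | S / r ≤ ∑ i ∈ t, X i x ^ 2} ≤ r := by
  have he : (fun x => ∑ i ∈ t, X i x ^ 2) = fun x => ∑ i ∈ t, (a i + ∑ j, c i j * x j) ^ 2 := by
    ext x
    exact Finset.sum_congr rfl fun i hi => by rw [hX i hi]
  have hi : Integrable (fun x => ∑ i ∈ t, X i x ^ 2) (stdGauss ι) := by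
    rw [he]
    exact integrable_finsetSum _ fun i _ => integrable_linear_sq _ _
  have hint : ∫ x, ∑ i ∈ t, X i x ^ 2 ∂(stdGauss ι) ≤ S := by
    rw [he, integral_finsetSum _ fun i _ => integrable_linear_sq _ _]
    simp_rw [integral_linear_sq]
    exact h
  refine (markov_real (f := fun x => ∑ i ∈ t, X i x ^ 2)
    (fun x => Finset.sum_nonneg fun _ _ => sq_nonneg _) hi (by positivity) hint).trans
    (le_of_eq ?_)
  field_simp

/-! ### Quadratic polynomials of Gaussian vectors -/

lemma gaussianReal_real_le_of_dist {s : Set ℝ} {d : ℝ} (hd : 0 ≤ d)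
    (h : ∀ x ∈ s, ∀ y ∈ s, |x - y| ≤ d) : (gaussianReal 0 1).real s ≤ d := by
  rcases s.eq_empty_or_nonempty with rfl | ⟨x₀, hx₀⟩
  · simpa using hd
  refine (gaussianReal_real_le one_ne_zero (a := x₀ - d) (b := x₀ + d) (p := 1 / 2)
    (by linarith) (fun x hx => ?_) fun x _ => ?_).trans (le_of_eq (by ring))
  · have := abs_le.1 (h x hx x₀ hx₀)
    exact ⟨by linarith, by linarith⟩
  · refine (gaussianPDFReal_le x).trans ?_
    simp only [NNReal.coe_one, Real.sqrt_one, mul_one]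
    refine mul_le_of_le_one_right (by norm_num) ?_
    rw [Real.exp_le_one_iff]
    nlinarith [sq_nonneg (x - 0)]

/-- A quadratic polynomial `f` of a standard Gaussian variable is small with small probability,
relative to its derivative `β` at `0` only. Where `f'` is not small and has a given sign, the
identity `2 (f x - f y) = (x - y) (f' x + f' y)` shows that `{|f| < r}` has small diameter. -/
lemma gaussianReal_quadratic_small_ball (α β γ : ℝ) {θ : ℝ} (hθ : 0 < θ) :
    (gaussianReal 0 1).real {t | |α * t ^ 2 + β * t + γ| < θ ^ 2 * |β|} ≤ 8 * θ := by
  rcases eq_or_ne β 0 with rfl | hβ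
  · have : {t | |α * t ^ 2 + 0 * t + γ| < θ ^ 2 * |(0 : ℝ)|} = ∅ := by
      ext t; simp
    rw [this]
    simp [hθ.le]
  have hβ' : 0 < |β| := abs_pos.2 hβ
  set f : ℝ → ℝ := fun t => α * t ^ 2 + β * t + γ with hf
  -- The derivative of `f`.
  set z : ℝ → ℝ := fun t => β + 2 * α * t with hz
  have key : ∀ x y, |f x| < θ ^ 2 * |β| → |f y| < θ ^ 2 * |β| → 2 * θ * |β| ≤ |z x + z y| →
      |x - y| ≤ 2 * θ := by
    intro x y hx hy hxy
    have h1 : (x - y) * (z x + z y) = 2 * (f x - f y) := by simp only [hf, hz]; ring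
    have h2 : |x - y| * |z x + z y| ≤ 2 * (2 * (θ ^ 2 * |β|)) := by
      rw [← abs_mul, h1, abs_mul, abs_two]
      have := abs_sub (f x) (f y)
      linarith
    by_contra! hcon
    have := mul_lt_mul_of_pos_right hcon (by positivity : 0 < 2 * θ * |β|)
    have := mul_le_mul_of_nonneg_left hxy (abs_nonneg (x - y))
    nlinarith
  have h1 : (gaussianReal 0 1).real {t | z t ^ 2 < θ ^ 2 * β ^ 2} ≤ 4 * θ := by
    have := stdGauss_small_ball_mean (ι := Unit) (X := fun t => z (t ())) (m := β)
      (c := fun _ => 2 * α) (fun x => by simp [hz]) hθ.le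
    rw [← map_stdGauss_unit, map_measureReal_apply (by fun_prop)
      (measurableSet_lt (by fun_prop) (by fun_prop))]
    exact this
  have h2 : (gaussianReal 0 1).real {t | |f t| < θ ^ 2 * |β| ∧ θ * |β| ≤ z t} ≤ 2 * θ := by
    refine gaussianReal_real_le_of_dist (by positivity) fun x hx y hy => key x y hx.1 hy.1 ?_
    exact le_trans (by linarith [hx.2, hy.2]) (le_abs_self _)
  have h3 : (gaussianReal 0 1).real {t | |f t| < θ ^ 2 * |β| ∧ z t ≤ -(θ * |β|)} ≤ 2 * θ := by
    refine gaussianReal_real_le_of_dist (by positivity) fun x hx y hy => key x y hx.1 hy.1 ?_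
    exact le_trans (by linarith [hx.2, hy.2]) (neg_le_abs _)
  have hsub : {t | |f t| < θ ^ 2 * |β|} ⊆ {t | z t ^ 2 < θ ^ 2 * β ^ 2} ∪
      ({t | |f t| < θ ^ 2 * |β| ∧ θ * |β| ≤ z t} ∪
        {t | |f t| < θ ^ 2 * |β| ∧ z t ≤ -(θ * |β|)}) := by
    intro t ht
    simp only [Set.mem_union, Set.mem_ofPred_eq] at ht ⊢
    by_contra! hcon
    obtain ⟨c1, c2, c3⟩ := hcon
    have c2 := c2 ht
    have c3 := c3 ht
    have := sq_lt_sq' c3 c2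
    rw [mul_pow, sq_abs] at this
    linarith
  refine (measureReal_mono hsub).trans ((measureReal_union_le _ _).trans ?_)
  have := measureReal_union_le (μ := gaussianReal 0 1)
    {t | |f t| < θ ^ 2 * |β| ∧ θ * |β| ≤ z t} {t | |f t| < θ ^ 2 * |β| ∧ z t ≤ -(θ * |β|)}
  linarith

lemma dotProduct_mulVec_comm {K : Matrix κ κ ℝ} (hK : Kᵀ = K) (u v : κ → ℝ) :
    u ⬝ᵥ K *ᵥ v = v ⬝ᵥ K *ᵥ u := by
  rw [dotProduct_mulVec, ← mulVec_transpose, hK, dotProduct_comm]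

lemma measurable_dotProduct_mulVec {Ω : Type*} [MeasurableSpace Ω] (K : Matrix κ κ ℝ)
    {w : Ω → κ → ℝ} (hw : Measurable w) : Measurable fun x => w x ⬝ᵥ K *ᵥ w x := by
  simp only [dotProduct, mulVec]
  fun_prop

/-- Around a point `w` the quadratic form of `K` has a gradient of size `2 ‖K w‖`, and it spreads
out accordingly under a Gaussian perturbation. -/
lemma quadratic_form_small_ball_aux {K : Matrix κ κ ℝ} (hK : Kᵀ = K) (w : κ → ℝ) (h s a : ℝ)
    (hs : 0 ≤ s) (ha : 0 < a) (hwa : ∑ i, (K *ᵥ w) i ^ 2 = a ^ 2) {θ : ℝ} (hθ : 0 < θ) :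
    (stdGauss κ).real
      {g | |h - (w + s • g) ⬝ᵥ K *ᵥ (w + s • g)| < θ ^ 3 * (2 * s * a)} ≤ 12 * θ := by
  -- The unit vector `y` along the gradient at `w`; only the component along `y` is used.
  set y : κ → ℝ := a⁻¹ • (K *ᵥ w) with hy
  have hyy : ∑ i, y i ^ 2 = 1 := by
    simp only [hy, Pi.smul_apply, smul_eq_mul, mul_pow, ← Finset.mul_sum, hwa]
    field_simp
  have hyKw : y ⬝ᵥ K *ᵥ w = a := by
    rw [hy, smul_dotProduct, smul_eq_mul]
    have : (K *ᵥ w) ⬝ᵥ K *ᵥ w = a ^ 2 := by rw [← hwa]; simp [dotProduct, sq]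
    rw [this]
    field_simp
  -- `P g` is the component of `g` orthogonal to `y`, and `β g` the derivative at `w + s P g` in the
  -- direction `s y`. It is an affine functional of `g` with mean `2 s a`.
  set P : (κ → ℝ) → κ → ℝ := fun g i => g i - (∑ j, y j * g j) * y i with hP
  set β : (κ → ℝ) → ℝ := fun g => 2 * s * (y ⬝ᵥ K *ᵥ (w + s • P g)) with hβ
  have hβlin : ∀ g, β g = 2 * s * a +
      ∑ j, (2 * s ^ 2 * ((K *ᵥ y) j - (y ⬝ᵥ K *ᵥ y) * y j)) * g j := by
    intro g
    have e0 : P g = g - (y ⬝ᵥ g) • y := by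
      ext i; simp [hP, dotProduct]
    have e1 : y ⬝ᵥ K *ᵥ g = ∑ j, (K *ᵥ y) j * g j := by
      rw [dotProduct_mulVec_comm hK, dotProduct_comm]; rfl
    simp only [hβ, e0, mulVec_add, mulVec_smul, mulVec_sub, dotProduct_add, dotProduct_smul,
      dotProduct_sub, hyKw, smul_eq_mul, e1]
    simp only [mul_assoc, sub_mul, ← Finset.mul_sum, Finset.sum_sub_distrib]
    simp only [dotProduct]
    ring
  have hS : (stdGauss κ).real {g | β g ^ 2 < θ ^ 2 * (2 * s * a) ^ 2} ≤ 4 * θ :=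
    stdGauss_small_ball_mean hβlin hθ.le
  have hT : Measurable
      (fun (p : (κ → ℝ) × ℝ) i => p.1 i - (∑ j, y j * p.1 j) * y i + p.2 * y i) := by
    fun_prop
  have hE : MeasurableSet
      {g | |h - (w + s • g) ⬝ᵥ K *ᵥ (w + s • g)| < θ ^ 3 * (2 * s * a)} := by
    have := measurable_dotProduct_mulVec K (w := fun g : κ → ℝ => w + s • g) (by fun_prop)
    exact measurableSet_lt (by fun_prop) measurable_const
  have := measureReal_le_of_sections_off hT (map_resample_direction hyy) hE
    (p := 8 * θ) (by positivity) hS fun g hg => ?_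
  · linarith
  simp only [Set.mem_ofPred_eq, not_lt] at hg
  set u := w + s • P g with hu
  refine (measureReal_mono fun t ht => ?_).trans
    (gaussianReal_quadratic_small_ball (-(s ^ 2 * (y ⬝ᵥ K *ᵥ y))) (-(β g)) (h - u ⬝ᵥ K *ᵥ u) hθ)
  simp only [Set.mem_ofPred_eq] at ht ⊢
  have e : w + s • (fun i => g i - (∑ j, y j * g j) * y i + t * y i) = u + (s * t) • y := by
    ext i
    simp only [hu, hP, Pi.add_apply, Pi.smul_apply, smul_eq_mul]
    ring
  rw [e] at ht
  have e2 : h - (u + (s * t) • y) ⬝ᵥ K *ᵥ (u + (s * t) • y)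
      = -(s ^ 2 * (y ⬝ᵥ K *ᵥ y)) * t ^ 2 + -(β g) * t + (h - u ⬝ᵥ K *ᵥ u) := by
    simp only [mulVec_add, mulVec_smul, dotProduct_add, add_dotProduct, dotProduct_smul,
      smul_dotProduct, smul_eq_mul]
    rw [dotProduct_mulVec_comm hK u y, show β g = 2 * s * (y ⬝ᵥ K *ᵥ u) from rfl]
    ring
  rw [e2] at ht
  refine ht.trans_le ?_
  have : θ * (2 * s * a) ≤ |β g| := by
    refine (pow_le_pow_iff_left₀ (by positivity) (abs_nonneg _) two_ne_zero).1 ?_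
    rw [mul_pow, sq_abs]; exact hg
  rw [abs_neg]
  nlinarith [sq_nonneg θ]

/-- Small ball estimate for a quadratic form `wᵀ K w` of a Gaussian vector `w = w₀ + σ g`. The
scale is `σ (‖K w₀‖² + σ² ‖K‖²)^{1/2}` with the Frobenius norm of `K`. -/
lemma quadratic_form_small_ball {K : Matrix κ κ ℝ} (hK : Kᵀ = K) (w₀ : κ → ℝ) (h σ ρ : ℝ)
    (hσ : 0 ≤ σ) (hρ : 0 < ρ)
    (hρ' : ρ ^ 2 ≤ ∑ i, ((K *ᵥ w₀) i ^ 2 + σ ^ 2 * ∑ j, K i j ^ 2)) {θ : ℝ} (hθ : 0 < θ) :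
    (stdGauss κ).real
      {g | |h - (w₀ + σ • g) ⬝ᵥ K *ᵥ (w₀ + σ • g)| < θ ^ 4 * σ * ρ / 2} ≤ 32 * θ := by
  have h2 : (0 : ℝ) < √2 := by positivity
  have h22 : √2 ^ 2 = (2 : ℝ) := Real.sq_sqrt (by norm_num)
  -- Write `g = (g₁ + g₂) / √2` with independent `g₁` and `g₂`: the first makes the gradient
  -- `2 K w` at `w = w₀ + s g₁` large, and the second makes the form fluctuate around `w`.
  set s := σ / √2 with hs
  have hs0 : 0 ≤ s := by positivity
  have hs2 : s ^ 2 = σ ^ 2 / 2 := by rw [hs, div_pow, h22]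
  have hT : Measurable (fun (p : (κ → ℝ) × (κ → ℝ)) i => (√2)⁻¹ * p.1 i + (√2)⁻¹ * p.2 i) := by
    fun_prop
  have hmap : ((stdGauss κ).prod (stdGauss κ)).map
      (fun p i => (√2)⁻¹ * p.1 i + (√2)⁻¹ * p.2 i) = stdGauss κ := by
    refine map_prod_stdGauss hT fun c =>
      ⟨fun i => (√2)⁻¹ * c i, fun i => (√2)⁻¹ * c i, fun p => ?_, ?_⟩
    · rw [← Finset.sum_add_distrib]
      exact Finset.sum_congr rfl fun i _ => by ring
    · simp only [mul_pow, inv_pow, h22, ← Finset.mul_sum]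
      ring
  have hE : MeasurableSet
      {g | |h - (w₀ + σ • g) ⬝ᵥ K *ᵥ (w₀ + σ • g)| < θ ^ 4 * σ * ρ / 2} := by
    have := measurable_dotProduct_mulVec K (w := fun g : κ → ℝ => w₀ + σ • g) (by fun_prop)
    exact measurableSet_lt (by fun_prop) measurable_const
  have hlin : ∀ i (g : κ → ℝ), (K *ᵥ (w₀ + s • g)) i
      = (K *ᵥ w₀) i + ∑ j, (s * K i j) * g j := by
    intro i g
    simp only [mulVec_add, mulVec_smul, Pi.add_apply, Pi.smul_apply, smul_eq_mul]
    simp only [mulVec, dotProduct, Finset.mul_sum, mul_assoc]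
  have hS : (stdGauss κ).real {g | ∑ i, (K *ᵥ (w₀ + s • g)) i ^ 2
      < θ ^ 2 / 2 * ∑ i, ((K *ᵥ w₀) i ^ 2 + ∑ j, (s * K i j) ^ 2)} ≤ 2 * (10 * θ) := by
    refine sum_sq_small_ball Finset.univ (X := fun i g => (K *ᵥ (w₀ + s • g)) i) (fun i _ => ?_)
      (fun i _ => add_nonneg (sq_nonneg _) (Finset.sum_nonneg fun _ _ => sq_nonneg _))
      (by positivity) fun i _ => stdGauss_small_ball_both (hlin i) hθ.le
    simp only [hlin]
    fun_prop
  have := measureReal_le_of_sections_off hT hmap hE (p := 12 * θ) (by positivity) hS fun g hg => ?_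
  · linarith
  simp only [Set.mem_ofPred_eq, not_lt] at hg
  have hg' : (θ * ρ / 2) ^ 2 ≤ ∑ i, (K *ᵥ (w₀ + s • g)) i ^ 2 := by
    have e : ∑ i, ((K *ᵥ w₀) i ^ 2 + σ ^ 2 * ∑ j, K i j ^ 2)
        ≤ 2 * ∑ i, ((K *ᵥ w₀) i ^ 2 + ∑ j, (s * K i j) ^ 2) := by
      rw [Finset.mul_sum]
      refine Finset.sum_le_sum fun i _ => ?_
      simp only [mul_pow, ← Finset.mul_sum, hs2]
      nlinarith [sq_nonneg ((K *ᵥ w₀) i)]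
    nlinarith [sq_nonneg θ]
  set a := √(∑ i, (K *ᵥ (w₀ + s • g)) i ^ 2) with ha
  have ha2 : ∑ i, (K *ᵥ (w₀ + s • g)) i ^ 2 = a ^ 2 :=
    (Real.sq_sqrt (Finset.sum_nonneg fun _ _ => sq_nonneg _)).symm
  have hale : θ * ρ / 2 ≤ a := Real.le_sqrt_of_sq_le hg'
  have ha0 : 0 < a := lt_of_lt_of_le (by positivity) hale
  refine (measureReal_mono fun g' hg' => ?_).trans
    (quadratic_form_small_ball_aux hK (w₀ + s • g) h s a hs0 ha0 ha2 hθ)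
  simp only [Set.mem_ofPred_eq] at hg' ⊢
  have e : w₀ + σ • (fun i => (√2)⁻¹ * g i + (√2)⁻¹ * g' i) = w₀ + s • g + s • g' := by
    ext i
    simp only [hs, Pi.add_apply, Pi.smul_apply, smul_eq_mul]
    ring
  rw [e] at hg'
  refine hg'.trans_le ?_
  have h3 : σ ≤ 2 * s := by
    have : √2 ≤ 2 := by nlinarith [Real.sqrt_nonneg 2]
    rw [hs]
    field_simp
    nlinarith
  have h4 : σ * (θ * ρ / 2) ≤ 2 * s * a := mul_le_mul h3 hale (by positivity) (by positivity)
  have := mul_le_mul_of_nonneg_left h4 (by positivity : 0 ≤ θ ^ 3)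
  nlinarith

end

/-! ### Schur complements of Gaussian symmetric matrices -/

section

variable {ι κ m : Type*} [Fintype ι] [Fintype κ] [Fintype m]

section Measurability

variable {Ω : Type*} [MeasurableSpace Ω]

lemma measurable_det_of_entries [DecidableEq m] {A : Ω → Matrix m m ℝ}
    (hA : ∀ i j, Measurable fun x => A x i j) : Measurable fun x => (A x).det := by
  simp only [Matrix.det_apply']
  fun_prop

lemma measurable_inv_of_entries [DecidableEq m] {A : Ω → Matrix m m ℝ}
    (hA : ∀ i j, Measurable fun x => A x i j) (i j : m) : Measurable fun x => (A x)⁻¹ i j := by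
  simp only [Matrix.inv_def, Ring.inverse_eq_inv', Matrix.smul_apply, smul_eq_mul,
    Matrix.adjugate_apply]
  refine (measurable_det_of_entries hA).inv.mul (measurable_det_of_entries fun a b => ?_)
  simp only [Matrix.updateRow_apply]
  by_cases h : a = j
  · simp [h]
  · simpa [h] using hA a b

lemma measurable_mul_of_entries {l n : Type*} {A : Ω → Matrix l m ℝ} {B : Ω → Matrix m n ℝ}
    (hA : ∀ i j, Measurable fun x => A x i j) (hB : ∀ i j, Measurable fun x => B x i j)
    (i : l) (j : n) : Measurable fun x => (A x * B x) i j := by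
  simp only [Matrix.mul_apply]
  fun_prop

end Measurability

lemma finite_det_add_smul_one_eq_zero [DecidableEq m] (A : Matrix m m ℝ) :
    {t : ℝ | (A + t • (1 : Matrix m m ℝ)).det = 0}.Finite := by
  refine ((-A).charpoly.roots.toFinset.finite_toSet).subset fun t ht => ?_
  simp only [Finset.mem_coe, Multiset.mem_toFinset,
    Polynomial.mem_roots (Matrix.charpoly_monic _).ne_zero, Polynomial.IsRoot.def,
    Matrix.eval_charpoly]
  rw [← ht.out]
  congr 1
  rw [sub_neg_eq_add, add_comm, Matrix.smul_one_eq_diagonal, Matrix.scalar_apply]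

/-- A Gaussian matrix that can be shifted by multiples of the identity is almost surely
invertible: its determinant is a nonzero polynomial along each line in that direction. -/
lemma stdGauss_det_eq_zero [DecidableEq m] {A : (ι → ℝ) → Matrix m m ℝ}
    (hA : ∀ i j, Measurable fun x => A x i j) {c : ι → ℝ} (hc : 0 < ∑ i, c i ^ 2)
    (h : ∀ (x : ι → ℝ) (t : ℝ), A (x + t • c) = A x + t • (1 : Matrix m m ℝ)) :
    (stdGauss ι).real {x | (A x).det = 0} = 0 := by
  set r := √(∑ i, c i ^ 2) with hr
  have hr0 : 0 < r := Real.sqrt_pos.2 hc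
  have hr2 : r ^ 2 = ∑ i, c i ^ 2 := Real.sq_sqrt hc.le
  set y : ι → ℝ := r⁻¹ • c with hy
  have hyy : ∑ i, y i ^ 2 = 1 := by
    simp only [hy, Pi.smul_apply, smul_eq_mul, mul_pow, ← Finset.mul_sum, ← hr2]
    field_simp
  refine le_antisymm ?_ measureReal_nonneg
  refine measureReal_le_of_sections (T := fun (p : (ι → ℝ) × ℝ) i =>
    p.1 i - (∑ j, y j * p.1 j) * y i + p.2 * y i) (by fun_prop) (map_resample_direction hyy)
    ((measurable_det_of_entries hA) (measurableSet_singleton 0)) le_rfl fun x => ?_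
  set u : ι → ℝ := fun i => x i - (∑ j, y j * x j) * y i with hu
  have : NullSingletonClass (gaussianReal (0 : ℝ) 1) := nullSingletonClass_gaussianReal one_ne_zero
  have hfin : ({t : ℝ | (A u + (t * r⁻¹) • (1 : Matrix m m ℝ)).det = 0}).Finite :=
    (finite_det_add_smul_one_eq_zero (A u)).preimage
      (mul_left_injective₀ (inv_ne_zero hr0.ne')).injOn
  rw [measureReal_def]
  refine (ENNReal.toReal_eq_zero_iff _).2 (Or.inl ?_) |>.le
  refine measure_mono_null (fun t ht => ?_) (hfin.measure_zero (gaussianReal 0 1))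
  have e : (fun i => x i - (∑ j, y j * x j) * y i + t * y i) = u + (t * r⁻¹) • c := by
    ext i
    simp only [hu, hy, Pi.add_apply, Pi.smul_apply, smul_eq_mul]
    ring
  simp only [Set.mem_ofPred_eq, e] at ht ⊢
  rw [← h]
  exact ht

/-- The matrix `τ (X + Xᵀ) + F`, where `X` is given by its entries, as a function on `m × m`. For a
standard Gaussian `X` and symmetric `F` it is a Gaussian perturbation of `F` whose law is that of
the Gaussian orthogonal ensemble, up to scale. -/
def symMat {m : Type*} (τ : ℝ) (F : Matrix m m ℝ) (X : m × m → ℝ) : Matrix m m ℝ :=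
  Matrix.of fun i j => τ * (X (i, j) + X (j, i)) + F i j

lemma symMat_apply {m : Type*} (τ : ℝ) (F : Matrix m m ℝ) (X : m × m → ℝ) (i j : m) :
    symMat τ F X i j = τ * (X (i, j) + X (j, i)) + F i j := rfl

lemma measurable_symMat {m : Type*} (τ : ℝ) (F : Matrix m m ℝ) (i j : m) :
    Measurable fun X => symMat τ F X i j := by
  simp only [symMat_apply]
  fun_prop

lemma symMat_transpose {m : Type*} {τ : ℝ} {F : Matrix m m ℝ} (hF : Fᵀ = F) (X : m × m → ℝ) :
    (symMat τ F X)ᵀ = symMat τ F X := by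
  ext i j
  simp only [Matrix.transpose_apply, symMat_apply]
  rw [← Matrix.transpose_apply F, hF, add_comm (X (j, i))]

/-- The first column of the inverse of a bordered matrix, by its Schur complement. -/
lemma inv_apply_zero_of_schur {n : ℕ} {H : Matrix (Fin (n + 1)) (Fin (n + 1)) ℝ} (hH : Hᵀ = H)
    {H' : Matrix (Fin n) (Fin n) ℝ} (hH' : ∀ i j, H' i j = H i.succ j.succ) (hdet : H'.det ≠ 0)
    (hdetH : H.det ≠ 0) {w : Fin n → ℝ} (hw : ∀ j, w j = H 0 j.succ) {s : ℝ}
    (hs : s = H 0 0 - w ⬝ᵥ H'⁻¹ *ᵥ w) (hs0 : s ≠ 0) :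
    ∑ i, H⁻¹ i 0 ^ 2 = (1 + ∑ i, (H'⁻¹ *ᵥ w) i ^ 2) / s ^ 2 := by
  have hz : H' *ᵥ (H'⁻¹ *ᵥ w) = w := by
    rw [mulVec_mulVec, mul_nonsing_inv _ (isUnit_iff_ne_zero.2 hdet), one_mulVec]
  generalize H'⁻¹ *ᵥ w = z at hs hz ⊢
  set x : Fin (n + 1) → ℝ := Fin.cons s⁻¹ (fun j => -(s⁻¹ * z j)) with hx
  have hsymm : ∀ i j, H i j = H j i := fun i j => by
    conv_lhs => rw [← hH]
    rfl
  have hsum : ∀ a : Fin n → ℝ, ∑ j, a j * -(s⁻¹ * z j) = -(s⁻¹ * (a ⬝ᵥ z)) := fun a => by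
    simp only [dotProduct, Finset.mul_sum, ← Finset.sum_neg_distrib]
    exact Finset.sum_congr rfl fun j _ => by ring
  have hmul : H *ᵥ x = Pi.single 0 1 := by
    ext i
    refine Fin.cases ?_ (fun i => ?_) i
    · change ∑ j, H 0 j * x j = _
      simp only [Fin.sum_univ_succ, hx, Fin.cons_zero, Fin.cons_succ, Pi.single_eq_same, ← hw]
      rw [hsum, show H 0 0 * s⁻¹ + -(s⁻¹ * (w ⬝ᵥ z)) = s⁻¹ * (H 0 0 - w ⬝ᵥ z) by ring, ← hs,
        inv_mul_cancel₀ hs0]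
    · change ∑ j, H i.succ j * x j = _
      simp only [Fin.sum_univ_succ, hx, Fin.cons_zero, Fin.cons_succ,
        Pi.single_eq_of_ne (Fin.succ_ne_zero i), ← hH']
      have h2 : H' i ⬝ᵥ z = w i := congrFun hz i
      rw [hsum, h2, hsymm, ← hw]
      ring
  have hinv : ∀ i, H⁻¹ i 0 = x i := by
    intro i
    have h1 : H⁻¹ *ᵥ (H *ᵥ x) = x := by
      rw [mulVec_mulVec, nonsing_inv_mul _ (isUnit_iff_ne_zero.2 hdetH), one_mulVec]
    rw [← h1, hmul, mulVec_single_one]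
    rfl
  simp only [hinv, Fin.sum_univ_succ, hx, Fin.cons_zero, Fin.cons_succ, neg_sq, mul_pow,
    ← Finset.mul_sum]
  field_simp

/-- The off-diagonal part of the first row of `(X + Xᵀ) / √2` is a standard Gaussian vector. -/
lemma map_border_stdGauss (n : ℕ) :
    (stdGauss (Fin (n + 1) × Fin (n + 1))).map
      (fun X (j : Fin n) => (√2)⁻¹ * (X (0, j.succ) + X (j.succ, 0))) = stdGauss (Fin n) := by
  have h22 : √2 ^ 2 = (2 : ℝ) := Real.sq_sqrt (by norm_num)
  refine map_stdGauss (by fun_prop) fun c =>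
    ⟨fun p => Fin.cases (Fin.cases 0 (fun j => (√2)⁻¹ * c j) p.2)
      (fun i => Fin.cases ((√2)⁻¹ * c i) (fun _ => 0) p.2) p.1, fun X => ?_, ?_⟩
  · simp only [Fintype.sum_prod_type, Fin.sum_univ_succ, Fin.cases_zero, Fin.cases_succ, zero_mul,
      Finset.sum_const_zero, zero_add, add_zero]
    rw [← Finset.sum_add_distrib]
    exact Finset.sum_congr rfl fun j _ => by ring
  · simp only [Fintype.sum_prod_type, Fin.sum_univ_succ, Fin.cases_zero, Fin.cases_succ, ne_eq,
      OfNat.ofNat_ne_zero, not_false_eq_true, zero_pow, Finset.sum_const_zero, zero_add, add_zero]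
    rw [← Finset.sum_add_distrib]
    refine Finset.sum_congr rfl fun j _ => ?_
    rw [mul_pow, inv_pow, h22]
    ring

/-- The Schur complement `s = h - wᵀ K w` is unlikely to be small relative to
`(1 + ‖K w‖²)^{1/2}`: when `K` is small this is due to the fluctuations of `h`, and otherwise to
those of `w`. -/
lemma schur_small_ball {n : ℕ} {K : Matrix (Fin n) (Fin n) ℝ} (hK : Kᵀ = K) (w₀ : Fin n → ℝ)
    (h₀ : ℝ) {τ θ : ℝ} (hτ : 0 < τ) (hθ : 0 < θ) (hθ1 : θ ≤ 1)
    {w : (Fin (n + 1) × Fin (n + 1) → ℝ) → Fin n → ℝ}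
    (hw : ∀ X j, w X j = τ * (X (0, j.succ) + X (j.succ, 0)) + w₀ j) :
    (stdGauss (Fin (n + 1) × Fin (n + 1))).real
      {X | 4 * (τ * (X (0, 0) + X (0, 0)) + h₀ - w X ⬝ᵥ K *ᵥ w X) ^ 2
        < θ ^ 10 * τ ^ 2 * (1 + ∑ i, (K *ᵥ w X) i ^ 2)} ≤ 33 * θ := by
  have h22 : √2 ^ 2 = (2 : ℝ) := Real.sq_sqrt (by norm_num)
  set g : (Fin (n + 1) × Fin (n + 1) → ℝ) → Fin n → ℝ :=
    fun X j => (√2)⁻¹ * (X (0, j.succ) + X (j.succ, 0)) with hg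
  have hgm : Measurable g := by fun_prop
  have hmap : (stdGauss (Fin (n + 1) × Fin (n + 1))).map g = stdGauss (Fin n) :=
    map_border_stdGauss n
  set σ := √2 * τ with hσ
  have hσ0 : 0 < σ := by positivity
  have hσ2 : σ ^ 2 = 2 * τ ^ 2 := by rw [hσ, mul_pow, h22]
  have hwg : ∀ X, w X = w₀ + σ • g X := by
    intro X
    ext j
    simp only [hw, hσ, hg, Pi.add_apply, Pi.smul_apply, smul_eq_mul]
    field_simp
    ring
  have hwm : Measurable w := by
    rw [show w = fun X => w₀ + σ • g X from funext hwg]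
    fun_prop
  -- The expectation of `‖K w‖²`.
  set R := ∑ i, ((K *ᵥ w₀) i ^ 2 + σ ^ 2 * ∑ j, K i j ^ 2) with hR
  have hR0 : 0 ≤ R := Finset.sum_nonneg fun i _ => by positivity
  have hbad1 : (stdGauss (Fin (n + 1) × Fin (n + 1))).real
      {X | max R 1 / θ ^ 2 ≤ ∑ i, (K *ᵥ w X) i ^ 2} ≤ θ := by
    have hlin : ∀ i (x : Fin n → ℝ), (K *ᵥ (w₀ + σ • x)) i
        = (K *ᵥ w₀) i + ∑ j, (σ * K i j) * x j := by
      intro i x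
      simp only [mulVec_add, mulVec_smul, Pi.add_apply, Pi.smul_apply, smul_eq_mul]
      simp only [mulVec, dotProduct, Finset.mul_sum, mul_assoc]
    have := sum_sq_large (ι := Fin n) Finset.univ (X := fun i x => (K *ᵥ (w₀ + σ • x)) i)
      (fun i _ x => hlin i x) (S := max R 1) (r := θ ^ 2) (by positivity) (by positivity)
      (le_trans (le_of_eq (by simp only [mul_pow, ← Finset.mul_sum, hR])) (le_max_left R 1))
    rw [← hmap, map_measureReal_apply hgm] at this
    · simp only [hwg]
      exact this.trans (by nlinarith)
    · simp only [hlin]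
      exact measurableSet_le (by fun_prop) (by fun_prop)
  rcases le_or_gt 1 R with hR1 | hR1
  -- Here the quadratic form fluctuates on the scale `σ √R`, whatever the value of `h`.
  · have hbad2 : (stdGauss (Fin (n + 1) × Fin (n + 1))).real
        {X | |τ * (X (0, 0) + X (0, 0)) + h₀ - w X ⬝ᵥ K *ᵥ w X| < θ ^ 4 * σ * √R / 2}
        ≤ 32 * θ := by
      have hm := measurable_dotProduct_mulVec K hwm
      refine measureReal_le_of_sections (measurable_mix {((0 : Fin (n + 1)), (0 : Fin (n + 1)))}ᶜ)
        (map_mix _) (measurableSet_lt (by fun_prop) measurable_const) (by positivity) fun X => ?_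
      have := quadratic_form_small_ball hK w₀ (τ * (X (0, 0) + X (0, 0)) + h₀) σ (√R) hσ0.le
        (by positivity) (Real.sq_sqrt hR0).le hθ
      rw [← hmap, map_measureReal_apply hgm] at this
      · refine (measureReal_mono fun Y hY => ?_).trans this
        have hwY : w (mix {((0 : Fin (n + 1)), (0 : Fin (n + 1)))}ᶜ (X, Y)) = w Y := by
          ext j
          rw [hw, hw, mix_of_mem (by simp), mix_of_mem (by simp)]
        simp only [Set.mem_ofPred_eq, Set.mem_preimage, hwY] at hY ⊢
        rw [mix_of_notMem (by simp)] at hY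
        rwa [← hwg]
      · have := measurable_dotProduct_mulVec K (w := fun x : Fin n → ℝ => w₀ + σ • x) (by fun_prop)
        exact measurableSet_lt (by fun_prop) measurable_const
    refine (measureReal_mono (fun X hX => ?_)).trans ((measureReal_union_le _ _).trans
      ((add_le_add hbad1 hbad2).trans (by linarith)))
    simp only [Set.mem_union, Set.mem_ofPred_eq] at hX ⊢
    by_contra! hcon
    obtain ⟨c1, c2⟩ := hcon
    rw [max_eq_left hR1] at c1
    have c3 : (θ ^ 4 * σ * √R / 2) ^ 2 ≤
        (τ * (X (0, 0) + X (0, 0)) + h₀ - w X ⬝ᵥ K *ᵥ w X) ^ 2 := by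
      rw [← sq_abs (τ * (X (0, 0) + X (0, 0)) + h₀ - w X ⬝ᵥ K *ᵥ w X)]
      exact pow_le_pow_left₀ (by positivity) c2 2
    rw [div_pow, mul_pow, mul_pow, hσ2, Real.sq_sqrt hR0] at c3
    rw [lt_div_iff₀ (by positivity)] at c1
    have c4 : θ ^ 10 * τ ^ 2 ≤ θ ^ 8 * τ ^ 2 * R := by
      have : θ ^ 10 ≤ θ ^ 8 := pow_le_pow_of_le_one hθ.le hθ1 (by norm_num)
      calc θ ^ 10 * τ ^ 2 ≤ θ ^ 8 * τ ^ 2 * 1 := by rw [mul_one]; gcongr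
        _ ≤ _ := by gcongr
    have c5 := mul_le_mul_of_nonneg_left c1.le (by positivity : 0 ≤ θ ^ 8 * τ ^ 2)
    nlinarith
  -- Here the fluctuations of `h` alone, on the scale `τ`, suffice.
  · have hbad3 : (stdGauss (Fin (n + 1) × Fin (n + 1))).real
        {X | (τ * (X (0, 0) + X (0, 0)) + h₀ - w X ⬝ᵥ K *ᵥ w X) ^ 2 < θ ^ 2 * (2 * τ) ^ 2}
        ≤ θ := by
      have hm := measurable_dotProduct_mulVec K hwm
      refine measureReal_le_of_sections (measurable_mix {((0 : Fin (n + 1)), (0 : Fin (n + 1)))})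
        (map_mix _) (measurableSet_lt (by fun_prop) measurable_const) hθ.le fun X => ?_
      refine (measureReal_mono fun Y hY => ?_).trans (stdGauss_small_ball
        (X := fun Y => τ * (Y ((0 : Fin (n + 1)), (0 : Fin (n + 1))) + Y (0, 0)) + h₀
          - w X ⬝ᵥ K *ᵥ w X) (m := h₀ - w X ⬝ᵥ K *ᵥ w X)
        (c := Pi.single ((0 : Fin (n + 1)), (0 : Fin (n + 1))) (2 * τ)) (fun Y => ?_)
        (s := (2 * τ) ^ 2) hθ.le ?_)
      · have hwY : w (mix {((0 : Fin (n + 1)), (0 : Fin (n + 1)))} (X, Y)) = w X := by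
          ext j
          rw [hw, hw, mix_of_notMem (by simp [Fin.succ_ne_zero]),
            mix_of_notMem (by simp [Fin.succ_ne_zero])]
        simp only [Set.mem_ofPred_eq, hwY] at hY ⊢
        rwa [mix_of_mem (by simp)] at hY
      · rw [Finset.sum_eq_single ((0 : Fin (n + 1)), (0 : Fin (n + 1)))
          (fun b _ hb => by rw [Pi.single_eq_of_ne hb, zero_mul]) (by simp), Pi.single_eq_same]
        ring
      · rw [Finset.sum_eq_single ((0 : Fin (n + 1)), (0 : Fin (n + 1)))
          (fun b _ hb => by rw [Pi.single_eq_of_ne hb]; simp) (by simp), Pi.single_eq_same]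
    refine (measureReal_mono (fun X hX => ?_)).trans ((measureReal_union_le _ _).trans
      ((add_le_add hbad1 hbad3).trans (by linarith)))
    simp only [Set.mem_union, Set.mem_ofPred_eq] at hX ⊢
    by_contra! hcon
    obtain ⟨c1, c2⟩ := hcon
    rw [max_eq_right hR1.le, lt_div_iff₀ (by positivity)] at c1
    have c4 : θ ^ 10 ≤ θ ^ 2 := pow_le_pow_of_le_one hθ.le hθ1 (by norm_num)
    have c6 : θ ^ 8 ≤ θ ^ 2 := pow_le_pow_of_le_one hθ.le hθ1 (by norm_num)
    have c5 := mul_le_mul_of_nonneg_left c1.le (by positivity : 0 ≤ θ ^ 8 * τ ^ 2)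
    have c7 := mul_le_mul_of_nonneg_right c4 (sq_nonneg τ)
    have c8 := mul_le_mul_of_nonneg_right c6 (sq_nonneg τ)
    nlinarith

end

/-! ### The Frobenius norm -/

section

variable {ι κ m : Type*} [Fintype ι] [Fintype κ] [Fintype m]

/-- The squared Frobenius norm of a matrix. -/
def fsq {l m : Type*} [Fintype l] [Fintype m] (A : Matrix l m ℝ) : ℝ := ∑ i, ∑ j, A i j ^ 2

lemma fsq_nonneg {l : Type*} [Fintype l] (A : Matrix l m ℝ) : 0 ≤ fsq A :=
  Finset.sum_nonneg fun _ _ => Finset.sum_nonneg fun _ _ => sq_nonneg _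

lemma fsq_eq_trace {l : Type*} [Fintype l] (A : Matrix l m ℝ) : fsq A = (Aᵀ * A).trace := by
  simp only [fsq, Matrix.trace, Matrix.diag, Matrix.mul_apply, Matrix.transpose_apply, sq]
  exact Finset.sum_comm

lemma fsq_transpose {l : Type*} [Fintype l] (A : Matrix l m ℝ) : fsq Aᵀ = fsq A := by
  simp only [fsq, transpose_apply]
  exact Finset.sum_comm

lemma sq_apply_le_fsq {m : Type*} [Fintype m] (A : Matrix m m ℝ) (p q : m) :
    A p q ^ 2 ≤ fsq A :=
  (Finset.single_le_sum (f := fun q => A p q ^ 2) (fun _ _ => sq_nonneg _)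
    (Finset.mem_univ q)).trans (Finset.single_le_sum (f := fun p => ∑ q, A p q ^ 2)
      (fun _ _ => Finset.sum_nonneg fun _ _ => sq_nonneg _) (Finset.mem_univ p))

lemma fsq_smul {m : Type*} [Fintype m] (r : ℝ) (A : Matrix m m ℝ) :
    fsq (r • A) = r ^ 2 * fsq A := by
  simp only [fsq, Matrix.smul_apply, smul_eq_mul, mul_pow, Finset.mul_sum]

lemma fsq_one_smul {m : Type*} [Fintype m] [DecidableEq m] (r : ℝ) :
    fsq (r • (1 : Matrix m m ℝ)) = r ^ 2 * Fintype.card m := by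
  rw [fsq_smul]
  simp [fsq, Matrix.one_apply, ite_pow]

lemma fsq_sub_sub_le {m : Type*} [Fintype m] (A B C : Matrix m m ℝ) :
    fsq (A - B - C) ≤ 3 * (fsq A + fsq B + fsq C) := by
  simp only [fsq, ← Finset.sum_add_distrib, Finset.mul_sum, Matrix.sub_apply]
  refine Finset.sum_le_sum fun i _ => Finset.sum_le_sum fun j _ => ?_
  nlinarith [sq_nonneg (A i j + B i j), sq_nonneg (A i j + C i j), sq_nonneg (B i j - C i j)]

/-! ### The inverse of a Gaussian perturbation of a symmetric matrix -/

/-- Bound for the first column of the inverse, uniform in the fixed matrix `F`. The minor obtained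
by deleting the first row and column is kept fixed while these are resampled; the Schur complement
of that minor is then not small. -/
lemma stdGauss_inv_column_large {n : ℕ} {F : Matrix (Fin (n + 1)) (Fin (n + 1)) ℝ} (hF : Fᵀ = F)
    {τ θ : ℝ} (hτ : 0 < τ) (hθ : 0 < θ) (hθ1 : θ ≤ 1) :
    (stdGauss (Fin (n + 1) × Fin (n + 1))).real
      {X | 4 < θ ^ 10 * τ ^ 2 * ∑ i, (symMat τ F X)⁻¹ i 0 ^ 2} ≤ 33 * θ := by
  set H' : (Fin (n + 1) × Fin (n + 1) → ℝ) → Matrix (Fin n) (Fin n) ℝ :=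
    fun X => Matrix.of fun i j => symMat τ F X i.succ j.succ with hH'
  have hdet : (stdGauss (Fin (n + 1) × Fin (n + 1))).real {X | (H' X).det = 0} ≤ 0 := by
    rcases n with _ | n
    · simp
    refine le_of_eq (stdGauss_det_eq_zero (fun i j => measurable_symMat τ F _ _)
      (c := fun p => if p.1 = p.2 then (2 * τ)⁻¹ else 0) ?_ fun X t => ?_)
    · refine lt_of_lt_of_le ?_ (Finset.single_le_sum (fun _ _ => sq_nonneg _)
        (Finset.mem_univ ((0 : Fin (n + 2)), (0 : Fin (n + 2)))))
      simp only [if_true]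
      positivity
    · ext i j
      simp only [hH', Matrix.of_apply, symMat_apply, Pi.add_apply, Pi.smul_apply, smul_eq_mul,
        Matrix.add_apply, Matrix.smul_apply, Matrix.one_apply, Fin.succ_inj, eq_comm (a := j)]
      split_ifs with hij
      · field_simp
        ring
      · ring
  have hm : MeasurableSet {X | 4 < θ ^ 10 * τ ^ 2 * ∑ i, (symMat τ F X)⁻¹ i 0 ^ 2} := by
    exact measurableSet_lt measurable_const ((Finset.measurable_sum _ fun i _ =>
      (measurable_inv_of_entries (measurable_symMat τ F) i 0).pow_const 2).const_mul _)
  have := measureReal_le_of_sections_off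
    (measurable_mix {p : Fin (n + 1) × Fin (n + 1) | p.1 = 0 ∨ p.2 = 0}) (map_mix _) hm
    (p := 33 * θ) (by positivity) hdet fun X hX => ?_
  · simpa using this
  simp only [Set.mem_ofPred_eq] at hX
  have hsymm : (H' X)ᵀ = H' X := by
    ext i j
    simp only [hH', Matrix.transpose_apply, Matrix.of_apply]
    rw [← Matrix.transpose_apply (symMat τ F X), symMat_transpose hF]
  have hK : ((H' X)⁻¹)ᵀ = (H' X)⁻¹ := by rw [Matrix.transpose_nonsing_inv, hsymm]
  refine (measureReal_mono fun Y hY => ?_).trans (schur_small_ball hK (fun j => F 0 j.succ) (F 0 0)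
    hτ hθ hθ1 (w := fun X j => τ * (X (0, j.succ) + X (j.succ, 0)) + F 0 j.succ)
    (fun X j => rfl))
  set Z := mix {p : Fin (n + 1) × Fin (n + 1) | p.1 = 0 ∨ p.2 = 0} (X, Y) with hZ
  simp only [Set.mem_ofPred_eq] at hY ⊢
  by_contra! hcon
  have hpos : 0 < θ ^ 10 * τ ^ 2 := by positivity
  set w : Fin n → ℝ := fun j => τ * (Y (0, j.succ) + Y (j.succ, 0)) + F 0 j.succ with hw
  set s := τ * (Y (0, 0) + Y (0, 0)) + F 0 0 - w ⬝ᵥ (H' X)⁻¹ *ᵥ w with hs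
  have hsum : 0 ≤ ∑ i, ((H' X)⁻¹ *ᵥ w) i ^ 2 := Finset.sum_nonneg fun _ _ => sq_nonneg _
  have hs0 : s ≠ 0 := by
    intro h0
    rw [h0] at hcon
    nlinarith
  -- The inverse of a singular matrix is `0` by convention, so that it cannot be large.
  by_cases hdZ : (symMat τ F Z).det = 0
  · have : (symMat τ F Z)⁻¹ = 0 :=
      Matrix.nonsing_inv_apply_not_isUnit _ (by rw [hdZ]; exact not_isUnit_zero)
    rw [this] at hY
    simp at hY
    linarith
  have := inv_apply_zero_of_schur (symMat_transpose hF Z) (H' := H' X) (fun i j => ?_) hX hdZ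
    (w := w) (fun j => ?_) (s := s) ?_ hs0
  · rw [this, ← mul_div_assoc, lt_div_iff₀ (by positivity)] at hY
    linarith
  · simp only [hH', Matrix.of_apply, symMat_apply, hZ]
    rw [mix_of_notMem (by simp [Fin.succ_ne_zero]), mix_of_notMem (by simp [Fin.succ_ne_zero])]
  · simp only [hw, symMat_apply, hZ]
    rw [mix_of_mem (by simp), mix_of_mem (by simp)]
  · rw [hs, symMat_apply, hZ, mix_of_mem (by simp)]

/-- A symmetric orthogonal matrix whose first column is a given unit vector: the reflection
exchanging the two vectors. -/
lemma exists_reflection {n : ℕ} {v : Fin (n + 1) → ℝ} (hv : ∑ i, v i ^ 2 = 1) :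
    ∃ O : Matrix (Fin (n + 1)) (Fin (n + 1)) ℝ, Oᵀ = O ∧ O * O = 1 ∧ ∀ i, O i 0 = v i := by
  by_cases h0 : v = Pi.single 0 1
  · refine ⟨1, Matrix.transpose_one, by simp, fun i => ?_⟩
    rw [h0, Matrix.one_apply, Pi.single_apply]
  set u := v - Pi.single 0 1 with hu
  have huu : u ⬝ᵥ u = 2 * (1 - v 0) := by
    have hvv : v ⬝ᵥ v = 1 := by rw [← hv]; simp [dotProduct, sq]
    simp only [hu, sub_dotProduct, dotProduct_sub, dotProduct_single, single_dotProduct, hvv,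
      Pi.sub_apply, Pi.single_eq_same]
    ring
  have hne : u ⬝ᵥ u ≠ 0 := fun h => h0 (sub_eq_zero.1 (dotProduct_self_eq_zero.1 h))
  set c := 2 / (u ⬝ᵥ u) with hc
  refine ⟨1 - c • vecMulVec u u, ?_, ?_, fun i => ?_⟩
  · rw [transpose_sub, transpose_one, transpose_smul, transpose_vecMulVec]
  · have h1 : vecMulVec u u * vecMulVec u u = (u ⬝ᵥ u) • vecMulVec u u := by
      rw [vecMulVec_mul_vecMulVec]
      ext i j
      simp [vecMulVec_apply]
      ring
    have h2 : c * (c * (u ⬝ᵥ u)) = c + c := by rw [hc]; field_simp; ring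
    rw [sub_mul, mul_sub, mul_sub, one_mul, one_mul, mul_one, smul_mul_smul_comm, h1, smul_smul,
      mul_assoc, h2, add_smul]
    abel
  · simp only [Matrix.sub_apply, Matrix.smul_apply, vecMulVec_apply, smul_eq_mul, Matrix.one_apply]
    have h1 : u 0 = v 0 - 1 := by simp [hu]
    have h2 : c * u 0 = -1 := by
      rw [hc, huu, h1]
      rw [huu] at hne
      rw [div_mul_eq_mul_div, div_eq_iff hne]
      ring
    have h3 : u i = v i - if i = 0 then 1 else 0 := by simp [hu, Pi.single_apply]
    calc _ = (if i = 0 then 1 else 0) - u i * (c * u 0) := by ring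
      _ = v i := by rw [h2, h3]; ring

lemma sum_sq_mulVec_of_reflection [DecidableEq m] {O : Matrix m m ℝ} (hO : Oᵀ = O)
    (hOO : O * O = 1) (x : m → ℝ) : ∑ i, (O *ᵥ x) i ^ 2 = ∑ i, x i ^ 2 := by
  have h : ∀ y : m → ℝ, ∑ i, y i ^ 2 = y ⬝ᵥ y := fun y => by simp [dotProduct, sq]
  rw [h, h, dotProduct_mulVec_comm hO, mulVec_mulVec, hOO, one_mulVec]

/-- A Gaussian matrix is invariant under conjugation by a reflection. -/
lemma map_conj_stdGauss [DecidableEq m] {O : Matrix m m ℝ} (hO : Oᵀ = O) (hOO : O * O = 1) :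
    (stdGauss (m × m)).map (fun X p => (O * Matrix.of (fun i j => X (i, j)) * O) p.1 p.2)
      = stdGauss (m × m) := by
  refine map_stdGauss ?_ fun c =>
    ⟨fun p => (O * Matrix.of (fun i j => c (i, j)) * O) p.1 p.2, fun X => ?_, ?_⟩
  · simp only [Matrix.mul_apply, Matrix.of_apply]
    fun_prop
  · have h1 : ∀ a b : m × m → ℝ, ∑ p, a p * b p
        = ((Matrix.of fun i j => a (i, j))ᵀ * Matrix.of fun i j => b (i, j)).trace := by
      intro a b
      simp only [Matrix.trace, Matrix.diag, Matrix.mul_apply, Matrix.transpose_apply,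
        Matrix.of_apply, Fintype.sum_prod_type]
      exact Finset.sum_comm
    rw [h1, h1]
    have h2 : ∀ C : Matrix m m ℝ, (Matrix.of fun i j => C i j) = C := fun _ => rfl
    simp only [h2, transpose_mul, hO]
    rw [← Matrix.mul_assoc, Matrix.trace_mul_comm]
    simp only [Matrix.mul_assoc]
  · have h1 : ∀ C : Matrix m m ℝ, ∑ p : m × m, C p.1 p.2 ^ 2 = (Cᵀ * C).trace := by
      intro C
      rw [← fsq_eq_trace, fsq, Fintype.sum_prod_type]
    have h2 := h1 (Matrix.of fun i j => c (i, j))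
    simp only [Matrix.of_apply, Prod.mk.eta] at h2
    rw [h1, h2]
    simp only [transpose_mul, hO]
    set C := Matrix.of fun i j => c (i, j)
    rw [show O * (Cᵀ * O) * (O * C * O) = O * (Cᵀ * (O * O) * C * O) by
      simp only [Matrix.mul_assoc], hOO, Matrix.mul_one, Matrix.trace_mul_comm,
      Matrix.mul_assoc _ O O, hOO, Matrix.mul_one]

/-- Bound for the inverse applied to a fixed vector, by orthogonal invariance. -/
lemma stdGauss_inv_mulVec_large {n : ℕ} {F : Matrix (Fin (n + 1)) (Fin (n + 1)) ℝ} (hF : Fᵀ = F)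
    {τ θ : ℝ} (hτ : 0 < τ) (hθ : 0 < θ) (hθ1 : θ ≤ 1) (v : Fin (n + 1) → ℝ) :
    (stdGauss (Fin (n + 1) × Fin (n + 1))).real
      {X | 4 * ∑ i, v i ^ 2 < θ ^ 10 * τ ^ 2 * ∑ i, ((symMat τ F X)⁻¹ *ᵥ v) i ^ 2} ≤ 33 * θ := by
  set r := √(∑ i, v i ^ 2) with hr
  have hr2 : r ^ 2 = ∑ i, v i ^ 2 := Real.sq_sqrt (Finset.sum_nonneg fun _ _ => sq_nonneg _)
  rcases (Real.sqrt_nonneg (∑ i, v i ^ 2)).eq_or_lt with h0 | h0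
  · have hv : v = 0 := by
      rw [← hr] at h0
      rw [← h0] at hr2
      ext i
      have := (Finset.sum_eq_zero_iff_of_nonneg (fun i _ => sq_nonneg (v i))).1
        (hr2.symm.trans (by norm_num)) i (Finset.mem_univ i)
      simpa using this
    have : {X | 4 * ∑ i, v i ^ 2 < θ ^ 10 * τ ^ 2 * ∑ i, ((symMat τ F X)⁻¹ *ᵥ v) i ^ 2} = ∅ := by
      ext X
      simp [hv]
    rw [this]
    simp [hθ.le]
  rw [← hr] at h0
  obtain ⟨O, hO, hOO, hOv⟩ := exists_reflection (v := r⁻¹ • v) (by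
    simp only [Pi.smul_apply, smul_eq_mul, mul_pow, ← Finset.mul_sum, ← hr2]
    field_simp)
  set T : (Fin (n + 1) × Fin (n + 1) → ℝ) → (Fin (n + 1) × Fin (n + 1) → ℝ) :=
    fun X p => (O * Matrix.of (fun i j => X (i, j)) * O) p.1 p.2 with hT
  have hTm : Measurable T := by
    simp only [hT, Matrix.mul_apply, Matrix.of_apply]
    fun_prop
  have hF' : (O * F * O)ᵀ = O * F * O := by
    simp only [transpose_mul, hO, hF, Matrix.mul_assoc]
  have h1 := stdGauss_inv_column_large hF' hτ hθ hθ1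
  rw [← map_conj_stdGauss hO hOO, map_measureReal_apply hTm ?_] at h1
  swap
  · exact measurableSet_lt measurable_const ((Finset.measurable_sum _ fun i _ =>
      (measurable_inv_of_entries (measurable_symMat τ (O * F * O)) i 0).pow_const 2).const_mul _)
  refine (measureReal_mono fun X hX => ?_).trans h1
  simp only [Set.mem_ofPred_eq, Set.mem_preimage] at hX ⊢
  have e1 : symMat τ (O * F * O) (T X) = O * symMat τ F X * O := by
    set Y : Matrix (Fin (n + 1)) (Fin (n + 1)) ℝ := Matrix.of fun i j => X (i, j) with hY
    have a1 : symMat τ F X = τ • (Y + Yᵀ) + F := by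
      ext i j; simp [symMat_apply, hY, mul_add]
    have a2 : symMat τ (O * F * O) (T X) = τ • (O * Y * O + (O * Y * O)ᵀ) + O * F * O := by
      ext i j; simp [symMat_apply, hT, hY, mul_add, -transpose_mul]
    rw [a1, a2]
    simp only [transpose_mul, hO, Matrix.mul_add, Matrix.add_mul, Matrix.mul_smul, Matrix.smul_mul,
      Matrix.mul_assoc]
  have hOinv : O⁻¹ = O := Matrix.inv_eq_right_inv hOO
  have e2 : ∀ i, (symMat τ (O * F * O) (T X))⁻¹ i 0
      = (O *ᵥ ((symMat τ F X)⁻¹ *ᵥ (r⁻¹ • v))) i := by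
    intro i
    have hcol : ∀ M : Matrix (Fin (n + 1)) (Fin (n + 1)) ℝ, M i 0 = (M *ᵥ Pi.single 0 1) i := by
      intro M
      rw [mulVec_single_one]
      rfl
    have hOe : r⁻¹ • v = O *ᵥ Pi.single 0 1 := by
      rw [mulVec_single_one]
      exact (funext hOv).symm
    rw [e1, Matrix.mul_inv_rev, Matrix.mul_inv_rev, hOinv, hcol (O * ((symMat τ F X)⁻¹ * O)), hOe,
      mulVec_mulVec, mulVec_mulVec, Matrix.mul_assoc]
  have e3 : ∑ i, (symMat τ (O * F * O) (T X))⁻¹ i 0 ^ 2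
      = (r ^ 2)⁻¹ * ∑ i, ((symMat τ F X)⁻¹ *ᵥ v) i ^ 2 := by
    simp only [e2]
    rw [sum_sq_mulVec_of_reflection hO hOO]
    simp only [mulVec_smul, Pi.smul_apply, smul_eq_mul, mul_pow, inv_pow, ← Finset.mul_sum]
  rw [e3]
  rw [← hr2] at hX
  rw [← mul_assoc, mul_comm _ (r ^ 2)⁻¹, mul_assoc, ← div_eq_inv_mul, lt_div_iff₀ (by positivity)]
  exact hX

/-- The inverse of a Gaussian perturbation of a fixed symmetric matrix has Frobenius norm of order
at most `√m / τ`, uniformly in the fixed matrix. -/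
lemma stdGauss_fsq_inv_large {n : ℕ} {F : Matrix (Fin (n + 1)) (Fin (n + 1)) ℝ} (hF : Fᵀ = F)
    {τ θ : ℝ} (hτ : 0 < τ) (hθ : 0 < θ) (hθ1 : θ ≤ 1) :
    (stdGauss (Fin (n + 1) × Fin (n + 1))).real
      {X | 128 * (n + 1) < θ ^ 11 * τ ^ 2 * fsq (symMat τ F X)⁻¹} ≤ 68 * θ := by
  set μ := stdGauss (Fin (n + 1) × Fin (n + 1))
  set ν := stdGauss (Fin (n + 1))
  set E := {X | 128 * ((n : ℝ) + 1) < θ ^ 11 * τ ^ 2 * fsq (symMat τ F X)⁻¹} with hE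
  have hinvm := measurable_inv_of_entries (measurable_symMat τ F)
  have hEm : MeasurableSet E := measurableSet_lt measurable_const
    ((Finset.measurable_sum _ fun i _ => Finset.measurable_sum _ fun j _ =>
      (hinvm i j).pow_const 2).const_mul _)
  -- `H⁻¹ v` for an independent Gaussian vector `v` detects the Frobenius norm of `H⁻¹`.
  set G : Set ((Fin (n + 1) → ℝ) × (Fin (n + 1) × Fin (n + 1) → ℝ)) :=
    {p | 4 * (n + 1) < θ ^ 11 * τ ^ 2 * ∑ i, ((symMat τ F p.2)⁻¹ *ᵥ p.1) i ^ 2} with hG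
  have hGm : MeasurableSet G := by
    refine measurableSet_lt measurable_const ((Finset.measurable_sum _ fun i _ =>
      (Measurable.pow_const ?_ 2)).const_mul _)
    simp only [mulVec, dotProduct]
    exact Finset.measurable_sum _ fun j _ =>
      ((hinvm i j).comp measurable_snd).mul (by fun_prop)
  have h1 : (ν.prod μ).real G ≤ 34 * θ := by
    have hv : ν.real {v | ((n : ℝ) + 1) / θ ≤ ∑ i, v i ^ 2} ≤ θ := by
      refine sum_sq_large Finset.univ (X := fun i v => v i) (a := fun _ => 0)
        (c := fun i => Pi.single i 1) (fun i _ x => ?_) (by positivity) hθ ?_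
      · simp [Pi.single_apply]
      · simp [Pi.single_apply]
    refine (measureReal_le_of_sections_off (T := id) measurable_id Measure.map_id hGm
      (p := 33 * θ) (by positivity) hv fun v hv => ?_).trans (by linarith)
    refine (measureReal_mono fun X hX => ?_).trans (stdGauss_inv_mulVec_large hF hτ hθ hθ1 v)
    simp only [Set.mem_ofPred_eq, not_le, id, hG] at hv hX ⊢
    rw [lt_div_iff₀ hθ] at hv
    have : θ * (4 * ∑ i, v i ^ 2) <
        θ * (θ ^ 10 * τ ^ 2 * ∑ i, ((symMat τ F X)⁻¹ *ᵥ v) i ^ 2) := by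
      calc _ = 4 * ((∑ i, v i ^ 2) * θ) := by ring
        _ < 4 * (n + 1) := by linarith
        _ < _ := hX
        _ = _ := by ring
    exact lt_of_mul_lt_mul_left this hθ.le
  -- Conversely `‖K v‖²` is at least `‖K‖² / 32` with probability at least `1 / 2`.
  have h2 : ∀ X ∈ E, 1 / 2 ≤ ν.real {v | (v, X) ∈ G} := by
    intro X hX
    set K := (symMat τ F X)⁻¹ with hK
    have hs := sum_sq_small_ball (μ := ν) (θ := 1 / 4) (p := 1 / 4) Finset.univ
      (X := fun i v => (K *ᵥ v) i) (s := fun i => ∑ j, K i j ^ 2)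
      (fun i _ => by simp only [mulVec, dotProduct]; fun_prop)
      (fun i _ => Finset.sum_nonneg fun _ _ => sq_nonneg _) (by norm_num)
      (fun i _ => stdGauss_small_ball (m := 0) (c := K i) (fun v => by simp [mulVec, dotProduct])
        (by norm_num) le_rfl)
    have hm : MeasurableSet {v : Fin (n + 1) → ℝ |
        ∑ i, (K *ᵥ v) i ^ 2 < (1 / 4) ^ 2 / 2 * ∑ i, ∑ j, K i j ^ 2} := by
      refine measurableSet_lt ?_ measurable_const
      simp only [mulVec, dotProduct]
      fun_prop
    have hc := probReal_add_probReal_compl (μ := ν) hm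
    have hsub : {v : Fin (n + 1) → ℝ |
        ∑ i, (K *ᵥ v) i ^ 2 < (1 / 4) ^ 2 / 2 * ∑ i, ∑ j, K i j ^ 2}ᶜ ⊆ {v | (v, X) ∈ G} := by
      intro v hv
      simp only [Set.mem_compl_iff, Set.mem_ofPred_eq, not_lt, hE, hG, ← hK] at hv hX ⊢
      rw [fsq] at hX
      have := mul_le_mul_of_nonneg_left hv (by positivity : 0 ≤ θ ^ 11 * τ ^ 2)
      nlinarith
    have := measureReal_mono (μ := ν) hsub
    linarith
  have h3 : μ.real E * (1 / 2) ≤ (ν.prod μ).real G := by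
    have hswap : (ν.prod μ) G = ∫⁻ X, ν {v | (v, X) ∈ G} ∂μ := Measure.prod_apply_symm hGm
    have : ENNReal.ofReal (1 / 2) * μ E ≤ (ν.prod μ) G := by
      rw [hswap, ← lintegral_indicator_const hEm]
      refine lintegral_mono fun X => ?_
      by_cases hX : X ∈ E
      · rw [Set.indicator_of_mem hX]
        exact (ENNReal.ofReal_le_iff_le_toReal (measure_ne_top _ _)).2 (h2 X hX)
      · rw [Set.indicator_of_notMem hX]
        exact zero_le
    have := ENNReal.toReal_mono (measure_ne_top _ _) this
    rw [ENNReal.toReal_mul, ENNReal.toReal_ofReal (by norm_num)] at this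
    rw [mul_comm]
    exact this
  linarith

end

/-! ### Congruence of a fixed matrix by a Gaussian matrix -/

section

variable {ι κ m : Type*} [Fintype ι] [Fintype κ] [Fintype m]

/-- The entry of `Yᵀ T Y` at `(a, c)`. -/
def congrEntry (T : Matrix m m ℝ) (a c : m) (Y : m × m → ℝ) : ℝ :=
  ∑ p, (∑ q, T p q * Y (q, c)) * Y (p, a)

lemma congr_apply (T : Matrix m m ℝ) (Y : m × m → ℝ) (a c : m) :
    ((Matrix.of fun i j => Y (i, j))ᵀ * T * Matrix.of fun i j => Y (i, j)) a c
      = congrEntry T a c Y := by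
  rw [Matrix.mul_assoc]
  simp only [Matrix.mul_apply, Matrix.transpose_apply, Matrix.of_apply, congrEntry]
  exact Finset.sum_congr rfl fun p _ => mul_comm _ _

@[fun_prop]
lemma measurable_congrEntry (T : Matrix m m ℝ) (a c : m) : Measurable (congrEntry T a c) := by
  unfold congrEntry
  fun_prop

lemma sum_ite_snd [DecidableEq m] (a : m) (f : m → ℝ) (g : m × m → ℝ) :
    ∑ r : m × m, (if r.2 = a then f r.1 else 0) * g r = ∑ p, f p * g (p, a) := by
  rw [Fintype.sum_prod_type]
  refine Finset.sum_congr rfl fun p _ => ?_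
  simp [ite_mul]

lemma sum_ite_snd_sq [DecidableEq m] (a : m) (f : m → ℝ) :
    ∑ r : m × m, (if r.2 = a then f r.1 else 0) ^ 2 = ∑ p, f p ^ 2 := by
  rw [Fintype.sum_prod_type]
  refine Finset.sum_congr rfl fun p _ => ?_
  simp [ite_pow]

/-- Resampling column `a` of `Y`: given column `c`, the entry at `(a, c)` with `a ≠ c` is a linear
functional of column `a`, since the two columns are independent. -/
lemma congrEntry_mix (T : Matrix m m ℝ) {a c : m} (hac : a ≠ c) (p : (m × m → ℝ) × (m × m → ℝ)) :
    congrEntry T a c (mix {r | r.2 = a} p) = ∑ i, (∑ q, T i q * p.1 (q, c)) * p.2 (i, a) := by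
  unfold congrEntry
  refine Finset.sum_congr rfl fun i _ => ?_
  rw [mix_of_mem (by simp)]
  congr 1
  exact Finset.sum_congr rfl fun q _ => by rw [mix_of_notMem (by simpa using hac.symm)]

lemma lintegral_linear_sq (a : ℝ) (c : ι → ℝ) :
    ∫⁻ x, ENNReal.ofReal ((a + ∑ i, c i * x i) ^ 2) ∂(stdGauss ι)
      = ENNReal.ofReal (a ^ 2 + ∑ i, c i ^ 2) := by
  rw [← integral_linear_sq, ofReal_integral_eq_lintegral_ofReal (integrable_linear_sq a c)
    (Filter.Eventually.of_forall fun _ => sq_nonneg _)]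

lemma lintegral_congrEntry_sq_of_ne [DecidableEq m] (T : Matrix m m ℝ) {a c : m} (hac : a ≠ c) :
    ∫⁻ Y, ENNReal.ofReal (congrEntry T a c Y ^ 2) ∂(stdGauss (m × m))
      = ENNReal.ofReal (fsq T) := by
  have hm : Measurable fun Y => ENNReal.ofReal (congrEntry T a c Y ^ 2) := by fun_prop
  have h1 : ∀ x : m × m → ℝ, ∫⁻ y, ENNReal.ofReal
      (congrEntry T a c (mix {r : m × m | r.2 = a} (x, y)) ^ 2) ∂(stdGauss (m × m))
      = ENNReal.ofReal (∑ i, (∑ q, T i q * x (q, c)) ^ 2) := by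
    intro x
    have := lintegral_linear_sq (ι := m × m) 0
      (fun r => if r.2 = a then (∑ q, T r.1 q * x (q, c)) else 0)
    rw [sum_ite_snd_sq a (fun i => ∑ q, T i q * x (q, c))] at this
    simp only [sum_ite_snd a (fun i => ∑ q, T i q * x (q, c)), zero_add, ne_eq,
      OfNat.ofNat_ne_zero, not_false_eq_true, zero_pow] at this
    rw [← this]
    exact lintegral_congr fun y => by rw [congrEntry_mix T hac]
  have h2 : ∀ i, ∫⁻ x, ENNReal.ofReal ((∑ q, T i q * x (q, c)) ^ 2) ∂(stdGauss (m × m))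
      = ENNReal.ofReal (∑ q, T i q ^ 2) := by
    intro i
    have := lintegral_linear_sq (ι := m × m) 0 (fun r => if r.2 = c then T i r.1 else 0)
    rw [sum_ite_snd_sq c (fun q => T i q)] at this
    simpa only [sum_ite_snd c (fun q => T i q), zero_add, ne_eq,
      OfNat.ofNat_ne_zero, not_false_eq_true, zero_pow] using this
  rw [← map_mix {r : m × m | r.2 = a}, lintegral_map hm (measurable_mix _),
    lintegral_prod (fun z => ENNReal.ofReal (congrEntry T a c (mix {r : m × m | r.2 = a} z) ^ 2))
      (hm.comp (measurable_mix _)).aemeasurable]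
  simp only [h1]
  simp_rw [ENNReal.ofReal_sum_of_nonneg (fun i (_ : i ∈ Finset.univ) => sq_nonneg _)]
  rw [lintegral_finsetSum _ (fun i _ => by fun_prop)]
  simp only [h2]
  exact (ENNReal.ofReal_sum_of_nonneg (f := fun i => ∑ q, T i q ^ 2)
    fun i _ => Finset.sum_nonneg fun _ _ => sq_nonneg _).symm

/-- The fourth moment of the standard Gaussian law. -/
noncomputable def gaussFour : ℝ := ∫ x, x ^ 4 ∂(gaussianReal 0 1)

lemma gaussFour_nonneg : 0 ≤ gaussFour := integral_nonneg fun x => by positivity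

lemma integrable_gaussianReal_pow_four (v : NNReal) :
    Integrable (fun x : ℝ => x ^ 4) (gaussianReal 0 v) := by
  have := (memLp_id_gaussianReal' (μ := 0) (v := v) 4 (by simp)).integrable_norm_pow (by norm_num)
  simp only [id] at this
  refine this.congr (Filter.Eventually.of_forall fun x => ?_)
  simp only [Real.norm_eq_abs]
  rw [show |x| ^ 4 = (|x| ^ 2) ^ 2 by ring, sq_abs]
  ring

lemma integrable_linear_four (c : ι → ℝ) :
    Integrable (fun x => (∑ i, c i * x i) ^ 4) (stdGauss ι) := by
  have h : Integrable (fun y : ℝ => y ^ 4)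
      ((stdGauss ι).map (fun x => 0 + ∑ i, c i * x i)) := by
    rw [map_linear_stdGauss]
    exact integrable_gaussianReal_pow_four _
  have := h.comp_measurable (by fun_prop)
  simpa [Function.comp_def] using this

lemma integral_linear_four (c : ι → ℝ) :
    ∫ x, (∑ i, c i * x i) ^ 4 ∂(stdGauss ι) = gaussFour * (∑ i, c i ^ 2) ^ 2 := by
  have h0 : 0 ≤ ∑ i, c i ^ 2 := Finset.sum_nonneg fun _ _ => sq_nonneg _
  have h1 : ∫ x, (∑ i, c i * x i) ^ 4 ∂(stdGauss ι)
      = ∫ y, y ^ 4 ∂(gaussianReal 0 (Real.toNNReal (∑ i, c i ^ 2))) := by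
    rw [← map_linear_stdGauss, integral_map (Measurable.aemeasurable (by fun_prop))
      (Measurable.aestronglyMeasurable (by fun_prop))]
    simp
  have h2 : gaussianReal 0 (Real.toNNReal (∑ i, c i ^ 2))
      = (gaussianReal 0 1).map (fun x => √(∑ i, c i ^ 2) * x) := by
    rw [gaussianReal_map_const_mul, mul_zero, mul_one]
    congr 1
    ext
    rw [Real.coe_toNNReal _ h0]
    exact (Real.sq_sqrt h0).symm
  rw [h1, h2, integral_map (Measurable.aemeasurable (by fun_prop))
      (Measurable.aestronglyMeasurable (by fun_prop))]
  simp only [mul_pow]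
  rw [integral_const_mul, gaussFour, show √(∑ i, c i ^ 2) ^ 4 = (√(∑ i, c i ^ 2) ^ 2) ^ 2 by ring,
    Real.sq_sqrt h0, mul_comm]

lemma lintegral_congrEntry_sq_diag [DecidableEq m] (T : Matrix m m ℝ) (a : m) :
    ∫⁻ Y, ENNReal.ofReal (congrEntry T a a Y ^ 2) ∂(stdGauss (m × m))
      ≤ ENNReal.ofReal (Fintype.card m * gaussFour * fsq T) := by
  set t : m → ℝ := fun i => ∑ q, T i q ^ 2 with ht
  have ht0 : ∀ i, 0 ≤ t i := fun i => Finset.sum_nonneg fun _ _ => sq_nonneg _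
  set ℓ : m → (m × m → ℝ) → ℝ := fun i Y => ∑ q, T i q * Y (q, a) with hℓ
  -- Bound `(bᵀ T b)²` by `‖b‖² ‖T b‖²` and each product of squares by fourth powers.
  have hpt : ∀ Y : m × m → ℝ, congrEntry T a a Y ^ 2
      ≤ ∑ p, ∑ i, (t i / 2 * Y (p, a) ^ 4 + (2 * t i)⁻¹ * ℓ i Y ^ 4) := by
    intro Y
    have h1 : congrEntry T a a Y ^ 2 ≤ (∑ i, ℓ i Y ^ 2) * ∑ p, Y (p, a) ^ 2 :=
      Finset.sum_mul_sq_le_sq_mul_sq _ _ _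
    refine h1.trans ?_
    rw [mul_comm, Finset.sum_mul_sum]
    refine Finset.sum_le_sum fun p _ => Finset.sum_le_sum fun i _ => ?_
    rcases (ht0 i).eq_or_lt with h0 | h0
    · have hz : ∀ q, T i q = 0 := fun q => by
        have := (Finset.sum_eq_zero_iff_of_nonneg (fun q _ => sq_nonneg (T i q))).1 h0.symm q
          (Finset.mem_univ q)
        simpa using this
      simp [hℓ, hz, ← h0]
    · rw [inv_mul_eq_div, ← sub_nonneg]
      have : t i / 2 * Y (p, a) ^ 4 + ℓ i Y ^ 4 / (2 * t i) - Y (p, a) ^ 2 * ℓ i Y ^ 2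
          = (t i * Y (p, a) ^ 2 - ℓ i Y ^ 2) ^ 2 / (2 * t i) := by
        field_simp
        ring
      rw [this]
      positivity
  have e1 : ∀ p, (fun Y : m × m → ℝ => Y (p, a) ^ 4)
      = fun Y => (∑ r, (Pi.single (p, a) 1 : m × m → ℝ) r * Y r) ^ 4 := fun p => by
    ext Y; simp [Pi.single_apply]
  have e2 : ∀ i, (fun Y : m × m → ℝ => ℓ i Y ^ 4)
      = fun Y => (∑ r : m × m, (if r.2 = a then T i r.1 else 0) * Y r) ^ 4 := fun i => by
    ext Y
    rw [sum_ite_snd a (fun q => T i q)]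
  have i1 : ∀ p, Integrable (fun Y : m × m → ℝ => Y (p, a) ^ 4) (stdGauss (m × m)) := fun p => by
    rw [e1]; exact integrable_linear_four _
  have i2 : ∀ i, Integrable (fun Y : m × m → ℝ => ℓ i Y ^ 4) (stdGauss (m × m)) := fun i => by
    rw [e2]; exact integrable_linear_four _
  have v1 : ∀ p, ∫ Y : m × m → ℝ, Y (p, a) ^ 4 ∂(stdGauss (m × m)) = gaussFour := fun p => by
    rw [e1, integral_linear_four]; simp [Pi.single_apply]
  have v2 : ∀ i, ∫ Y : m × m → ℝ, ℓ i Y ^ 4 ∂(stdGauss (m × m)) = gaussFour * t i ^ 2 := fun i => by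
    rw [e2, integral_linear_four, sum_ite_snd_sq a (fun q => T i q)]
  have i3 : ∀ p i, Integrable (fun Y : m × m → ℝ =>
      t i / 2 * Y (p, a) ^ 4 + (2 * t i)⁻¹ * ℓ i Y ^ 4) (stdGauss (m × m)) := fun p i =>
    ((i1 p).const_mul _).add ((i2 i).const_mul _)
  have hI : Integrable (fun Y : m × m → ℝ =>
      ∑ p, ∑ i, (t i / 2 * Y (p, a) ^ 4 + (2 * t i)⁻¹ * ℓ i Y ^ 4)) (stdGauss (m × m)) :=
    integrable_finsetSum _ fun p _ => integrable_finsetSum _ fun i _ => i3 p i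
  refine (lintegral_mono fun Y => ENNReal.ofReal_le_ofReal (hpt Y)).trans ?_
  rw [← ofReal_integral_eq_lintegral_ofReal hI
    (Filter.Eventually.of_forall fun Y => (sq_nonneg _).trans (hpt Y))]
  refine ENNReal.ofReal_le_ofReal ?_
  rw [integral_finsetSum _ fun p _ => integrable_finsetSum _ fun i _ => i3 p i]
  have : ∀ p ∈ Finset.univ, ∫ Y : m × m → ℝ, ∑ i, (t i / 2 * Y (p, a) ^ 4
      + (2 * t i)⁻¹ * ℓ i Y ^ 4) ∂(stdGauss (m × m)) ≤ gaussFour * fsq T := by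
    intro p _
    rw [integral_finsetSum _ fun i _ => i3 p i, fsq,
      Finset.mul_sum]
    refine Finset.sum_le_sum fun i _ => ?_
    rw [integral_add ((i1 p).const_mul _) ((i2 i).const_mul _), integral_const_mul,
      integral_const_mul, v1, v2]
    change _ ≤ gaussFour * t i
    rcases (ht0 i).eq_or_lt with h0 | h0
    · simp [← h0]
    · refine le_of_eq ?_
      field_simp
      ring
  refine (Finset.sum_le_sum this).trans (le_of_eq ?_)
  rw [Finset.sum_const, Finset.card_univ, nsmul_eq_mul, mul_assoc]

/-- `‖Yᵀ T Y‖` is at most of order `m ‖T‖` in Frobenius norm for a Gaussian `m × m` matrix `Y`. -/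
lemma stdGauss_fsq_congr_large [DecidableEq m] (T : Matrix m m ℝ) {θ S : ℝ} (hθ : 0 < θ)
    (hS : 0 < S) (hTS : fsq T ≤ S) :
    (stdGauss (m × m)).real {Y | (1 + gaussFour) * Fintype.card m ^ 2 * S / θ <
      fsq ((Matrix.of fun i j => Y (i, j))ᵀ * T * Matrix.of fun i j => Y (i, j))} ≤ θ := by
  rcases isEmpty_or_nonempty m with hm | hm
  · have : ∀ Y : m × m → ℝ,
      fsq ((Matrix.of fun i j => Y (i, j))ᵀ * T * Matrix.of fun i j => Y (i, j)) = 0 := fun Y => by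
      simp [fsq]
    simp only [this]
    simp [hθ.le]
  have hC := gaussFour_nonneg
  have hM : (1 : ℝ) ≤ Fintype.card m := by exact_mod_cast Fintype.card_pos
  set M : ℝ := ((Fintype.card m : ℕ) : ℝ) with hMdef
  have hT0 := fsq_nonneg T
  have hle : ∀ a c, ∫⁻ Y, ENNReal.ofReal (congrEntry T a c Y ^ 2) ∂(stdGauss (m × m))
      ≤ ENNReal.ofReal (fsq T) + if a = c then ENNReal.ofReal (M * gaussFour * fsq T) else 0 := by
    intro a c
    by_cases h : a = c
    · subst h
      simpa using (lintegral_congrEntry_sq_diag T a).trans le_add_self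
    · simp [h, lintegral_congrEntry_sq_of_ne T h]
  have htot : ∫⁻ Y, ENNReal.ofReal (∑ a, ∑ c, congrEntry T a c Y ^ 2) ∂(stdGauss (m × m))
      ≤ ENNReal.ofReal ((1 + gaussFour) * M ^ 2 * S) := by
    simp_rw [ENNReal.ofReal_sum_of_nonneg
      (fun a (_ : a ∈ Finset.univ) => Finset.sum_nonneg fun c _ => sq_nonneg _),
      ENNReal.ofReal_sum_of_nonneg (fun c (_ : c ∈ Finset.univ) => sq_nonneg _)]
    rw [lintegral_finsetSum _ fun a _ => Finset.measurable_sum _ fun c _ => by fun_prop]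
    have hstep : ∀ a, ∫⁻ Y, ∑ c, ENNReal.ofReal (congrEntry T a c Y ^ 2) ∂(stdGauss (m × m))
        = ∑ c, ∫⁻ Y, ENNReal.ofReal (congrEntry T a c Y ^ 2) ∂(stdGauss (m × m)) := fun a =>
      lintegral_finsetSum _ fun c _ => by fun_prop
    simp_rw [hstep]
    refine (Finset.sum_le_sum fun a _ => Finset.sum_le_sum fun c _ => hle a c).trans ?_
    simp only [Finset.sum_add_distrib, Finset.sum_ite_eq, Finset.mem_univ, if_true,
      Finset.sum_const, Finset.card_univ, nsmul_eq_mul]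
    rw [← ENNReal.ofReal_natCast, ← ENNReal.ofReal_mul (by positivity), ← ENNReal.ofReal_mul
      (by positivity), ← ENNReal.ofReal_mul (by positivity), ← ENNReal.ofReal_add (by positivity)
      (by positivity)]
    refine ENNReal.ofReal_le_ofReal ?_
    rw [← hMdef]
    have := mul_le_mul_of_nonneg_left hTS (by positivity : 0 ≤ (1 + gaussFour) * M ^ 2)
    nlinarith
  have hmk := meas_ge_le_lintegral_div (μ := stdGauss (m × m))
    (f := fun Y => ENNReal.ofReal (∑ a, ∑ c, congrEntry T a c Y ^ 2))
    (Measurable.aemeasurable (by fun_prop))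
    (ε := ENNReal.ofReal ((1 + gaussFour) * M ^ 2 * S / θ))
    (by simp only [ne_eq, ENNReal.ofReal_eq_zero, not_le]; positivity) ENNReal.ofReal_ne_top
  refine ENNReal.toReal_le_of_le_ofReal hθ.le ?_
  refine (measure_mono fun Y hY => ?_).trans (hmk.trans ((ENNReal.div_le_div_right htot _).trans
    (le_of_eq ?_)))
  · simp only [Set.mem_ofPred_eq] at hY ⊢
    refine ENNReal.ofReal_le_ofReal (hY.le.trans (le_of_eq ?_))
    simp only [fsq, congr_apply]
  · rw [← ENNReal.ofReal_div_of_pos (by positivity)]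
    congr 1
    field_simp

/-- `‖Yᵀ K Y‖` is at least of order `m ‖K‖` in Frobenius norm for a Gaussian `m × m` matrix `Y`. -/
lemma stdGauss_fsq_congr_small [DecidableEq m] (K : Matrix m m ℝ) (hm : 2 ≤ Fintype.card m)
    {θ : ℝ} (hθ : 0 < θ) :
    (stdGauss (m × m)).real {Y | fsq ((Matrix.of fun i j => Y (i, j))ᵀ * K
      * Matrix.of fun i j => Y (i, j)) < θ ^ 4 / 8 * Fintype.card m ^ 2 * fsq K} ≤ 6 * θ := by
  have hK0 := fsq_nonneg K
  -- Only the entries off the diagonal are used: each is a bilinear form in two independent columns.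
  have hpair : ∀ r ∈ (Finset.univ : Finset m).offDiag, (stdGauss (m × m)).real
      {Y | congrEntry K r.1 r.2 Y ^ 2 < (θ ^ 2) ^ 2 * (fsq K / 2)} ≤ 3 * θ := by
    rintro ⟨a, c⟩ hac
    have hac : a ≠ c := by simpa using hac
    have hsb : ∀ i ∈ Finset.univ, (stdGauss (m × m)).real
        {Y | (∑ q, K i q * Y (q, c)) ^ 2 < θ ^ 2 * ∑ q, K i q ^ 2} ≤ θ := by
      intro i _
      have hlin : ∀ Y : m × m → ℝ, ∑ q, K i q * Y (q, c)
          = 0 + ∑ r : m × m, (if r.2 = c then K i r.1 else 0) * Y r := fun Y => by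
        rw [sum_ite_snd c (fun q => K i q), zero_add]
      exact stdGauss_small_ball hlin hθ.le (sum_ite_snd_sq c (fun q => K i q)).ge
    have hlm : ∀ i ∈ Finset.univ, Measurable fun Y : m × m → ℝ => ∑ q, K i q * Y (q, c) :=
      fun i _ => by fun_prop
    have h1 : (stdGauss (m × m)).real {Y | ∑ i, (∑ q, K i q * Y (q, c)) ^ 2
        < θ ^ 2 / 2 * ∑ i, ∑ q, K i q ^ 2} ≤ 2 * θ :=
      sum_sq_small_ball Finset.univ hlm (fun i _ => Finset.sum_nonneg fun _ _ => sq_nonneg _)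
        hθ.le hsb
    have := measureReal_le_of_sections_off (measurable_mix {r : m × m | r.2 = a}) (map_mix _)
      (E := {Y | congrEntry K a c Y ^ 2 < (θ ^ 2) ^ 2 * (fsq K / 2)})
      (measurableSet_lt ((measurable_congrEntry K a c).pow_const 2) measurable_const) hθ.le h1
      fun x hx => ?_
    · linarith
    refine (measureReal_mono fun y hy => ?_).trans (stdGauss_small_ball (ι := m × m) (m := 0)
      (X := fun y => ∑ i, (∑ q, K i q * x (q, c)) * y (i, a))
      (c := fun r => if r.2 = a then ∑ q, K r.1 q * x (q, c) else 0)
      (s := ∑ i, (∑ q, K i q * x (q, c)) ^ 2) (fun y => ?_) hθ.le ?_)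
    · simp only [Set.mem_ofPred_eq, not_lt] at hx hy ⊢
      rw [congrEntry_mix K hac] at hy
      refine hy.trans_le ?_
      have := mul_le_mul_of_nonneg_left hx (sq_nonneg θ)
      rw [fsq]
      nlinarith
    · rw [sum_ite_snd a (fun i => ∑ q, K i q * x (q, c)), zero_add]
    · rw [sum_ite_snd_sq a (fun i => ∑ q, K i q * x (q, c))]
  have := sum_sq_small_ball (μ := stdGauss (m × m)) (Finset.univ : Finset m).offDiag
    (X := fun r => congrEntry K r.1 r.2) (fun r _ => measurable_congrEntry _ _ _)
    (s := fun _ => fsq K / 2) (fun _ _ => by positivity) (by positivity) hpair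
  refine (measureReal_mono fun Y hY => ?_).trans (this.trans (by linarith))
  simp only [Set.mem_ofPred_eq] at hY ⊢
  have hsum : ∑ r ∈ (Finset.univ : Finset m).offDiag, congrEntry K r.1 r.2 Y ^ 2
      ≤ fsq ((Matrix.of fun i j => Y (i, j))ᵀ * K * Matrix.of fun i j => Y (i, j)) := by
    simp only [fsq, congr_apply]
    rw [← Fintype.sum_prod_type (f := fun r : m × m => congrEntry K r.1 r.2 Y ^ 2)]
    exact Finset.sum_le_sum_of_subset_of_nonneg (Finset.subset_univ _) fun _ _ _ => sq_nonneg _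
  refine hsum.trans_lt (hY.trans_le ?_)
  rw [Finset.sum_const, Finset.offDiag_card, Finset.card_univ, nsmul_eq_mul,
    Nat.cast_sub (Nat.le_mul_self _), Nat.cast_mul]
  have hM : (2 : ℝ) ≤ Fintype.card m := by exact_mod_cast hm
  have : (Fintype.card m : ℝ) ^ 2 / 2 ≤ Fintype.card m * Fintype.card m - Fintype.card m := by
    nlinarith
  have := mul_le_mul_of_nonneg_right this (by positivity : 0 ≤ θ ^ 4 * fsq K)
  nlinarith

end

/-! ### Lower bounds for inverses -/

section

variable {m : Type*} [Fintype m]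

/-- Bessel's inequality, row by row. -/
lemma sum_sq_mulVec_le_fsq {E : Submodule ℝ (EuclideanSpace ℝ m)} {d : ℕ}
    (b : OrthonormalBasis (Fin d) ℝ E) (N : Matrix m m ℝ) :
    ∑ i, ∑ p, (N *ᵥ WithLp.ofLp (b i : EuclideanSpace ℝ m)) p ^ 2 ≤ fsq N := by
  have ho : Orthonormal ℝ (fun i => (b i : EuclideanSpace ℝ m)) :=
    b.orthonormal.comp_linearIsometry E.subtypeₗᵢ
  rw [Finset.sum_comm]
  refine Finset.sum_le_sum fun p _ => ?_
  have := ho.sum_inner_products_le (WithLp.toLp 2 (N p)) (s := Finset.univ)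
  rw [EuclideanSpace.real_norm_sq_eq] at this
  refine le_trans (le_of_eq (Finset.sum_congr rfl fun i _ => ?_)) this
  rw [Real.norm_eq_abs, sq_abs]
  congr 1

/-- If `D = A - Bᵀ D'⁻¹ B` and `T` inverts `D'` on the coordinate vectors in `I`, then `D` agrees
with `A - Bᵀ T B` on a subspace of dimension at least `#I`, which bounds `D⁻¹` from below. -/
lemma card_sq_le_fsq_mul_fsq [DecidableEq m] {A B D K D' K' T : Matrix m m ℝ} {I : Finset m}
    (hD : D = A - Bᵀ * K' * B) (hK : K * D = 1) (hK' : K' * D' = 1)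
    (hT : ∀ p, ∀ l ∈ I, (T * D') p l = if p = l then 1 else 0) :
    (I.card : ℝ) ^ 2 ≤ fsq K * fsq (A - Bᵀ * T * B) := by
  set N := A - Bᵀ * T * B with hN
  -- Extension by zero of a vector indexed by `I`.
  let ext : (I → ℝ) → m → ℝ := fun u p => if h : p ∈ I then u ⟨p, h⟩ else 0
  have hText : ∀ u : I → ℝ, T *ᵥ (D' *ᵥ ext u) = ext u := by
    intro u
    ext p
    rw [mulVec_mulVec]
    simp only [mulVec, dotProduct]
    rw [← Finset.sum_subset (Finset.subset_univ I) (fun l _ hl => by simp [ext, hl]),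
      Finset.sum_congr rfl (fun l hl => by rw [hT p l hl])]
    by_cases hp : p ∈ I
    · simp [hp]
    · rw [Finset.sum_eq_zero fun l hl => by
        rw [if_neg (by rintro rfl; exact hp hl), zero_mul]]
      simp [ext, hp]
  let extL : (I → ℝ) →ₗ[ℝ] (m → ℝ) :=
    { toFun := ext
      map_add' := fun u v => by
        ext p; by_cases hp : p ∈ I <;> simp [ext, hp]
      map_smul' := fun r u => by
        ext p; by_cases hp : p ∈ I <;> simp [ext, hp] }
  -- The subspace of all `v` with `B v` in the image under `D'` of the coordinate vectors in `I`.
  let f : EuclideanSpace ℝ m × (I → ℝ) →ₗ[ℝ] (m → ℝ) :=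
    (B.mulVecLin ∘ₗ (WithLp.linearEquiv 2 ℝ (m → ℝ)).toLinearMap).coprod
      (-(D'.mulVecLin ∘ₗ extL))
  have hf : ∀ v u, f (v, u) = 0 → B *ᵥ WithLp.ofLp v = D' *ᵥ ext u := by
    intro v u h
    have : B *ᵥ WithLp.ofLp v + -(D' *ᵥ ext u) = 0 := h
    rwa [← sub_eq_add_neg, sub_eq_zero] at this
  have hker : I.card ≤ Module.finrank ℝ (LinearMap.ker f) := by
    have h1 := LinearMap.finrank_range_add_finrank_ker f
    have h2 : Module.finrank ℝ (LinearMap.range f) ≤ Fintype.card m :=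
      (Submodule.finrank_le _).trans (by simp)
    have h3 : Module.finrank ℝ (EuclideanSpace ℝ m × (I → ℝ)) = Fintype.card m + I.card := by
      rw [Module.finrank_prod]; simp
    omega
  let V : Submodule ℝ (EuclideanSpace ℝ m) := (LinearMap.ker f).map (LinearMap.fst ℝ _ _)
  have hinj : Set.InjOn (LinearMap.fst ℝ (EuclideanSpace ℝ m) (I → ℝ)) (LinearMap.ker f) := by
    rintro ⟨v, u⟩ h1 ⟨v', u'⟩ h2 h
    have hv : v = v' := h
    subst hv
    have e : ext u = ext u' := by
      rw [← hText u, ← hText u', ← hf v u h1, ← hf v u' h2]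
    have : u = u' := by
      ext ⟨p, hp⟩
      have := congrFun e p
      simpa [ext, hp] using this
    rw [this]
  have hV : I.card ≤ Module.finrank ℝ V := by
    have : Module.finrank ℝ V = Module.finrank ℝ (LinearMap.ker f) :=
      (LinearEquiv.finrank_eq (LinearEquiv.ofBijective
        ((LinearMap.fst ℝ (EuclideanSpace ℝ m) (I → ℝ)).submoduleMap (LinearMap.ker f))
        ⟨fun x y hxy => Subtype.ext (hinj x.2 y.2 (congrArg Subtype.val hxy)),
          LinearMap.submoduleMap_surjective _ _⟩)).symm
    omega
  -- On `V` the matrices `D` and `N` agree, so that `K` inverts `N` there.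
  have hKN : ∀ v ∈ V, K *ᵥ (N *ᵥ WithLp.ofLp v) = WithLp.ofLp v := by
    rintro v ⟨⟨v', u⟩, h1, rfl⟩
    have h2 := hf v' u h1
    change K *ᵥ (N *ᵥ WithLp.ofLp v') = WithLp.ofLp v'
    have h3 : K' *ᵥ (B *ᵥ WithLp.ofLp v') = T *ᵥ (B *ᵥ WithLp.ofLp v') := by
      rw [h2, hText, mulVec_mulVec, hK', one_mulVec]
    have h4 : N *ᵥ WithLp.ofLp v' = D *ᵥ WithLp.ofLp v' := by
      rw [hN, hD, sub_mulVec, sub_mulVec, ← mulVec_mulVec, ← mulVec_mulVec, ← h3, mulVec_mulVec,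
        mulVec_mulVec]
    rw [h4, mulVec_mulVec, hK, one_mulVec]
  set b := stdOrthonormalBasis ℝ V with hb
  set d := Module.finrank ℝ V with hd
  have hone : ∀ i, (1 : ℝ) = ∑ p, (Kᵀ *ᵥ WithLp.ofLp (b i : EuclideanSpace ℝ m)) p
      * (N *ᵥ WithLp.ofLp (b i : EuclideanSpace ℝ m)) p := by
    intro i
    set v := WithLp.ofLp (b i : EuclideanSpace ℝ m) with hv
    have h1 : (1 : ℝ) = v ⬝ᵥ v := by
      have h0 : ‖(b i : EuclideanSpace ℝ m)‖ = 1 := b.norm_eq_one i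
      have : ‖(b i : EuclideanSpace ℝ m)‖ ^ 2 = 1 := by rw [h0, one_pow]
      rw [EuclideanSpace.real_norm_sq_eq] at this
      rw [← this]
      simp [dotProduct, sq, hv]
    change _ = (Kᵀ *ᵥ v) ⬝ᵥ (N *ᵥ v)
    rw [mulVec_transpose, ← dotProduct_mulVec, hKN _ (b i).2, ← h1]
  -- The trace of `K N` over `V` is `dim V`; bound it by the Cauchy-Schwarz inequality.
  have hsum : (d : ℝ) = ∑ i, ∑ p, (Kᵀ *ᵥ WithLp.ofLp (b i : EuclideanSpace ℝ m)) p
      * (N *ᵥ WithLp.ofLp (b i : EuclideanSpace ℝ m)) p := by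
    rw [← Finset.sum_congr rfl fun i _ => hone i]
    simp
  have hcs : (d : ℝ) ^ 2 ≤ fsq Kᵀ * fsq N := by
    rw [hsum, ← Fintype.sum_prod_type']
    refine (Finset.sum_mul_sq_le_sq_mul_sq _ _ _).trans ?_
    simp only [Fintype.sum_prod_type]
    exact mul_le_mul (sum_sq_mulVec_le_fsq b Kᵀ) (sum_sq_mulVec_le_fsq b N)
      (Finset.sum_nonneg fun _ _ => Finset.sum_nonneg fun _ _ => sq_nonneg _) (fsq_nonneg _)
  rw [fsq_transpose] at hcs
  refine le_trans ?_ hcs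
  have : (I.card : ℝ) ≤ d := by exact_mod_cast hV
  gcongr

/-- A vector at distance at least `r` from the span of a family has a dual vector of norm at most
`1 / r`. -/
lemma exists_dual_vector {J L : Type*} [Fintype J] (x : EuclideanSpace ℝ J) (s : Finset L)
    (z : L → EuclideanSpace ℝ J) {r : ℝ} (hr : 0 < r)
    (h : ∀ c : L → ℝ, r ^ 2 ≤ ‖x - ∑ l ∈ s, c l • z l‖ ^ 2) :
    ∃ y : EuclideanSpace ℝ J, inner ℝ y x = 1 ∧ (∀ l ∈ s, inner ℝ y (z l) = 0) ∧
      ‖y‖ ^ 2 ≤ 1 / r ^ 2 := by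
  classical
  set W := Submodule.span ℝ (z '' s) with hW
  set q := x - W.starProjection x with hq
  have hqW : q ∈ Wᗮ := W.sub_starProjection_mem_orthogonal x
  obtain ⟨c, hc⟩ : ∃ c : L → ℝ, ∑ l ∈ s, c l • z l = W.starProjection x := by
    obtain ⟨c, hc⟩ :=
      (Submodule.mem_span_image_finset_iff_exists_fun ℝ).1 (W.starProjection_apply_mem x)
    refine ⟨fun l => if hl : l ∈ s then c ⟨l, hl⟩ else 0, ?_⟩
    rw [← hc, ← Finset.sum_coe_sort]
    exact Finset.sum_congr rfl fun l _ => by simp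
  have hqr : r ^ 2 ≤ ‖q‖ ^ 2 := by
    have := h c
    rwa [hc] at this
  have hq0 : 0 < ‖q‖ ^ 2 := lt_of_lt_of_le (by positivity) hqr
  have hx : inner ℝ q x = ‖q‖ ^ 2 := by
    have : x = q + W.starProjection x := by rw [hq]; abel
    conv_lhs => rw [this]
    rw [inner_add_right, real_inner_self_eq_norm_sq,
      Submodule.inner_left_of_mem_orthogonal (W.starProjection_apply_mem x) hqW, add_zero]
  refine ⟨(‖q‖ ^ 2)⁻¹ • q, ?_, fun l hl => ?_, ?_⟩
  · rw [real_inner_smul_left, hx, inv_mul_cancel₀ hq0.ne']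
  · rw [real_inner_smul_left, Submodule.inner_left_of_mem_orthogonal
      (Submodule.subset_span (Set.mem_image_of_mem z (by exact_mod_cast hl))) hqW, mul_zero]
  · rw [norm_smul, mul_pow, norm_inv, norm_pow, norm_norm, inv_pow, sq (‖q‖ ^ 2), mul_inv,
      mul_assoc, inv_mul_cancel₀ hq0.ne', mul_one, ← one_div]
    exact one_div_le_one_div_of_le (by positivity) hqr

end

/-! ### Partial inverses of Gaussian symmetric matrices -/

section

variable {m : Type*} [Fintype m]

/-- The part of column `l` of a matrix in the rows `J`. -/
noncomputable def partCol {m : Type*} (J : Finset m) (l : m) (H : Matrix m m ℝ) :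
    EuclideanSpace ℝ J :=
  WithLp.toLp 2 fun j => H j l

lemma partCol_apply {m : Type*} (J : Finset m) (l : m) (H : Matrix m m ℝ) (j : J) :
    partCol J l H j = H j l := rfl

@[fun_prop]
lemma continuous_partCol {m : Type*} (J : Finset m) (l : m) : Continuous (partCol J l) := by
  refine (PiLp.continuous_toLp 2 _).comp (continuous_pi fun j => ?_)
  exact continuous_id.matrix_elem _ _

/-- The matrices in which the segment of column `p` in the rows `J` is at squared distance less than
`r` from the span of the other column segments in `P`. -/
def nearSpan {m : Type*} [DecidableEq m] (P J : Finset m) (r : ℝ) (p : m) : Set (Matrix m m ℝ) :=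
  {H | ∃ c : m → ℝ, ‖partCol J p H - ∑ l ∈ P.erase p, c l • partCol J l H‖ ^ 2 < r}

lemma isOpen_nearSpan {m : Type*} [DecidableEq m] (P J : Finset m) (r : ℝ) (p : m) :
    IsOpen (nearSpan P J r p) := by
  simp only [nearSpan, Set.ofPred_exists]
  exact isOpen_iUnion fun c => isOpen_lt (by fun_prop) continuous_const

/-- `Matrix m m ℝ` carries no measurable structure of its own; the product structure of
`m → m → ℝ` is meant here and in the statements with explicit `@` below. -/
lemma measurable_pi_of_entries {m Ω : Type*} [MeasurableSpace Ω] {f : Ω → Matrix m m ℝ}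
    (hf : ∀ i j, Measurable fun x => f x i j) : @Measurable Ω (m → m → ℝ) _ _ f :=
  measurable_pi_lambda _ fun i => measurable_pi_lambda _ fun j => hf i j

lemma measurableSet_nearSpan [DecidableEq m] (P J : Finset m) (r : ℝ) (p : m) :
    @MeasurableSet (m → m → ℝ) _ (nearSpan P J r p) :=
  @IsOpen.measurableSet (m → m → ℝ) _ _ _ _ (isOpen_nearSpan P J r p)

/-- A column segment of a random symmetric matrix is far from the span of few other such
segments: conditionally on these, its component in each orthogonal direction is Gaussian. -/
lemma stdGauss_partCol_near_span [DecidableEq m] (τ : ℝ) (F : Matrix m m ℝ) {P J : Finset m}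
    (hPJ : Disjoint P J) {d : ℕ} (hd : P.card + d ≤ J.card) {p : m} (hp : p ∈ P) {θ : ℝ}
    (hθ : 0 ≤ θ) :
    (stdGauss (m × m)).real {X | symMat τ F X ∈ nearSpan P J (θ ^ 2 * d * τ ^ 2) p}
      ≤ 2 * θ := by
  have hmeas := (measurable_pi_of_entries (measurable_symMat τ F))
    (measurableSet_nearSpan P J (θ ^ 2 * d * τ ^ 2) p)
  have hpJ : p ∉ J := Finset.disjoint_left.1 hPJ hp
  -- The entries of `X` that enter column `p` in the rows `J`. As `P` and `J` are disjoint, they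
  -- enter none of the other column segments.
  set s : Set (m × m) := {r | (r.1 ∈ J ∧ r.2 = p) ∨ (r.1 = p ∧ r.2 ∈ J)} with hs
  refine measureReal_le_of_sections (measurable_mix s) (map_mix s) hmeas
    (by positivity) fun X => ?_
  have hl : ∀ l ∈ P.erase p, ∀ Y,
      partCol J l (symMat τ F (mix s (X, Y))) = partCol J l (symMat τ F X) := by
    intro l hl Y
    have hlp := Finset.ne_of_mem_erase hl
    have hlJ : l ∉ J := Finset.disjoint_left.1 hPJ (Finset.mem_of_mem_erase hl)
    ext j
    have hjp : (j : m) ≠ p := fun h => hpJ (h ▸ j.2)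
    rw [partCol_apply, partCol_apply, symMat_apply, symMat_apply,
      mix_of_notMem (by simp [hs, hlp, hjp]), mix_of_notMem (by simp [hs, hlp, hlJ])]
  have hpY : ∀ Y (j : J), partCol J p (symMat τ F (mix s (X, Y))) j
      = τ * (Y (j, p) + Y (p, j)) + F j p := by
    intro Y j
    rw [partCol_apply, symMat_apply, mix_of_mem (by simp [hs]), mix_of_mem (by simp [hs])]
  set W := Submodule.span ℝ
    ((fun l => partCol J l (symMat τ F X)) '' (P.erase p : Finset m)) with hW
  set b := stdOrthonormalBasis ℝ Wᗮ with hb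
  set d' := Module.finrank ℝ Wᗮ with hd'
  have hdd : d ≤ d' := by
    have h1 := Submodule.finrank_add_finrank_orthogonal W
    have h2 : Module.finrank ℝ W ≤ (P.erase p).card := by
      classical
      rw [hW, ← Finset.coe_image]
      exact (finrank_span_finset_le_card _).trans Finset.card_image_le
    have h3 : Module.finrank ℝ (EuclideanSpace ℝ J) = J.card := by simp
    have := Finset.card_erase_le (s := P) (a := p)
    omega
  have ho : Orthonormal ℝ (fun i => (b i : EuclideanSpace ℝ J)) :=
    b.orthonormal.comp_linearIsometry Wᗮ.subtypeₗᵢ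
  -- The orthonormal basis of the orthogonal complement, extended by zero.
  set v : Fin d' → m → ℝ := fun i q => if h : q ∈ J then (b i : EuclideanSpace ℝ J) ⟨q, h⟩ else 0
    with hv
  have hvp : ∀ i, v i p = 0 := fun i => by simp [hv, hpJ]
  have hv1 : ∀ i, ∑ q, v i q ^ 2 = 1 := by
    intro i
    have h0 : ‖(b i : EuclideanSpace ℝ J)‖ ^ 2 = 1 := by
      rw [show ‖(b i : EuclideanSpace ℝ J)‖ = 1 from b.norm_eq_one i, one_pow]
    rw [EuclideanSpace.real_norm_sq_eq] at h0
    rw [← h0, ← Finset.sum_subset (Finset.subset_univ J) (fun q _ hq => by simp [hv, hq]),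
      ← Finset.sum_coe_sort]
    exact Finset.sum_congr rfl fun j _ => by simp [hv]
  set c : Fin d' → m × m → ℝ := fun i r =>
    τ * ((if r.2 = p then v i r.1 else 0) + (if r.1 = p then v i r.2 else 0)) with hc
  have hX : ∀ i Y, inner ℝ (b i : EuclideanSpace ℝ J) (partCol J p (symMat τ F (mix s (X, Y))))
      = (∑ q, v i q * F q p) + ∑ r, c i r * Y r := by
    intro i Y
    have e1 : ∑ r, c i r * Y r = ∑ q, v i q * (τ * (Y (q, p) + Y (p, q))) := by
      have e2 : ∀ r : m × m, c i r * Y r = τ * ((if r.2 = p then v i r.1 else 0) * Y r)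
          + τ * ((if r.1 = p then v i r.2 else 0) * Y r) := fun r => by simp only [hc]; ring
      simp only [e2, Finset.sum_add_distrib, ← Finset.mul_sum]
      rw [sum_ite_snd, Fintype.sum_prod_type]
      simp only [ite_mul, zero_mul, Finset.sum_ite_irrel, Finset.sum_const_zero,
        Finset.sum_ite_eq', Finset.mem_univ, if_true]
      rw [← mul_add, ← Finset.sum_add_distrib, Finset.mul_sum]
      exact Finset.sum_congr rfl fun q _ => by ring
    rw [e1, ← Finset.sum_add_distrib,
      ← Finset.sum_subset (Finset.subset_univ J) (fun q _ hq => by simp [hv, hq]),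
      ← Finset.sum_coe_sort, PiLp.inner_apply]
    refine Finset.sum_congr rfl fun j _ => ?_
    rw [hpY]
    simp only [hv, j.2, dif_pos, Real.inner_apply]
    simp
    ring
  have hvar : ∀ i, ∑ r, c i r ^ 2 = 2 * τ ^ 2 := by
    intro i
    have e2 : ∀ r : m × m, c i r ^ 2 = τ ^ 2 * (if r.2 = p then v i r.1 else 0) ^ 2
        + τ ^ 2 * (if r.1 = p then v i r.2 else 0) ^ 2 := by
      rintro ⟨q, q'⟩
      simp only [hc]
      by_cases h1 : q' = p
      · by_cases h2 : q = p
        · simp [h1, h2, hvp]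
        · simp only [h1, h2, if_true, if_false]; ring
      · simp only [h1, if_false]; ring
    simp only [e2, Finset.sum_add_distrib, ← Finset.mul_sum]
    rw [sum_ite_snd_sq, Fintype.sum_prod_type]
    simp only [ite_pow, ne_eq, OfNat.ofNat_ne_zero, not_false_eq_true, zero_pow,
      Finset.sum_ite_irrel, Finset.sum_const_zero,
        Finset.sum_ite_eq', Finset.mem_univ, if_true, hv1]
    ring
  have key := sum_sq_small_ball (μ := stdGauss (m × m)) (Finset.univ : Finset (Fin d'))
    (X := fun i Y => inner ℝ (b i : EuclideanSpace ℝ J) (partCol J p (symMat τ F (mix s (X, Y)))))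
    (fun i _ => by simp only [hX]; fun_prop) (s := fun _ => 2 * τ ^ 2)
    (fun _ _ => by positivity) (θ := θ) hθ
    (fun i _ => stdGauss_small_ball (hX i) hθ (hvar i).ge)
  refine (measureReal_mono ?_).trans key
  rintro Y ⟨a, ha⟩
  simp only [Set.mem_ofPred_eq, Finset.sum_const, Finset.card_univ, Fintype.card_fin,
    nsmul_eq_mul]
  have h1 : ∀ i, inner ℝ (b i : EuclideanSpace ℝ J) (partCol J p (symMat τ F (mix s (X, Y))))
      = inner ℝ (b i : EuclideanSpace ℝ J) (partCol J p (symMat τ F (mix s (X, Y)))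
        - ∑ l ∈ P.erase p, a l • partCol J l (symMat τ F (mix s (X, Y)))) := by
    intro i
    have hmem : ∑ l ∈ P.erase p, a l • partCol J l (symMat τ F (mix s (X, Y))) ∈ W := by
      refine Submodule.sum_mem _ fun l hl' => Submodule.smul_mem _ _ ?_
      rw [hl l hl']
      exact Submodule.subset_span ⟨l, by exact_mod_cast hl', rfl⟩
    rw [inner_sub_right, Submodule.inner_left_of_mem_orthogonal hmem (b i).2, sub_zero]
  simp only [h1]
  -- Bessel's inequality bounds the distance to the span from below.
  have h2 := ho.sum_inner_products_le (partCol J p (symMat τ F (mix s (X, Y)))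
        - ∑ l ∈ P.erase p, a l • partCol J l (symMat τ F (mix s (X, Y)))) (s := Finset.univ)
  simp only [Real.norm_eq_abs, sq_abs] at h2
  refine (h2.trans_lt ha).trans_le ?_
  have : (d : ℝ) ≤ d' := by exact_mod_cast hdd
  calc θ ^ 2 * d * τ ^ 2 ≤ θ ^ 2 * d' * τ ^ 2 := by gcongr
    _ = _ := by ring

/-- Off an event of small probability, the random symmetric matrix has a partial left inverse of
controlled size, on at least half of the prescribed coordinates `P`. It is much smaller than the
inverse typically is, because the columns in `P` restricted to `J` form a rectangular matrix. The
exceptional set `G` does not depend on the fixed matrix `F`. -/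
theorem stdGauss_partial_inverse [DecidableEq m] {τ : ℝ} (hτ : 0 < τ)
    {P J : Finset m} (hPJ : Disjoint P J) {d : ℕ} (hd0 : 0 < d) (hd : P.card + d ≤ J.card) {θ : ℝ}
    (hθ : 0 < θ) :
    ∃ G : Set (Matrix m m ℝ), @MeasurableSet (m → m → ℝ) _ G ∧
      (∀ F : Matrix m m ℝ, (stdGauss (m × m)).real {X | symMat τ F X ∈ G} ≤ 4 * θ) ∧
      ∀ H : Matrix m m ℝ, H ∉ G → ∃ (I : Finset m) (T : Matrix m m ℝ),
        (P.card : ℝ) / 2 ≤ I.card ∧ (∀ q, ∀ l ∈ I, (T * H) q l = if q = l then 1 else 0) ∧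
        fsq T ≤ P.card / (θ ^ 2 * d * τ ^ 2) := by
  set E : m → Set (Matrix m m ℝ) := nearSpan P J (θ ^ 2 * d * τ ^ 2) with hE
  have hind : ∀ p, @Measurable (m → m → ℝ) ℝ _ _ ((E p)ᶜ.indicator fun _ => (1 : ℝ)) := fun p =>
    measurable_const.indicator (measurableSet_nearSpan P J _ p).compl
  refine ⟨{H | ∑ p ∈ P, (E p)ᶜ.indicator (fun _ => (1 : ℝ)) H ^ 2 < 1 ^ 2 / 2 * ∑ p ∈ P, 1},
    measurableSet_lt (δ := m → m → ℝ)
      (Finset.measurable_sum _ fun p _ => (hind p).pow_const 2) measurable_const,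
    fun F => ?_, fun H hcon => ?_⟩
  -- Apply the lemma on sums of squares to indicator functions: at least half of the columns in `P`
  -- are far from the span of the others.
  · have key := sum_sq_small_ball (μ := stdGauss (m × m)) P
      (X := fun p X => (E p)ᶜ.indicator (fun _ => (1 : ℝ)) (symMat τ F X))
      (fun p _ => (hind p).comp (measurable_pi_of_entries (measurable_symMat τ F)))
      (s := fun _ => 1)
      (fun _ _ => zero_le_one) (θ := 1) (p := 2 * θ) (by positivity) (fun p hp => by
        refine (measureReal_mono fun X hX => ?_).trans
          (stdGauss_partCol_near_span τ F hPJ hd hp hθ.le)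
        by_contra h
        have h' : symMat τ F X ∈ (E p)ᶜ := h
        have hX' : (E p)ᶜ.indicator (fun _ => (1 : ℝ)) (symMat τ F X) ^ 2 < 1 ^ 2 * 1 := hX
        rw [Set.indicator_of_mem h'] at hX'
        norm_num at hX')
    rw [show 2 * (2 * θ) = 4 * θ by ring] at key
    exact key
  classical
  -- Outside `G`, the rows of `T` are the vectors dual to the column segments that are not near the
  -- span of the others.
  set I := P.filter fun p => H ∉ E p with hI
  set r := θ * √d * τ with hr
  have hr0 : 0 < r := by positivity
  have hr2 : r ^ 2 = θ ^ 2 * d * τ ^ 2 := by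
    rw [hr, mul_pow, mul_pow, Real.sq_sqrt (by positivity)]
  have hy : ∀ p ∈ I, ∃ y : EuclideanSpace ℝ J, inner ℝ y (partCol J p H) = 1 ∧
      (∀ l ∈ P.erase p, inner ℝ y (partCol J l H) = 0) ∧ ‖y‖ ^ 2 ≤ 1 / r ^ 2 := by
    intro p hp
    refine exists_dual_vector _ _ (fun l => partCol J l H) hr0 fun c => ?_
    rw [hr2]
    have h1 := (Finset.mem_filter.1 hp).2
    simp only [hE, nearSpan, Set.mem_ofPred_eq, not_exists, not_lt] at h1
    exact h1 c
  choose! y hy1 hy0 hyn using hy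
  set T : Matrix m m ℝ := Matrix.of fun q j =>
    if q ∈ I then (if h : j ∈ J then y q ⟨j, h⟩ else 0) else 0 with hT
  refine ⟨I, T, ?_, ?_, ?_⟩
  · have h1 := hcon
    simp only [Set.mem_ofPred_eq, not_lt] at h1
    have h2 : ∀ p, (E p)ᶜ.indicator (fun _ => (1 : ℝ)) H ^ 2 = if H ∉ E p then 1 else 0 := by
      intro p
      by_cases h : H ∈ E p <;> simp [Set.indicator, h]
    simp only [h2, Finset.sum_boole, Finset.sum_const, nsmul_eq_mul, mul_one, one_pow] at h1
    linarith
  · intro q l hl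
    rw [Matrix.mul_apply]
    by_cases hq : q ∈ I
    · have e1 : ∑ j, T q j * H j l = inner ℝ (y q) (partCol J l H) := by
        rw [← Finset.sum_subset (Finset.subset_univ J)
          (fun j _ hj => by simp [hT, hj]), ← Finset.sum_coe_sort, PiLp.inner_apply]
        refine Finset.sum_congr rfl fun j _ => ?_
        simp only [hT, Matrix.of_apply, hq, if_true, j.2, dif_pos, Real.inner_apply]
        rfl
      rw [e1]
      by_cases hql : q = l
      · subst hql; simp [hy1 q hq]
      · rw [if_neg hql]
        exact hy0 q hq l (Finset.mem_erase.2 ⟨fun h => hql h.symm, (Finset.mem_filter.1 hl).1⟩)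
    · rw [if_neg (by rintro rfl; exact hq hl)]
      exact Finset.sum_eq_zero fun j _ => by simp [hT, hq]
  · have h1 : ∀ q, ∑ j, T q j ^ 2 ≤ if q ∈ I then 1 / r ^ 2 else 0 := by
      intro q
      by_cases hq : q ∈ I
      · rw [if_pos hq, ← Finset.sum_subset (Finset.subset_univ J)
          (fun j _ hj => by simp [hT, hj]), ← Finset.sum_coe_sort]
        have := hyn q hq
        rw [EuclideanSpace.real_norm_sq_eq] at this
        refine le_trans (le_of_eq (Finset.sum_congr rfl fun j _ => ?_)) this
        simp [hT, hq]
      · simp [hT, hq]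
    unfold fsq
    refine (Finset.sum_le_sum fun q _ => h1 q).trans ?_
    rw [Finset.sum_ite_mem, Finset.univ_inter, Finset.sum_const, nsmul_eq_mul, hr2, mul_one_div]
    have : (I.card : ℝ) ≤ P.card := by exact_mod_cast Finset.card_filter_le _ _
    gcongr

end

/-! ### The Frobenius norm of Gaussian symmetric matrices -/

section

variable {m : Type*} [Fintype m]

/-- The coefficients of the entry `(r.1, r.2)` of `symMat τ F X` as an affine function of `X`. -/
def symCoeff {m : Type*} [DecidableEq m] (τ : ℝ) (r s : m × m) : ℝ :=
  τ * ((if s = r then 1 else 0) + if s = r.swap then 1 else 0)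

lemma symMat_eq_symCoeff [DecidableEq m] (τ : ℝ) (F : Matrix m m ℝ) (X : m × m → ℝ) (r : m × m) :
    symMat τ F X r.1 r.2 = F r.1 r.2 + ∑ s, symCoeff τ r s * X s := by
  have : ∀ s, symCoeff τ r s * X s
      = τ * ((if s = r then X s else 0) + if s = r.swap then X s else 0) := by
    intro s
    unfold symCoeff
    split_ifs <;> ring
  simp only [this, ← Finset.mul_sum, Finset.sum_add_distrib, Finset.sum_ite_eq', Finset.mem_univ,
    if_true, symMat_apply, Prod.swap, Prod.mk.eta]
  ring

lemma sum_symCoeff_sq_le [DecidableEq m] (τ : ℝ) (r : m × m) :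
    ∑ s, symCoeff τ r s ^ 2 ≤ 4 * τ ^ 2 := by
  have : ∀ s, symCoeff τ r s ^ 2
      ≤ 2 * τ ^ 2 * ((if s = r then 1 else 0) + if s = r.swap then 1 else 0) := by
    intro s
    unfold symCoeff
    split_ifs <;> nlinarith [sq_nonneg τ]
  refine (Finset.sum_le_sum fun s _ => this s).trans ?_
  simp only [← Finset.mul_sum, Finset.sum_add_distrib, Finset.sum_ite_eq', Finset.mem_univ, if_true]
  linarith

lemma le_sum_symCoeff_sq [DecidableEq m] (τ : ℝ) (r : m × m) :
    2 * τ ^ 2 ≤ ∑ s, symCoeff τ r s ^ 2 := by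
  have : ∀ s, τ ^ 2 * ((if s = r then 1 else 0) + if s = r.swap then 1 else 0)
      ≤ symCoeff τ r s ^ 2 := by
    intro s
    unfold symCoeff
    split_ifs <;> nlinarith [sq_nonneg τ]
  refine le_trans ?_ (Finset.sum_le_sum fun s _ => this s)
  simp only [← Finset.mul_sum, Finset.sum_add_distrib, Finset.sum_ite_eq', Finset.mem_univ, if_true]
  linarith

lemma stdGauss_fsq_symMat_large [DecidableEq m] [Nonempty m] {τ θ : ℝ} (hτ : 0 < τ) (hθ : 0 < θ) :
    (stdGauss (m × m)).real {X | 4 * τ ^ 2 * Fintype.card m ^ 2 / θ < fsq (symMat τ 0 X)} ≤ θ := by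
  have hc : (0 : ℝ) < Fintype.card m := by exact_mod_cast Fintype.card_pos
  have key := sum_sq_large (ι := m × m) (Finset.univ : Finset (m × m))
    (X := fun r X => symMat τ 0 X r.1 r.2) (a := fun r => (0 : Matrix m m ℝ) r.1 r.2)
    (c := symCoeff τ) (S := 4 * τ ^ 2 * Fintype.card m ^ 2) (r := θ)
    (fun r _ X => symMat_eq_symCoeff τ 0 X r) (by positivity) hθ
    ((Finset.sum_le_sum fun r _ => show _ ≤ 4 * τ ^ 2 by
      simpa using sum_symCoeff_sq_le τ r).trans (le_of_eq (by
        simp only [Finset.sum_const, Finset.card_univ, Fintype.card_prod, nsmul_eq_mul]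
        push_cast
        ring)))
  refine (measureReal_mono fun X hX => ?_).trans key
  simp only [Fintype.sum_prod_type, Set.mem_ofPred_eq]
  exact le_of_lt hX

/-- The lower bound holds uniformly in the fixed matrix `F`. -/
lemma stdGauss_fsq_symMat_small [DecidableEq m] (τ : ℝ) (F : Matrix m m ℝ) {θ : ℝ} (hθ : 0 ≤ θ) :
    (stdGauss (m × m)).real {X | fsq (symMat τ F X) < θ ^ 2 * τ ^ 2 * Fintype.card m ^ 2}
      ≤ 2 * θ := by
  have key := sum_sq_small_ball (μ := stdGauss (m × m)) (Finset.univ : Finset (m × m))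
    (X := fun r X => symMat τ F X r.1 r.2) (fun r _ => measurable_symMat τ F r.1 r.2)
    (s := fun _ => 2 * τ ^ 2) (fun _ _ => by positivity) (θ := θ) hθ
    (fun r _ => stdGauss_small_ball (symMat_eq_symCoeff τ F · r) hθ (le_sum_symCoeff_sq τ r))
  refine (measureReal_mono fun X hX => ?_).trans key
  simp only [Fintype.sum_prod_type, Set.mem_ofPred_eq, Finset.sum_const, Finset.card_univ,
    nsmul_eq_mul]
  refine lt_of_lt_of_le hX (le_of_eq ?_)
  rw [Fintype.card_prod]
  push_cast
  ring

lemma stdGauss_det_symMat_eq_zero [DecidableEq m] [Nonempty m] {τ : ℝ} (hτ : 0 < τ)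
    (F : Matrix m m ℝ) : (stdGauss (m × m)).real {X | (symMat τ F X).det = 0} = 0 := by
  refine stdGauss_det_eq_zero (fun i j => measurable_symMat τ F i j)
    (c := fun r => if r.1 = r.2 then (2 * τ)⁻¹ else 0) ?_ fun X t => ?_
  · obtain ⟨i⟩ := ‹Nonempty m›
    refine Finset.sum_pos' (fun _ _ => sq_nonneg _) ⟨(i, i), Finset.mem_univ _, ?_⟩
    simp only [if_true]
    positivity
  · ext i j
    simp only [symMat_apply, Pi.add_apply, Pi.smul_apply, smul_eq_mul, Matrix.add_apply,
      Matrix.smul_apply, Matrix.one_apply]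
    by_cases h : i = j
    · subst h
      simp
      field_simp
      ring
    · simp [h, Ne.symm h]

end

/-! ### Gaussian densities with respect to Haar measure -/

/-- A measure with density proportional to `exp (-‖R a‖² / 2)` with respect to Haar measure, for an
injective linear map `R` to an inner product space, is determined by the law of `⟨R a, R b⟩`,
which is centred Gaussian of variance `‖R b‖²`. -/
lemma map_eq_smul_withDensity_of_charFun {V E Ω : Type*} [AddCommGroup V] [Module ℝ V]
    [TopologicalSpace V] [IsTopologicalAddGroup V] [ContinuousSMul ℝ V] [T2Space V]
    [FiniteDimensional ℝ V] [MeasurableSpace V] [BorelSpace V]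
    [NormedAddCommGroup E] [InnerProductSpace ℝ E] [FiniteDimensional ℝ E] [MeasurableSpace E]
    [BorelSpace E] (μ : Measure V) [μ.IsAddHaarMeasure] (R : V →ₗ[ℝ] E)
    (hR : Function.Injective R) [MeasurableSpace Ω] {P : Measure Ω} [IsProbabilityMeasure P]
    {L : Ω → V} (hL : Measurable L)
    (h : ∀ a, ∫ ω, Complex.exp ((inner ℝ (R (L ω)) (R a) : ℝ) * Complex.I) ∂P
      = Complex.exp (-(‖R a‖ ^ 2 : ℝ) / 2)) {Z : ENNReal}
    [IsProbabilityMeasure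
      (Z • μ.withDensity fun a => ENNReal.ofReal (Real.exp (-‖R a‖ ^ 2 / 2)))] :
    P.map L = Z • μ.withDensity fun a => ENNReal.ofReal (Real.exp (-‖R a‖ ^ 2 / 2)) := by
  set W := LinearMap.range R with hW
  let e : V ≃L[ℝ] W := (LinearEquiv.ofInjective R hR).toContinuousLinearEquiv
  have he : ∀ a, ((e a : W) : E) = R a := fun a => rfl
  have hRc : Continuous R := R.continuous_of_finiteDimensional
  set ν := Z • μ.withDensity fun a => ENNReal.ofReal (Real.exp (-‖R a‖ ^ 2 / 2)) with hν
  have hem : Measurable e := e.continuous.measurable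
  have : IsProbabilityMeasure (P.map L) := Measure.isProbabilityMeasure_map hL.aemeasurable
  have : IsProbabilityMeasure ((P.map L).map e) :=
    Measure.isProbabilityMeasure_map hem.aemeasurable
  have : IsProbabilityMeasure (ν.map e) := Measure.isProbabilityMeasure_map hem.aemeasurable
  have h1 : (P.map L).map e = stdGaussian W := by
    refine Measure.ext_of_charFun (funext fun w => ?_)
    obtain ⟨a, rfl⟩ := e.surjective w
    rw [charFun_stdGaussian, charFun_apply, Measure.map_map hem hL,
      integral_map (hem.comp hL).aemeasurable (Measurable.aestronglyMeasurable (by fun_prop))]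
    have h2 := h a
    simp only [Function.comp_apply, Submodule.coe_inner, he]
    rw [h2]
    congr 1
    rw [Submodule.coe_norm, he]
    push_cast
    rfl
  -- The characteristic function is computed up to a constant factor `q` that absorbs the
  -- normalization of `μ`; its value at `0` shows that `q = 1`.
  have h2 : ν.map e = stdGaussian W := by
    obtain ⟨q, hq⟩ : ∃ q : ℂ, ∀ w : W, charFun (ν.map e) w = q * Complex.exp (-‖w‖ ^ 2 / 2) := by
      have hHaar : (μ.map e).IsAddHaarMeasure := inferInstance
      obtain ⟨c, hc⟩ : ∃ c : NNReal, μ.map e = c • (volume : Measure W) :=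
        ⟨_, Measure.isAddLeftInvariant_eq_smul (μ.map e) (volume : Measure W)⟩
      refine ⟨Z.toReal * ((c : ℝ) *
        (Real.pi / (1 / 2 : ℂ)) ^ (Module.finrank ℝ W / 2 : ℂ)), fun w => ?_⟩
      have h3 := GaussianFourier.integral_cexp_neg_mul_sq_norm_add (V := W) (b := 1 / 2)
        (by norm_num) Complex.I w
      have h4 : ∫ v, Complex.exp (-(1 / 2 : ℂ) * ‖v‖ ^ 2 + Complex.I * (inner ℝ w v : ℝ)) ∂(μ.map e)
          = (c : ℝ) * ((Real.pi / (1 / 2 : ℂ)) ^ (Module.finrank ℝ W / 2 : ℂ)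
            * Complex.exp (Complex.I ^ 2 * ‖w‖ ^ 2 / (4 * (1 / 2)))) := by
        rw [hc, integral_smul_nnreal_measure, h3]
        rfl
      rw [charFun_apply, integral_map hem.aemeasurable
        (Measurable.aestronglyMeasurable (by fun_prop)), hν, integral_smul_measure,
        integral_withDensity_eq_integral_toReal_smul
          (by have := hRc.measurable; fun_prop) (Filter.Eventually.of_forall fun _ => by simp),
        Complex.real_smul]
      rw [integral_map hem.aemeasurable (Measurable.aestronglyMeasurable (by fun_prop))] at h4
      have h5 : ∀ a, (ENNReal.ofReal (Real.exp (-‖R a‖ ^ 2 / 2))).toReal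
          • Complex.exp ((inner ℝ (e a) w : ℝ) * Complex.I)
          = Complex.exp (-(1 / 2 : ℂ) * ‖e a‖ ^ 2 + Complex.I * (inner ℝ w (e a) : ℝ)) := by
        intro a
        rw [ENNReal.toReal_ofReal (Real.exp_pos _).le, Complex.real_smul, Complex.ofReal_exp,
          ← Complex.exp_add, real_inner_comm, Submodule.coe_norm, he]
        congr 1
        push_cast
        ring
      simp only [h5]
      rw [h4, mul_assoc, mul_assoc]
      congr 4
      rw [Complex.I_sq]
      ring
    have h3 := hq 0
    rw [charFun_zero] at h3
    simp at h3
    refine Measure.ext_of_charFun (funext fun w => ?_)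
    rw [charFun_stdGaussian, hq, ← h3, one_mul]
  have h3 : ((P.map L).map e).map e.symm = (ν.map e).map e.symm := by rw [h1, h2]
  have hes : Measurable e.symm := e.symm.continuous.measurable
  rw [Measure.map_map hes hem, Measure.map_map hes hem] at h3
  simpa [Function.comp_def] using h3

/-! ### A Gaussian model of the random band matrix -/

/-- Independent standard Gaussian arrays: one per diagonal block and one per block above the
diagonal (the last of these is not used). -/
noncomputable def modelLaw (N M : ℕ) : Measure (Fin N ⊕ Fin N → Fin M × Fin M → ℝ) :=
  Measure.pi fun _ => stdGauss (Fin M × Fin M)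

instance (N M : ℕ) : IsProbabilityMeasure (modelLaw N M) :=
  inferInstanceAs (IsProbabilityMeasure (Measure.pi fun _ => stdGauss (Fin M × Fin M)))

/-- The scale `1 / √(2 M)` for which `diagScale M • (X + Xᵀ)`, with `X` standard Gaussian, has
density proportional to `exp (-(M / 4) tr a²)` on the symmetric matrices. -/
noncomputable def diagScale (M : ℕ) : ℝ := (√(2 * M))⁻¹

/-- The scaled square Gaussian block `M ^ (-1/2) Y`: the density of a block above the diagonal is
proportional to `exp (-(M / 2) tr Yᵀ Y)`, as the block and its transpose both count. -/
noncomputable def offBlock {M : ℕ} (Y : Fin M × Fin M → ℝ) : Matrix (Fin M) (Fin M) ℝ :=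
  (√M)⁻¹ • Matrix.of fun p q => Y (p, q)

/-- The symmetric block tridiagonal matrix built from Gaussian arrays. -/
noncomputable def modelMatrix {N M : ℕ} (ω : Fin N ⊕ Fin N → Fin M × Fin M → ℝ) :
    bandSpace N M where
  val := fun i j => if i = j then symMat (diagScale M) 0 (ω (.inl i))
    else if (j : ℕ) = i + 1 then offBlock (ω (.inr i))
    else if (i : ℕ) = j + 1 then (offBlock (ω (.inr j)))ᵀ else 0
  property := by
    refine ⟨fun i j => ?_, fun i j h => ?_⟩
    · by_cases h : i = j
      · subst h
        simp [symMat_transpose (Matrix.transpose_zero)]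
      · beta_reduce
        rw [if_neg h, if_neg (Ne.symm h)]
        by_cases h1 : (i : ℕ) = j + 1
        · rw [if_pos h1, if_neg (by omega), if_pos h1, Matrix.transpose_transpose]
        · by_cases h2 : (j : ℕ) = i + 1
          · rw [if_neg h1, if_pos h2, if_pos h2]
          · rw [if_neg h1, if_neg h2, if_neg h2, if_neg h1, Matrix.transpose_zero]
    · beta_reduce
      rw [if_neg (by rintro rfl; simp at h), if_neg (by rw [lt_abs] at h; omega),
        if_neg (by rw [lt_abs] at h; omega)]

lemma modelMatrix_diag {N M : ℕ} (ω : Fin N ⊕ Fin N → Fin M × Fin M → ℝ) (i : Fin N) :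
    (modelMatrix ω).1 i i = symMat (diagScale M) 0 (ω (.inl i)) := by
  simp [modelMatrix]

lemma modelMatrix_succ {N M : ℕ} (ω : Fin N ⊕ Fin N → Fin M × Fin M → ℝ) {i j : Fin N}
    (h : (j : ℕ) = i + 1) : (modelMatrix ω).1 i j = offBlock (ω (.inr i)) := by
  have : i ≠ j := by rintro rfl; omega
  simp [modelMatrix, h, this]

lemma measurable_modelMatrix {N M : ℕ} :
    Measurable (modelMatrix : (Fin N ⊕ Fin N → Fin M × Fin M → ℝ) → bandSpace N M) := by
  refine Continuous.measurable (Continuous.subtype_mk ?_ _)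
  refine continuous_pi fun i => continuous_pi fun j => continuous_pi fun p =>
    continuous_pi fun q => ?_
  split_ifs
  · simp only [symMat_apply]
    fun_prop
  · simp only [offBlock, Matrix.smul_apply, Matrix.of_apply]
    fun_prop
  · simp only [offBlock, Matrix.smul_apply, Matrix.of_apply, Matrix.transpose_apply]
    fun_prop
  · exact continuous_const

/-- The coordinates of a symmetric block tridiagonal matrix in which the weight
`exp (-(M / 4) tr a²)` is the standard Gaussian one. -/
noncomputable def bandCoord (N M : ℕ) :
    bandSpace N M →ₗ[ℝ] EuclideanSpace ℝ ((Fin N ⊕ Fin N) × (Fin M × Fin M)) where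
  toFun a := WithLp.toLp 2 fun b => Sum.elim (fun i : Fin N => √(M / 2 : ℝ) * a.1 i i b.2.1 b.2.2)
    (fun i : Fin N =>
      if h : (i : ℕ) + 1 < N then √(M : ℝ) * a.1 i ⟨i + 1, h⟩ b.2.1 b.2.2 else 0) b.1
  map_add' a b := by
    ext ⟨i | i, r⟩
    · simp [mul_add]
    · by_cases h : (i : ℕ) + 1 < N <;> simp [h, mul_add]
  map_smul' t a := by
    ext ⟨i | i, r⟩
    · simp [mul_left_comm]
    · by_cases h : (i : ℕ) + 1 < N <;> simp [h, mul_left_comm]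

lemma bandCoord_inl {N M : ℕ} (a : bandSpace N M) (i : Fin N) (r : Fin M × Fin M) :
    bandCoord N M a (.inl i, r) = √(M / 2 : ℝ) * a.1 i i r.1 r.2 := rfl

lemma bandCoord_inr {N M : ℕ} (a : bandSpace N M) (i : Fin N) (r : Fin M × Fin M) :
    bandCoord N M a (.inr i, r)
      = if h : (i : ℕ) + 1 < N then √(M : ℝ) * a.1 i ⟨i + 1, h⟩ r.1 r.2 else 0 := rfl

/-- The sum over a symmetric tridiagonal array: the diagonal plus twice the superdiagonal. -/
lemma sum_sum_tridiagonal {N : ℕ} (f : Fin N → Fin N → ℝ) (hs : ∀ i j, f i j = f j i)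
    (h0 : ∀ i j : Fin N, 1 < |((i : ℕ) : ℤ) - ((j : ℕ) : ℤ)| → f i j = 0) :
    ∑ i, ∑ j, f i j
      = ∑ i, f i i + 2 * ∑ i : Fin N, if h : (i : ℕ) + 1 < N then f i ⟨i + 1, h⟩ else 0 := by
  have h1 : ∀ i j, f i j = (if i = j then f i j else 0) + (if (j : ℕ) = i + 1 then f i j else 0)
      + (if (i : ℕ) = j + 1 then f j i else 0) := by
    intro i j
    by_cases hij : i = j
    · subst hij; simp
    · have hij' : (i : ℕ) ≠ j := fun h => hij (Fin.ext h)
      by_cases h2 : (j : ℕ) = i + 1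
      · rw [if_neg hij, if_pos h2, if_neg (by omega)]; ring
      · by_cases h3 : (i : ℕ) = j + 1
        · rw [if_neg hij, if_neg h2, if_pos h3, hs i j]; ring
        · rw [if_neg hij, if_neg h2, if_neg h3, h0 i j (by rw [lt_abs]; omega)]; ring
  have h2 : ∀ i : Fin N, ∑ j : Fin N, (if (j : ℕ) = i + 1 then f i j else 0)
      = if h : (i : ℕ) + 1 < N then f i ⟨i + 1, h⟩ else 0 := by
    intro i
    by_cases h : (i : ℕ) + 1 < N
    · rw [dif_pos h, Finset.sum_eq_single ⟨i + 1, h⟩]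
      · simp
      · intro j _ hj
        rw [if_neg fun hj' => hj (Fin.ext hj')]
      · simp
    · rw [dif_neg h]
      exact Finset.sum_eq_zero fun j _ => by rw [if_neg]; have := j.2; omega
  calc ∑ i, ∑ j, f i j = ∑ i, ∑ j, ((if i = j then f i j else 0)
        + (if (j : ℕ) = i + 1 then f i j else 0) + (if (i : ℕ) = j + 1 then f j i else 0)) :=
        Finset.sum_congr rfl fun i _ => Finset.sum_congr rfl fun j _ => h1 i j
    _ = _ := by
      simp only [Finset.sum_add_distrib, Finset.sum_ite_eq, Finset.mem_univ, if_true, h2]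
      rw [Finset.sum_comm (f := fun i j : Fin N => if (i : ℕ) = j + 1 then f j i else 0)]
      simp only [h2]
      ring

lemma norm_bandCoord_sq {N M : ℕ} (a : bandSpace N M) :
    ‖bandCoord N M a‖ ^ 2 = M / 2 * trSq a.1 := by
  have h1 : trSq a.1 = ∑ i, ∑ j, fsq (a.1 i j) := by simp only [trSq, fsq_eq_trace]
  rw [h1, sum_sum_tridiagonal _ (fun i j => by rw [a.2.1 j i, fsq_transpose])
    (fun i j h => by rw [a.2.2 i j h]; simp [fsq]), EuclideanSpace.real_norm_sq_eq,
    Fintype.sum_prod_type, Fintype.sum_sum_type, mul_add, Finset.mul_sum, Finset.mul_sum,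
    Finset.mul_sum]
  congr 1
  · refine Finset.sum_congr rfl fun i _ => ?_
    simp only [bandCoord_inl, mul_pow, Real.sq_sqrt (show (0 : ℝ) ≤ M / 2 by positivity), fsq,
      Fintype.sum_prod_type, Finset.mul_sum]
  · refine Finset.sum_congr rfl fun i _ => ?_
    by_cases h : (i : ℕ) + 1 < N
    · simp only [bandCoord_inr, h, dif_pos, mul_pow, Real.sq_sqrt (show (0 : ℝ) ≤ M by positivity),
        fsq, Fintype.sum_prod_type, Finset.mul_sum]
      refine Finset.sum_congr rfl fun p _ => Finset.sum_congr rfl fun q _ => by ring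
    · simp [bandCoord_inr, h]

/-- In the coordinates `bandCoord`, the model matrix is the orthogonal projection of the Gaussian
vector `ω` to the space of symmetric block tridiagonal matrices. -/
lemma inner_bandCoord_modelMatrix {N M : ℕ} (hM : 0 < M)
    (ω : Fin N ⊕ Fin N → Fin M × Fin M → ℝ) (a : bandSpace N M) :
    inner ℝ (bandCoord N M (modelMatrix ω)) (bandCoord N M a)
      = ∑ b, ∑ r, bandCoord N M a (b, r) * ω b r := by
  have hM' : (0 : ℝ) < M := by exact_mod_cast hM
  have hτ : √(M / 2 : ℝ) * diagScale M * 2 = 1 := by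
    rw [diagScale, show (M : ℝ) / 2 = 2 * M * (1 / 2) ^ 2 by ring, Real.sqrt_mul (by positivity),
      Real.sqrt_sq (by norm_num)]
    have : √(2 * M : ℝ) ≠ 0 := by positivity
    field_simp
  have hτ' : √(M : ℝ) * (√(M : ℝ))⁻¹ = 1 := mul_inv_cancel₀ (by positivity)
  rw [PiLp.inner_apply, Fintype.sum_prod_type, Fintype.sum_sum_type, Fintype.sum_sum_type]
  congr 1
  · refine Finset.sum_congr rfl fun i _ => ?_
    have h1 : ∀ r : Fin M × Fin M, a.1 i i r.1 r.2 = a.1 i i r.2 r.1 := fun r => by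
      conv_lhs => rw [a.2.1 i i]
      rfl
    have h2 : ∑ r : Fin M × Fin M, a.1 i i r.1 r.2 * ω (.inl i) r.swap
        = ∑ r : Fin M × Fin M, a.1 i i r.1 r.2 * ω (.inl i) r := by
      rw [← Equiv.sum_comp (Equiv.prodComm (Fin M) (Fin M))]
      refine Finset.sum_congr rfl fun r _ => ?_
      rw [Equiv.prodComm_apply, Prod.swap_swap, h1 r]
      rfl
    have h3 : ∀ r : Fin M × Fin M, inner ℝ (bandCoord N M (modelMatrix ω) (.inl i, r))
        (bandCoord N M a (.inl i, r)) = √(M / 2 : ℝ) * (√(M / 2 : ℝ) * diagScale M) *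
        (a.1 i i r.1 r.2 * ω (.inl i) r + a.1 i i r.1 r.2 * ω (.inl i) r.swap) := by
      intro r
      rw [bandCoord_inl, bandCoord_inl, modelMatrix_diag, symMat_apply, Real.inner_apply]
      simp only [Matrix.zero_apply, Prod.mk.eta, Prod.swap]
      ring
    rw [Finset.sum_congr rfl fun r _ => h3 r, ← Finset.mul_sum, Finset.sum_add_distrib, h2,
      ← two_mul, Finset.mul_sum, Finset.mul_sum]
    refine Finset.sum_congr rfl fun r _ => ?_
    rw [bandCoord_inl]
    linear_combination (√(M / 2 : ℝ) * a.1 i i r.1 r.2 * ω (.inl i) r) * hτ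
  · refine Finset.sum_congr rfl fun i _ => Finset.sum_congr rfl fun r _ => ?_
    rw [bandCoord_inr, bandCoord_inr]
    by_cases h : (i : ℕ) + 1 < N
    · rw [dif_pos h, dif_pos h, modelMatrix_succ ω (by rfl), Real.inner_apply]
      simp only [offBlock, Matrix.smul_apply, Matrix.of_apply, smul_eq_mul, Prod.mk.eta]
      linear_combination (√(M : ℝ) * a.1 i ⟨i + 1, h⟩ r.1 r.2 * ω (.inr i) r) * hτ'
    · simp [h]

lemma integral_cexp_modelLaw {N M : ℕ} (v : (Fin N ⊕ Fin N) → Fin M × Fin M → ℝ) :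
    ∫ ω, Complex.exp ((∑ b, ∑ r, v b r * ω b r : ℝ) * Complex.I) ∂(modelLaw N M)
      = Complex.exp (-(∑ b, ∑ r, v b r ^ 2 : ℝ) / 2) := by
  have h1 : ∀ ω : Fin N ⊕ Fin N → Fin M × Fin M → ℝ,
      Complex.exp ((∑ b, ∑ r, v b r * ω b r : ℝ) * Complex.I)
        = ∏ b, Complex.exp ((∑ r, v b r * ω b r : ℝ) * Complex.I) := by
    intro ω
    rw [← Complex.exp_sum, Complex.ofReal_sum, Finset.sum_mul]
  simp only [h1]
  rw [modelLaw, integral_fintype_prod_eq_prod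
    (f := fun b (x : Fin M × Fin M → ℝ) =>
    Complex.exp ((∑ r, v b r * x r : ℝ) * Complex.I))]
  simp only [integral_cexp_stdGauss]
  rw [← Complex.exp_sum, Complex.ofReal_sum, ← Finset.sum_neg_distrib, Finset.sum_div]

/-- The random band matrix has the law of the model. In particular its blocks on and above the
diagonal are independent and Gaussian. -/
theorem map_modelMatrix {N M : ℕ} (hM : 0 < M) :
    (modelLaw N M).map modelMatrix = bandLaw N M := by
  have hd : (fun a : bandSpace N M =>
      ENNReal.ofReal (Real.exp (-((M : ℝ) / 4) * trSq (a : BlockMatrix N M))))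
      = fun a => ENNReal.ofReal (Real.exp (-‖bandCoord N M a‖ ^ 2 / 2)) := by
    funext a
    rw [norm_bandCoord_sq]
    congr 2
    ring
  have hb : bandLaw N M = (bandWeight N M Set.univ)⁻¹ • (Measure.addHaar.withDensity
      fun a => ENNReal.ofReal (Real.exp (-‖bandCoord N M a‖ ^ 2 / 2))) := by
    rw [← hd]; rfl
  have hp : IsProbabilityMeasure ((bandWeight N M Set.univ)⁻¹ • (Measure.addHaar.withDensity
      fun a => ENNReal.ofReal (Real.exp (-‖bandCoord N M a‖ ^ 2 / 2)))) := by
    rw [← hb]; infer_instance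
  have hinj : Function.Injective (bandCoord N M) := by
    rw [← LinearMap.ker_eq_bot, LinearMap.ker_eq_bot']
    intro a ha
    have h1 := norm_bandCoord_sq a
    rw [ha, norm_zero] at h1
    have hM' : (0 : ℝ) < M := by exact_mod_cast hM
    have h2 : trSq a.1 = 0 := by
      have : (M : ℝ) / 2 ≠ 0 := by positivity
      rcases mul_eq_zero.1 (by simpa using h1.symm : (M : ℝ) / 2 * trSq a.1 = 0) with h | h
      · exact absurd h this
      · exact h
    have h0 : ∀ i j, 0 ≤ fsq (a.1 i j) := fun i j => fsq_nonneg _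
    have h3 : trSq a.1 = ∑ i, ∑ j, fsq (a.1 i j) := by simp only [trSq, fsq_eq_trace]
    rw [h3, Finset.sum_eq_zero_iff_of_nonneg fun i _ => Finset.sum_nonneg fun j _ => h0 i j] at h2
    refine Subtype.ext ?_
    ext i j p q
    have h4 := (Finset.sum_eq_zero_iff_of_nonneg fun j _ => h0 i j).1 (h2 i (Finset.mem_univ i)) j
      (Finset.mem_univ j)
    have h5 := sq_apply_le_fsq (a.1 i j) p q
    rw [h4] at h5
    exact pow_eq_zero_iff two_ne_zero |>.1 (le_antisymm h5 (sq_nonneg _))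
  rw [hb]
  refine map_eq_smul_withDensity_of_charFun Measure.addHaar (bandCoord N M) hinj
    measurable_modelMatrix fun a => ?_
  simp only [inner_bandCoord_modelMatrix hM]
  rw [integral_cexp_modelLaw fun b r => bandCoord N M a (b, r), EuclideanSpace.real_norm_sq_eq,
    Fintype.sum_prod_type]

/-! ### The derivatives of the logarithmic density -/

lemma frobNorm_sq {M : ℕ} (X : Matrix (Fin M) (Fin M) ℝ) : frobNorm X ^ 2 = fsq X := by
  rw [frobNorm, ← fsq_eq_trace, Real.sq_sqrt (fsq_nonneg X)]

/-- The Frobenius inner product. -/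
def frobInner {m : Type*} [Fintype m] (A B : Matrix m m ℝ) : ℝ := ∑ i, ∑ j, A i j * B i j

lemma fsq_add_smul {m : Type*} [Fintype m] (A B : Matrix m m ℝ) (s : ℝ) :
    fsq (A + s • B) = fsq A + 2 * s * frobInner A B + s ^ 2 * fsq B := by
  simp only [fsq, frobInner, Finset.mul_sum, ← Finset.sum_add_distrib, Matrix.add_apply,
    Matrix.smul_apply, smul_eq_mul]
  refine Finset.sum_congr rfl fun i _ => Finset.sum_congr rfl fun j _ => ?_
  ring

/-- The first two derivatives, at `S s`, of a Laurent polynomial in `t / S` plus a logarithm. This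
is the form of `phi`. -/
lemma deriv_laurent_log {f : ℝ → ℝ} {S α β γ δ κ c : ℝ} (hS : 0 < S)
    (hf : ∀ t, f t = α * (t / S) ^ 2 + β * (t / S) + γ * (t / S)⁻¹ + δ * (t / S)⁻¹ ^ 2 + κ
      - c * Real.log t) {s : ℝ} (hs : 0 < s) :
    S * deriv f (S * s) = 2 * α * s + β - γ * s⁻¹ ^ 2 - 2 * δ * s⁻¹ ^ 3 - c * s⁻¹ ∧
    S ^ 2 * iteratedDeriv 2 f (S * s)
      = 2 * α + 2 * γ * s⁻¹ ^ 3 + 6 * δ * s⁻¹ ^ 4 + c * s⁻¹ ^ 2 := by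
  have h1 : ∀ t : ℝ, 0 < t → HasDerivAt f (2 * α / S ^ 2 * t + β / S - γ * S * t⁻¹ ^ 2
      - 2 * δ * S ^ 2 * t⁻¹ ^ 3 - c * t⁻¹) t := by
    intro t ht
    have hfe : f = fun t => α / S ^ 2 * t ^ 2 + β / S * t + γ * S * t⁻¹ + δ * S ^ 2 * t⁻¹ ^ 2 + κ
        - c * Real.log t := by
      funext t
      rw [hf, inv_div]
      ring
    rw [hfe]
    have hi := hasDerivAt_inv ht.ne'
    refine (((((((hasDerivAt_pow 2 t).const_mul (α / S ^ 2)).add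
      ((hasDerivAt_id t).const_mul (β / S))).add (hi.const_mul (γ * S))).add
      ((hi.pow 2).const_mul (δ * S ^ 2))).add_const κ).sub
      ((Real.hasDerivAt_log ht.ne').const_mul c)).congr_deriv ?_
    simp only [Nat.cast_ofNat, Nat.reduceSub, pow_one]
    field_simp
    ring
  have hSs : 0 < S * s := mul_pos hS hs
  have h2 : HasDerivAt (deriv f) (2 * α / S ^ 2 + 2 * γ * S * (S * s)⁻¹ ^ 3
      + 6 * δ * S ^ 2 * (S * s)⁻¹ ^ 4 + c * (S * s)⁻¹ ^ 2) (S * s) := by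
    have he : deriv f =ᶠ[nhds (S * s)] fun t => 2 * α / S ^ 2 * t + β / S - γ * S * t⁻¹ ^ 2
      - 2 * δ * S ^ 2 * t⁻¹ ^ 3 - c * t⁻¹ := by
      filter_upwards [lt_mem_nhds hSs] with t ht using (h1 t ht).deriv
    refine HasDerivAt.congr_of_eventuallyEq ?_ he
    have hi := hasDerivAt_inv hSs.ne'
    refine (((((((hasDerivAt_id (S * s)).const_mul (2 * α / S ^ 2)).add_const (β / S))).sub
      ((hi.pow 2).const_mul (γ * S))).sub ((hi.pow 3).const_mul (2 * δ * S ^ 2))).sub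
      (hi.const_mul c)).congr_deriv ?_
    simp only [Nat.cast_ofNat, Nat.reduceSub, pow_one]
    field_simp
    ring
  refine ⟨?_, ?_⟩
  · rw [(h1 _ hSs).deriv]
    field_simp
  · rw [iteratedDeriv_succ, iteratedDeriv_one, h2.deriv]
    field_simp

/-! In the following inequalities `d = ‖D_k‖²`, `z = ‖Z_k‖²`, `a = ‖A_{k,k}‖²` and
`a' = ‖A_{k+1,k+1}‖²` are squared Frobenius norms, `x = ⟨D_k, A_{k,k}⟩` and
`y = ⟨Z_k, A_{k+1,k+1}⟩`, and `u` stands for a small power of `M`. -/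

section Inequalities

variable {M u d z a a' x y s : ℝ}

lemma abs_le_of_sq_le_mul {p q : ℝ} (hp : 0 ≤ p) (hq : 0 ≤ q) (h : x ^ 2 ≤ p * q) :
    (-(p + q / 4) ≤ x ∧ x ≤ p + q / 4) ∧ (-(p / 2 + q / 2) ≤ x ∧ x ≤ p / 2 + q / 2) :=
  ⟨abs_le_of_sq_le_sq' (h.trans (by nlinarith [sq_nonneg (p - q / 4)])) (by positivity),
    abs_le_of_sq_le_sq' (h.trans (by nlinarith [sq_nonneg (p - q)])) (by positivity)⟩

/-- The term `d s` dominates for large `s`. -/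
lemma drift_ge (hM : 1 ≤ M) (hu : 4 ≤ u) (hd : M ≤ d * u) (hz : 0 ≤ z)
    (ha : a ≤ M * u) (ha' : a' ≤ M * u) (ha0 : 0 ≤ a) (ha0' : 0 ≤ a') (hx : x ^ 2 ≤ d * a)
    (hy : y ^ 2 ≤ z * a') (hs : u ^ 4 ≤ s) :
    M ^ 2 / u ^ 4 * s ≤ M / 2 * (d * s + (x - d) - (y - z) * s⁻¹ ^ 2 - z * s⁻¹ ^ 3)
      - (M ^ 2 + M - 2) / 2 * s⁻¹ := by
  have hu0 : 0 < u := by linarith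
  have hd0 : 0 < d := pos_of_mul_pos_left (by linarith : 0 < d * u) hu0.le
  have hs4 : 4 ≤ s := (hu.trans (le_self_pow₀ (by linarith) (by norm_num))).trans hs
  have hs0 : 0 < s := by linarith
  have hx' := (abs_le_of_sq_le_mul hd0.le ha0 hx).1.1
  have hy' := (abs_le_of_sq_le_mul hz ha0' hy).2.2
  set t := s⁻¹ with ht
  have ht0 : 0 < t := inv_pos.2 hs0
  have ht4 : t ≤ 1 / 4 := by
    rw [ht, inv_le_comm₀ hs0 (by norm_num)]; linarith
  have ht1 : t ^ 2 ≤ 1 := pow_le_one₀ ht0.le (by linarith)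
  have h1 : -(a' / 2) ≤ -(y - z) * t ^ 2 - z * t ^ 3 := by
    have e1 : (z / 2 - a' / 2) * t ^ 2 ≤ -(y - z) * t ^ 2 :=
      mul_le_mul_of_nonneg_right (by linarith) (sq_nonneg t)
    have e2 : z * t ^ 2 * t ≤ z * t ^ 2 * (1 / 2) :=
      mul_le_mul_of_nonneg_left (by linarith) (by positivity)
    have e3 : a' / 2 * t ^ 2 ≤ a' / 2 * 1 := mul_le_mul_of_nonneg_left ht1 (by positivity)
    linarith
  have h2 : (M ^ 2 + M - 2) / 2 * t ≤ M ^ 2 := by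
    have e1 : (M ^ 2 + M - 2) / 2 ≤ M ^ 2 := by nlinarith
    have e2 : (M ^ 2 + M - 2) / 2 * t ≤ M ^ 2 * 1 :=
      mul_le_mul e1 (by linarith) ht0.le (sq_nonneg M)
    linarith
  have h3 : d * s / 2 - M * u ≤ d * s + (x - d) - (y - z) * t ^ 2 - z * t ^ 3 := by
    have : d * 4 ≤ d * s := mul_le_mul_of_nonneg_left hs4 hd0.le
    linarith
  have h4 : M * s / (2 * u) - M * u ≤ d * s + (x - d) - (y - z) * t ^ 2 - z * t ^ 3 := by
    refine le_trans ?_ h3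
    have : M * s / (2 * u) ≤ d * s / 2 := by
      rw [div_le_div_iff₀ (by positivity) (by norm_num)]
      have := mul_le_mul_of_nonneg_right hd hs0.le
      linarith
    linarith
  have h5 : M ^ 2 / u ^ 4 * s ≤ M / 2 * (M * s / (2 * u) - M * u) - M ^ 2 := by
    have e : M / 2 * (M * s / (2 * u) - M * u) - M ^ 2 - M ^ 2 / u ^ 4 * s
        = M ^ 2 / u ^ 4 * ((u ^ 3 / 4 - 1) * s - (u / 2 + 1) * u ^ 4) := by
      field_simp
      ring
    have e3 : 4 * u ^ 2 ≤ u ^ 3 := by nlinarith [sq_nonneg u]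
    have e4 : (u / 2 + 1) * u ^ 4 ≤ (u ^ 3 / 4 - 1) * s := by
      have e5 : u / 2 + 1 ≤ u ^ 3 / 4 - 1 := by nlinarith
      calc (u / 2 + 1) * u ^ 4 ≤ (u ^ 3 / 4 - 1) * u ^ 4 := by gcongr
        _ ≤ _ := mul_le_mul_of_nonneg_left hs (by linarith)
    have : 0 ≤ M ^ 2 / u ^ 4 * ((u ^ 3 / 4 - 1) * s - (u / 2 + 1) * u ^ 4) :=
      mul_nonneg (by positivity) (by linarith)
    linarith
  have h6 := mul_le_mul_of_nonneg_left h4 (by linarith : 0 ≤ M / 2)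
  linarith

/-- The term `-z s⁻¹ ^ 3` dominates for small `s`. -/
lemma drift_le (hM : 1 ≤ M) (hu : 4 ≤ u) (hz : M ≤ z * u) (hd : 0 ≤ d)
    (ha : a ≤ M * u) (ha' : a' ≤ M * u) (ha0 : 0 ≤ a) (ha0' : 0 ≤ a') (hx : x ^ 2 ≤ d * a)
    (hy : y ^ 2 ≤ z * a') (hs0 : 0 < s) (hs : u ^ 4 ≤ s⁻¹) :
    M / 2 * (d * s + (x - d) - (y - z) * s⁻¹ ^ 2 - z * s⁻¹ ^ 3)
      - (M ^ 2 + M - 2) / 2 * s⁻¹ ≤ -(M ^ 2 / u ^ 4 * s⁻¹ ^ 3) := by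
  have hu0 : 0 < u := by linarith
  have hz0 : 0 < z := pos_of_mul_pos_left (by linarith : 0 < z * u) hu0.le
  set t := s⁻¹ with ht
  have ht4 : 4 ≤ t := (hu.trans (le_self_pow₀ (by linarith) (by norm_num))).trans hs
  have hs4 : s ≤ 1 / 4 := by
    rw [← inv_inv s, ← ht, inv_le_comm₀ (by linarith) (by norm_num)]; linarith
  have hx' := (abs_le_of_sq_le_mul hd ha0 hx).2.2
  have hy' := (abs_le_of_sq_le_mul hz0.le ha0' hy).1.1
  have h1 : d * s + (x - d) ≤ a / 2 := by nlinarith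
  have h2 : -(y - z) * t ^ 2 - z * t ^ 3 ≤ a' / 4 * t ^ 2 - z * t ^ 3 / 2 := by
    have e1 : -(y - z) * t ^ 2 ≤ (2 * z + a' / 4) * t ^ 2 := by nlinarith [sq_nonneg t]
    have e2 : 4 * (z * t ^ 2) ≤ z * t ^ 3 := by
      have : z * t ^ 2 * 4 ≤ z * t ^ 2 * t := mul_le_mul_of_nonneg_left ht4 (by positivity)
      nlinarith
    nlinarith
  have h3 : 0 ≤ (M ^ 2 + M - 2) / 2 * t := by
    have : 0 ≤ M ^ 2 + M - 2 := by nlinarith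
    positivity
  have h4 : a / 2 + a' / 4 * t ^ 2 ≤ M * u * t ^ 2 := by
    have e1 : M * u * 1 ≤ M * u * t ^ 2 :=
      mul_le_mul_of_nonneg_left (one_le_pow₀ (by linarith)) (by positivity)
    have e2 : a' * t ^ 2 ≤ M * u * t ^ 2 := mul_le_mul_of_nonneg_right ha' (sq_nonneg t)
    linarith
  have h5 : M * u * t ^ 2 ≤ M / u ^ 3 * t ^ 3 := by
    have : M * u * t ^ 2 * u ^ 3 ≤ M * t ^ 3 := by
      calc M * u * t ^ 2 * u ^ 3 = M * t ^ 2 * u ^ 4 := by ring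
        _ ≤ M * t ^ 2 * t := by gcongr
        _ = _ := by ring
    rw [div_mul_eq_mul_div, le_div_iff₀ (by positivity)]
    exact this
  have h6 : M / u * t ^ 3 ≤ z * t ^ 3 := by
    have : M / u ≤ z := by rw [div_le_iff₀ hu0]; exact hz
    gcongr
  have h7 : M / 2 * (M / u ^ 3 * t ^ 3 - M / u * t ^ 3 / 2) ≤ -(M ^ 2 / u ^ 4 * t ^ 3) := by
    have e : -(M ^ 2 / u ^ 4 * t ^ 3) - M / 2 * (M / u ^ 3 * t ^ 3 - M / u * t ^ 3 / 2)
        = M ^ 2 / u ^ 4 * t ^ 3 * (u ^ 3 / 4 - u / 2 - 1) := by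
      field_simp
      ring
    have : 0 ≤ M ^ 2 / u ^ 4 * t ^ 3 * (u ^ 3 / 4 - u / 2 - 1) :=
      mul_nonneg (by positivity) (by nlinarith [sq_nonneg u])
    linarith
  have h8 : M / 2 * (d * s + (x - d) - (y - z) * t ^ 2 - z * t ^ 3)
      ≤ M / 2 * (M / u ^ 3 * t ^ 3 - M / u * t ^ 3 / 2) :=
    mul_le_mul_of_nonneg_left (by linarith) (by linarith)
  linarith

lemma abs_second_le (hM : 1 ≤ M) (hu : 4 ≤ u) (hd : d ≤ M ^ 2 * u) (hd0 : 0 ≤ d)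
    (hz : z ≤ M ^ 2 * u) (hz0 : 0 ≤ z) (ha' : a' ≤ M * u) (ha0' : 0 ≤ a')
    (hy : y ^ 2 ≤ z * a') (hs0 : 0 < s) :
    |M / 2 * (d + 2 * (y - z) * s⁻¹ ^ 3 + 3 * z * s⁻¹ ^ 4) + (M ^ 2 + M - 2) / 2 * s⁻¹ ^ 2|
      ≤ M ^ 3 * u ^ 4 * (1 + s⁻¹ ^ 4) := by
  set t := s⁻¹ with ht
  have ht0 : 0 < t := inv_pos.2 hs0
  have hu0 : 0 < u := by linarith
  obtain ⟨hy2, hy1⟩ := (abs_le_of_sq_le_mul hz0 ha0' hy).2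
  have h2 : t ^ 2 ≤ 1 + t ^ 4 := by nlinarith [sq_nonneg (t ^ 2 - 1), sq_nonneg t]
  have h3 : t ^ 3 ≤ 1 + t ^ 4 := by
    rcases le_or_gt t 1 with h | h
    · have : t ^ 3 ≤ 1 := pow_le_one₀ ht0.le h
      nlinarith [pow_pos ht0 4]
    · have : t ^ 3 ≤ t ^ 4 := pow_le_pow_right₀ h.le (by norm_num)
      linarith
  set q := 1 + t ^ 4 with hq
  have hq1 : 1 ≤ q := by have := pow_pos ht0 4; linarith
  have hq4 : t ^ 4 ≤ q := by linarith
  have hw : |2 * (y - z) * t ^ 3| ≤ (3 * z + a') * q := by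
    rw [abs_mul, abs_of_pos (pow_pos ht0 3)]
    refine mul_le_mul ?_ h3 (by positivity) (by positivity)
    rw [abs_le]
    constructor <;> linarith
  have hc : 0 ≤ (M ^ 2 + M - 2) / 2 := by nlinarith
  have hc' : (M ^ 2 + M - 2) / 2 ≤ M ^ 2 := by nlinarith
  have hin : |d + 2 * (y - z) * t ^ 3 + 3 * z * t ^ 4| ≤ (d + 6 * z + a') * q := by
    refine (abs_add_three _ _ _).trans ?_
    rw [abs_of_nonneg hd0, abs_of_nonneg (a := 3 * z * t ^ 4) (by positivity)]
    have e1 : d ≤ d * q := le_mul_of_one_le_right hd0 hq1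
    have e2 : 3 * z * t ^ 4 ≤ 3 * z * q := by gcongr
    nlinarith
  refine (abs_add_le _ _).trans ?_
  rw [abs_mul, abs_of_nonneg (a := M / 2) (by linarith),
    abs_of_nonneg (a := (M ^ 2 + M - 2) / 2 * t ^ 2) (by positivity)]
  have h4 : M / 2 * |d + 2 * (y - z) * t ^ 3 + 3 * z * t ^ 4|
      ≤ M / 2 * ((d + 6 * z + a') * q) := by gcongr
  have h5 : (M ^ 2 + M - 2) / 2 * t ^ 2 ≤ M ^ 2 * q := by gcongr
  have hMM : M ≤ M ^ 2 := by nlinarith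
  have h6 : d + 6 * z + a' ≤ 8 * M ^ 2 * u := by nlinarith
  have h7 : M / 2 * ((d + 6 * z + a') * q) ≤ M / 2 * ((8 * M ^ 2 * u) * q) := by gcongr
  have hu4 : 5 * u ≤ u ^ 4 := by nlinarith [sq_nonneg (u ^ 2 - 16), sq_nonneg (u - 4)]
  have h8 : M ^ 2 * q ≤ M ^ 3 * u * q := by
    have : M ^ 2 ≤ M ^ 3 * u := by nlinarith [sq_nonneg M]
    gcongr
  have h9 : M ^ 3 * (5 * u) * q ≤ M ^ 3 * u ^ 4 * q := by gcongr
  nlinarith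

end Inequalities

lemma frobInner_sq_le {m : Type*} [Fintype m] (A B : Matrix m m ℝ) :
    frobInner A B ^ 2 ≤ fsq A * fsq B := by
  unfold frobInner fsq
  simp only [← Fintype.sum_prod_type']
  exact Finset.sum_mul_sq_le_sq_mul_sq _ _ _

lemma frobInner_add_right {m : Type*} [Fintype m] (A B C : Matrix m m ℝ) :
    frobInner A (B + C) = frobInner A B + frobInner A C := by
  simp only [frobInner, Matrix.add_apply, mul_add, Finset.sum_add_distrib]

lemma frobInner_self {m : Type*} [Fintype m] (A : Matrix m m ℝ) : frobInner A A = fsq A := by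
  simp only [frobInner, fsq, sq]

lemma frobInner_comm {m : Type*} [Fintype m] (A B : Matrix m m ℝ) :
    frobInner A B = frobInner B A := by
  simp only [frobInner, mul_comm]

/-- `Z_k = B_k* D_k⁻¹ B_k`, the correction to the next diagonal block. -/
noncomputable def schurTerm {N M : ℕ} (a : BlockMatrix N M) (lam : ℝ) (k : ℕ) :
    Matrix (Fin M) (Fin M) ℝ := (B a k)ᵀ * (D a lam k)⁻¹ * B a k

lemma D_succ {N M : ℕ} (a : BlockMatrix N M) (lam : ℝ) {k : ℕ} (hk : 1 ≤ k) :
    D a lam (k + 1) = block a (k + 1) (k + 1) - lam • (1 : Matrix (Fin M) (Fin M) ℝ)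
      - schurTerm a lam k := by
  obtain ⟨j, rfl⟩ := Nat.exists_eq_add_of_le' hk
  rfl

lemma S_pos {N M : ℕ} {a : BlockMatrix N M} {lam : ℝ} {k : ℕ} (h : 0 < fsq (D a lam k)) :
    0 < S a lam k := by
  refine norm_pos_iff.2 fun h0 => ?_
  rw [map_eq_zero_iff _ (EquivLike.injective _)] at h0
  rw [h0] at h
  simp [fsq] at h

/-- The three bounds for the derivatives of `phi`, with `u ^ 4` in the place of `M ^ ε`, for every
matrix for which `D_k`, `Z_k` and the two adjacent diagonal blocks have Frobenius norms of the right
order. -/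
theorem phi_bounds {N M : ℕ} {a : BlockMatrix N M} {lam u : ℝ} {k : ℕ} (hk : 1 < k) (hM : 1 ≤ M)
    (hu : 4 ≤ u) (hd : M ≤ fsq (D a lam k) * u) (hd' : fsq (D a lam k) ≤ (M : ℝ) ^ 2 * u)
    (hz : M ≤ fsq (schurTerm a lam k) * u) (hz' : fsq (schurTerm a lam k) ≤ (M : ℝ) ^ 2 * u)
    (ha : fsq (block a k k) ≤ M * u) (ha' : fsq (block a (k + 1) (k + 1)) ≤ M * u) :
    (∀ s, u ^ 4 ≤ s → (M : ℝ) ^ 2 / u ^ 4 * s ≤ S a lam k * deriv (phi a lam k) (S a lam k * s)) ∧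
    (∀ s, 0 < s → u ^ 4 ≤ s⁻¹ →
      S a lam k * deriv (phi a lam k) (S a lam k * s) ≤ -((M : ℝ) ^ 2 / u ^ 4 * s⁻¹ ^ 3)) ∧
    (∀ s, 0 < s → |S a lam k ^ 2 * iteratedDeriv 2 (phi a lam k) (S a lam k * s)|
      ≤ (M : ℝ) ^ 3 * u ^ 4 * (1 + s⁻¹ ^ 4)) := by
  have hM1 : (1 : ℝ) ≤ M := by exact_mod_cast hM
  set d := fsq (D a lam k) with hdd
  set z := fsq (schurTerm a lam k) with hzz
  have hd0 : 0 < d := by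
    by_contra h
    push Not at h
    nlinarith
  have hz0 : 0 < z := by
    by_contra h
    push Not at h
    nlinarith
  have hS : 0 < S a lam k := S_pos hd0
  set X := lam • (1 : Matrix (Fin M) (Fin M) ℝ) + schurTerm a lam (k - 1) with hX
  set W := D a lam (k + 1) + lam • (1 : Matrix (Fin M) (Fin M) ℝ) with hW
  have hA : X + D a lam k = block a k k := by
    obtain ⟨j, rfl⟩ := Nat.exists_eq_add_of_le' hk
    rw [hX, show j + (1 + 1) = j + 1 + 1 by rfl, D_succ a lam (by omega)]
    simp only [Nat.add_sub_cancel]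
    abel
  have hA' : W + schurTerm a lam k = block a (k + 1) (k + 1) := by
    rw [hW, D_succ a lam (by omega)]
    abel
  -- The matrices `X` and `W` in the definition of `phi` satisfy `X + D_k = A_{k,k}` and
  -- `W + Z_k = A_{k+1,k+1}`, which turns the coefficients into `x - d` and `y - z`.
  have hphi : ∀ t, phi a lam k t = (M / 4 * d) * (t / S a lam k) ^ 2
      + (M / 2 * frobInner X (D a lam k)) * (t / S a lam k)
      + (M / 2 * frobInner W (schurTerm a lam k)) * (t / S a lam k)⁻¹
      + (M / 4 * z) * (t / S a lam k)⁻¹ ^ 2 + (M / 4 * fsq X + M / 4 * fsq W)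
      - ((M : ℝ) ^ 2 + M - 2) / 2 * Real.log t := by
    intro t
    unfold phi
    rw [frobNorm_sq, frobNorm_sq]
    change (M : ℝ) / 4 * fsq ((t / S a lam k) • D a lam k + lam • (1 : Matrix (Fin M) (Fin M) ℝ)
      + schurTerm a lam (k - 1)) + (M : ℝ) / 4 * fsq (W + (t / S a lam k)⁻¹ • schurTerm a lam k)
      - _ = _
    rw [add_assoc, add_comm ((t / S a lam k) • D a lam k), ← hX, fsq_add_smul, fsq_add_smul]
    ring
  have hx : frobInner X (D a lam k) = frobInner (D a lam k) (block a k k) - d := by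
    rw [← hA, frobInner_add_right, frobInner_self, frobInner_comm]
    ring
  have hy : frobInner W (schurTerm a lam k)
      = frobInner (schurTerm a lam k) (block a (k + 1) (k + 1)) - z := by
    rw [← hA', frobInner_add_right, frobInner_self, frobInner_comm]
    ring
  have hx2 := frobInner_sq_le (D a lam k) (block a k k)
  have hy2 := frobInner_sq_le (schurTerm a lam k) (block a (k + 1) (k + 1))
  refine ⟨fun s hs => ?_, fun s hs0 hs => ?_, fun s hs0 => ?_⟩
  · have hs0 : 0 < s := lt_of_lt_of_le (by positivity) hs
    rw [(deriv_laurent_log hS hphi hs0).1, hx, hy]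
    refine (drift_ge hM1 hu hd hz0.le ha ha' (fsq_nonneg _) (fsq_nonneg _) hx2 hy2 hs).trans_eq ?_
    ring
  · rw [(deriv_laurent_log hS hphi hs0).1, hx, hy]
    refine le_of_eq_of_le ?_
      (drift_le hM1 hu hz hd0.le ha ha' (fsq_nonneg _) (fsq_nonneg _) hx2 hy2 hs0 hs)
    ring
  · rw [(deriv_laurent_log hS hphi hs0).2, hy]
    refine le_of_eq_of_le ?_
      (abs_second_le hM1 hu hd' hd0.le hz' hz0.le ha' (fsq_nonneg _) hy2 hs0)
    congr 1
    ring

/-! ### The block elimination on the Gaussian model -/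

section

variable {N M : ℕ}

lemma block_eq {a : BlockMatrix N M} {i j : ℕ} (hi : i < N) (hj : j < N) :
    block a (i + 1) (j + 1) = a ⟨i, hi⟩ ⟨j, hj⟩ := by
  unfold block
  rw [dif_pos ⟨⟨by omega, by omega⟩, by omega, by omega⟩]
  rfl

lemma block_modelMatrix (ω : Fin N ⊕ Fin N → Fin M × Fin M → ℝ) {j : ℕ} (hj : j < N) :
    block (modelMatrix ω).1 (j + 1) (j + 1) = symMat (diagScale M) 0 (ω (.inl ⟨j, hj⟩)) := by
  rw [block_eq hj hj, modelMatrix_diag]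

lemma B_modelMatrix (ω : Fin N ⊕ Fin N → Fin M × Fin M → ℝ) {j : ℕ} (hj : j + 1 < N) :
    B (modelMatrix ω).1 (j + 1) = -offBlock (ω (.inr ⟨j, by omega⟩)) := by
  rw [B, block_eq (by omega) hj, modelMatrix_succ ω rfl]

/-- `D_k` depends only on the first `k` diagonal blocks and the blocks `B_1, …, B_{k-1}`. -/
lemma D_congr {a a' : BlockMatrix N M} {lam : ℝ} {k : ℕ}
    (h : ∀ i < k, block a (i + 1) (i + 1) = block a' (i + 1) (i + 1))
    (h' : ∀ i, i + 1 < k → B a (i + 1) = B a' (i + 1)) : D a lam k = D a' lam k := by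
  induction k with
  | zero => rfl
  | succ k ih =>
    rcases Nat.eq_zero_or_pos k with rfl | hk
    · simp only [D, h 0 zero_lt_one]
    · obtain ⟨j, rfl⟩ := Nat.exists_eq_add_of_le' hk
      rw [D_succ a lam hk, D_succ a' lam hk, schurTerm, schurTerm, h _ (Nat.lt_succ_self _),
        h' j (by omega), ih (fun i hi => h i (by omega)) fun i hi => h' i (by omega)]

lemma D_transpose (a : bandSpace N M) (lam : ℝ) (k : ℕ) : (D a.1 lam k)ᵀ = D a.1 lam k := by
  have hb : ∀ i, (block a.1 i i)ᵀ = block a.1 i i := by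
    intro i
    unfold block
    split_ifs
    · exact (a.2.1 _ _).symm
    · exact Matrix.transpose_zero
  induction k with
  | zero => exact Matrix.transpose_zero
  | succ k ih =>
    rcases Nat.eq_zero_or_pos k with rfl | hk
    · simp only [D, Matrix.transpose_sub, hb, Matrix.transpose_smul, Matrix.transpose_one]
    · rw [D_succ _ _ hk, schurTerm]
      simp only [Matrix.transpose_sub, hb, Matrix.transpose_smul, Matrix.transpose_one,
        Matrix.transpose_mul, Matrix.transpose_transpose, Matrix.transpose_nonsing_inv, ih,
        Matrix.mul_assoc]

lemma D_update_inr (ω : Fin N ⊕ Fin N → Fin M × Fin M → ℝ) (lam : ℝ) {j k : ℕ} (hj : j < N)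
    (hk : k ≤ j + 1) (hkN : k ≤ N) (Y : Fin M × Fin M → ℝ) :
    D (modelMatrix (Function.update ω (.inr ⟨j, hj⟩) Y)).1 lam k = D (modelMatrix ω).1 lam k := by
  refine D_congr (fun i hi => ?_) fun i hi => ?_
  · rw [block_modelMatrix _ (by omega), block_modelMatrix _ (by omega),
      Function.update_of_ne (by simp)]
  · rw [B_modelMatrix _ (by omega), B_modelMatrix _ (by omega), Function.update_of_ne]
    simp only [ne_eq, Sum.inr.injEq, Fin.mk.injEq]
    omega

lemma D_update_inl (ω : Fin N ⊕ Fin N → Fin M × Fin M → ℝ) (lam : ℝ) {j k : ℕ} (hj : j < N)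
    (hk : k ≤ j) (X : Fin M × Fin M → ℝ) :
    D (modelMatrix (Function.update ω (.inl ⟨j, hj⟩) X)).1 lam k = D (modelMatrix ω).1 lam k := by
  refine D_congr (fun i hi => ?_) fun i hi => ?_
  · rw [block_modelMatrix _ (by omega), block_modelMatrix _ (by omega), Function.update_of_ne]
    simp only [ne_eq, Sum.inl.injEq, Fin.mk.injEq]
    omega
  · rw [B_modelMatrix _ (by omega), B_modelMatrix _ (by omega), Function.update_of_ne (by simp)]

/-- Given the other blocks, `D_{j+1}` is the diagonal block number `j + 1` shifted by a fixed
symmetric matrix. -/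
lemma exists_D_update_eq_symMat (ω : Fin N ⊕ Fin N → Fin M × Fin M → ℝ) (lam : ℝ) {j : ℕ}
    (hj : j < N) : ∃ F : Matrix (Fin M) (Fin M) ℝ, Fᵀ = F ∧ ∀ X,
      D (modelMatrix (Function.update ω (.inl ⟨j, hj⟩) X)).1 lam (j + 1)
        = symMat (diagScale M) F X := by
  have key : ∀ (F : Matrix (Fin M) (Fin M) ℝ) X,
      symMat (diagScale M) F X = symMat (diagScale M) 0 X + F := by
    intro F X
    ext p q
    simp [symMat_apply]
  rcases Nat.eq_zero_or_pos j with rfl | hj0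
  · refine ⟨-(lam • 1), by simp, fun X => ?_⟩
    rw [key, D, block_modelMatrix _ hj, Function.update_self, sub_eq_add_neg]
  · refine ⟨-(lam • 1) - schurTerm (modelMatrix ω).1 lam j, ?_, fun X => ?_⟩
    · simp only [schurTerm, Matrix.transpose_sub, Matrix.transpose_neg, Matrix.transpose_smul,
        Matrix.transpose_one, Matrix.transpose_mul, Matrix.transpose_transpose,
        Matrix.transpose_nonsing_inv, D_transpose, Matrix.mul_assoc]
    · obtain ⟨i, rfl⟩ := Nat.exists_eq_add_of_le' hj0
      rw [key, D_succ _ _ hj0, block_modelMatrix _ hj, Function.update_self, schurTerm, schurTerm,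
        D_update_inl ω lam hj le_rfl, B_modelMatrix _ hj, B_modelMatrix _ hj,
        Function.update_of_ne (by simp)]
      abel

/-- Resampling `B_{j+1}` leaves `D_{j+1}` unchanged. -/
lemma schurTerm_update (ω : Fin N ⊕ Fin N → Fin M × Fin M → ℝ) (lam : ℝ) {j : ℕ} (hj : j + 1 < N)
    (Y : Fin M × Fin M → ℝ) :
    schurTerm (modelMatrix (Function.update ω (.inr ⟨j, by omega⟩) Y)).1 lam (j + 1)
      = (-offBlock Y)ᵀ * (D (modelMatrix ω).1 lam (j + 1))⁻¹ * -offBlock Y := by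
  rw [schurTerm, D_update_inr ω lam _ le_rfl (by omega), B_modelMatrix _ hj, Function.update_self]

lemma offBlock_congr (T : Matrix (Fin M) (Fin M) ℝ) (Y : Fin M × Fin M → ℝ) :
    (-offBlock Y)ᵀ * T * -offBlock Y = (M : ℝ)⁻¹ • ((Matrix.of fun p q => Y (p, q))ᵀ * T
      * Matrix.of fun p q => Y (p, q)) := by
  have : (√(M : ℝ))⁻¹ * (√(M : ℝ))⁻¹ = (M : ℝ)⁻¹ := by
    rw [← mul_inv, Real.mul_self_sqrt (by positivity)]
  simp only [offBlock, Matrix.transpose_neg, Matrix.transpose_smul, Matrix.neg_mul, Matrix.mul_neg,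
    smul_neg, neg_neg, Matrix.smul_mul, Matrix.mul_smul, smul_smul, this]

lemma diagScale_sq (hM : 0 < M) : diagScale M ^ 2 = 1 / (2 * M) := by
  rw [diagScale, inv_pow, Real.sq_sqrt (by positivity), one_div]

lemma diagScale_pos (hM : 0 < M) : 0 < diagScale M := by
  have : (0 : ℝ) < M := by exact_mod_cast hM
  unfold diagScale
  positivity

/-! ### Measurability of the block elimination -/

lemma measurable_entry (i j : Fin N) (p q : Fin M) :
    Measurable fun a : bandSpace N M => a.1 i j p q := by
  have h : Continuous fun a : bandSpace N M => (a.1 i j : Matrix (Fin M) (Fin M) ℝ) :=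
    continuous_subtype_val.matrix_elem i j
  exact (h.matrix_elem p q).measurable

lemma measurable_block (i j : ℕ) (p q : Fin M) :
    Measurable fun a : bandSpace N M => block a.1 i j p q := by
  unfold block
  split_ifs
  · exact measurable_entry _ _ p q
  · exact measurable_const

lemma measurable_congr_inv {Ω : Type*} [MeasurableSpace Ω] {C K : Ω → Matrix (Fin M) (Fin M) ℝ}
    (hC : ∀ p q, Measurable fun x => C x p q) (hK : ∀ p q, Measurable fun x => K x p q)
    (p q : Fin M) : Measurable fun x => ((C x)ᵀ * (K x)⁻¹ * C x) p q :=
  measurable_mul_of_entries (measurable_mul_of_entries (fun p q => hC q p)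
    (measurable_inv_of_entries hK)) hC p q

lemma measurable_B (k : ℕ) (p q : Fin M) : Measurable fun a : bandSpace N M => B a.1 k p q :=
  (measurable_block k (k + 1) p q).neg

lemma measurable_D (lam : ℝ) (k : ℕ) (p q : Fin M) :
    Measurable fun a : bandSpace N M => D a.1 lam k p q := by
  induction k generalizing p q with
  | zero => exact measurable_const
  | succ k ih =>
    rcases Nat.eq_zero_or_pos k with rfl | hk
    · exact (measurable_block 1 1 p q).sub measurable_const
    · simp only [D_succ _ _ hk]
      exact ((measurable_block _ _ p q).sub measurable_const).sub
        (measurable_congr_inv (measurable_B k) ih p q)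

lemma measurable_schurTerm (lam : ℝ) (k : ℕ) (p q : Fin M) :
    Measurable fun a : bandSpace N M => schurTerm a.1 lam k p q :=
  measurable_congr_inv (measurable_B k) (measurable_D lam k) p q

lemma measurable_fsq_of_entries {Ω : Type*} [MeasurableSpace Ω] {C : Ω → Matrix (Fin M) (Fin M) ℝ}
    (hC : ∀ p q, Measurable fun x => C x p q) : Measurable fun x => fsq (C x) :=
  Finset.measurable_sum _ fun p _ => Finset.measurable_sum _ fun q _ => (hC p q).pow_const 2

/-- Bounding the probability of an event by resampling one of the Gaussian arrays. -/
lemma modelLaw_real_le (b : Fin N ⊕ Fin N) {E S : Set (Fin N ⊕ Fin N → Fin M × Fin M → ℝ)}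
    (hE : MeasurableSet E) {p q : ℝ} (hp : 0 ≤ p) (hS : (modelLaw N M).real S ≤ q)
    (h : ∀ ω ∉ S, (stdGauss (Fin M × Fin M)).real {x | Function.update ω b x ∈ E} ≤ p) :
    (modelLaw N M).real E ≤ p + q := by
  refine measureReal_le_of_sections_off (μ₁ := modelLaw N M) (μ₂ := stdGauss (Fin M × Fin M))
    (T := fun z => Function.update z.1 b z.2) ?_ (map_pi_update _ b) hE hp hS h
  refine measurable_pi_lambda _ fun i => ?_
  by_cases hi : i = b
  · subst hi
    simpa using measurable_snd
  · simp only [Function.update_of_ne hi]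
    fun_prop

end

/-! ### Bounds that hold with high probability -/

section

variable {N M : ℕ}

lemma modelLaw_block_large (hM : 0 < M) {j : ℕ} (hj : j < N) {θ : ℝ} (hθ : 0 < θ) :
    (modelLaw N M).real {ω | 2 * M / θ < fsq (block (modelMatrix ω).1 (j + 1) (j + 1))} ≤ θ := by
  have : Nonempty (Fin M) := ⟨⟨0, hM⟩⟩
  have hM' : (0 : ℝ) < M := by exact_mod_cast hM
  have key := modelLaw_real_le (.inl ⟨j, hj⟩) (p := θ) (q := 0) (S := (∅ : Set _))
    (E := {ω : Fin N ⊕ Fin N → Fin M × Fin M → ℝ |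
      2 * M / θ < fsq (block (modelMatrix ω).1 (j + 1) (j + 1))})
    (measurableSet_lt measurable_const ((measurable_fsq_of_entries
      (measurable_block _ _)).comp measurable_modelMatrix)) hθ.le (by simp) fun ω _ => by
        simp only [Set.mem_ofPred_eq, block_modelMatrix _ hj, Function.update_self]
        have h1 := stdGauss_fsq_symMat_large (m := Fin M) (diagScale_pos hM) hθ
        rwa [diagScale_sq hM, Fintype.card_fin,
          show 4 * (1 / (2 * (M : ℝ))) * M ^ 2 / θ = 2 * M / θ by field_simp; ring] at h1
  simpa using key

lemma modelLaw_det_eq_zero (hM : 0 < M) (lam : ℝ) {j : ℕ} (hj : j < N) :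
    (modelLaw N M).real {ω | (D (modelMatrix ω).1 lam (j + 1)).det = 0} ≤ 0 := by
  have : Nonempty (Fin M) := ⟨⟨0, hM⟩⟩
  have key := modelLaw_real_le (.inl ⟨j, hj⟩) (p := 0) (q := 0) (S := (∅ : Set _))
    (E := {ω : Fin N ⊕ Fin N → Fin M × Fin M → ℝ | (D (modelMatrix ω).1 lam (j + 1)).det = 0})
    (measurableSet_eq_fun ((measurable_det_of_entries (measurable_D lam _)).comp
      measurable_modelMatrix) measurable_const) le_rfl (by simp) fun ω _ => by
        obtain ⟨F, -, hF⟩ := exists_D_update_eq_symMat ω lam hj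
        simp only [Set.mem_ofPred_eq, hF]
        exact (stdGauss_det_symMat_eq_zero (diagScale_pos hM) F).le
  simpa using key

lemma modelLaw_fsq_D_small (hM : 0 < M) (lam : ℝ) {j : ℕ} (hj : j < N) {θ : ℝ} (hθ : 0 < θ) :
    (modelLaw N M).real {ω | fsq (D (modelMatrix ω).1 lam (j + 1)) < θ ^ 2 * M / 2} ≤ 2 * θ := by
  have hM' : (0 : ℝ) < M := by exact_mod_cast hM
  have key := modelLaw_real_le (.inl ⟨j, hj⟩) (p := 2 * θ) (q := 0) (S := (∅ : Set _))
    (E := {ω : Fin N ⊕ Fin N → Fin M × Fin M → ℝ |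
      fsq (D (modelMatrix ω).1 lam (j + 1)) < θ ^ 2 * M / 2})
    (measurableSet_lt ((measurable_fsq_of_entries (measurable_D lam _)).comp
      measurable_modelMatrix) measurable_const) (by positivity) (by simp) fun ω _ => by
        obtain ⟨F, -, hF⟩ := exists_D_update_eq_symMat ω lam hj
        simp only [Set.mem_ofPred_eq, hF]
        have h1 := stdGauss_fsq_symMat_small (diagScale M) F hθ.le
        rwa [diagScale_sq hM, Fintype.card_fin,
          show θ ^ 2 * (1 / (2 * (M : ℝ))) * M ^ 2 = θ ^ 2 * M / 2 by field_simp] at h1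
  simpa using key

lemma modelLaw_fsq_inv_D_large (hM : 0 < M) (lam : ℝ) {j : ℕ} (hj : j < N) {θ : ℝ} (hθ : 0 < θ)
    (hθ1 : θ ≤ 1) :
    (modelLaw N M).real {ω | 256 * M ^ 2 / θ ^ 11 < fsq (D (modelMatrix ω).1 lam (j + 1))⁻¹}
      ≤ 68 * θ := by
  have hM' : (0 : ℝ) < M := by exact_mod_cast hM
  have key := modelLaw_real_le (.inl ⟨j, hj⟩) (p := 68 * θ) (q := 0) (S := (∅ : Set _))
    (E := {ω : Fin N ⊕ Fin N → Fin M × Fin M → ℝ |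
      256 * M ^ 2 / θ ^ 11 < fsq (D (modelMatrix ω).1 lam (j + 1))⁻¹})
    (measurableSet_lt measurable_const ((measurable_fsq_of_entries
      (measurable_inv_of_entries (measurable_D lam _))).comp measurable_modelMatrix))
    (by positivity) (by simp) fun ω _ => by
        obtain ⟨F, hFs, hF⟩ := exists_D_update_eq_symMat ω lam hj
        simp only [Set.mem_ofPred_eq, hF]
        have hτ := diagScale_sq hM
        have hτ0 := diagScale_pos hM
        generalize diagScale M = τ at hτ hτ0
        obtain ⟨n, rfl⟩ := Nat.exists_eq_add_of_le' hM
        refine (measureReal_mono fun X hX => ?_).trans (stdGauss_fsq_inv_large hFs hτ0 hθ hθ1)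
        simp only [Set.mem_ofPred_eq, hτ] at hX ⊢
        rw [div_lt_iff₀ (by positivity)] at hX
        push_cast at hX ⊢
        have h2 : (0 : ℝ) < 1 / (2 * (n + 1)) := by positivity
        have h3 := mul_lt_mul_of_pos_left hX h2
        refine lt_of_eq_of_lt ?_ (h3.trans_eq ?_)
        · field_simp
          ring
        · ring
  simpa using key

lemma gaussFour_add_one_pos : 0 < 1 + gaussFour := by
  have := gaussFour_nonneg
  linarith

lemma modelLaw_schurTerm_large (hM : 0 < M) (lam : ℝ) {j : ℕ} (hj : j + 1 < N) {θ : ℝ}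
    (hθ : 0 < θ) (hθ1 : θ ≤ 1) :
    (modelLaw N M).real {ω | (1 + gaussFour) * (256 * M ^ 2 / θ ^ 12)
      < fsq (schurTerm (modelMatrix ω).1 lam (j + 1))} ≤ 69 * θ := by
  have hM' : (0 : ℝ) < M := by exact_mod_cast hM
  have hg := gaussFour_add_one_pos
  have key := modelLaw_real_le (.inr ⟨j, by omega⟩) (p := θ)
    (E := {ω : Fin N ⊕ Fin N → Fin M × Fin M → ℝ | (1 + gaussFour) * (256 * M ^ 2 / θ ^ 12)
      < fsq (schurTerm (modelMatrix ω).1 lam (j + 1))})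
    (measurableSet_lt measurable_const ((measurable_fsq_of_entries
      (measurable_schurTerm lam _)).comp measurable_modelMatrix)) hθ.le
    (modelLaw_fsq_inv_D_large hM lam (by omega : j < N) hθ hθ1) fun ω hω => by
        simp only [Set.mem_ofPred_eq, not_lt] at hω
        simp only [Set.mem_ofPred_eq, schurTerm_update ω lam hj, offBlock_congr, fsq_smul]
        refine (measureReal_mono fun Y hY => ?_).trans
          (stdGauss_fsq_congr_large _ hθ (by positivity) hω)
        simp only [Set.mem_ofPred_eq, Fintype.card_fin] at hY ⊢
        have h3 := mul_lt_mul_of_pos_left hY (by positivity : (0 : ℝ) < M ^ 2)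
        refine lt_of_eq_of_lt ?_ (h3.trans_eq ?_)
        · field_simp
        · field_simp
  linarith

/-- The inverse of `D_k` is not small, because `D_k` agrees, on a subspace of dimension
proportional to `M`, with a matrix in which `D_{k-1}⁻¹` is replaced by a small partial inverse. The
block `B_{k-1}` is resampled given `D_{k-1}` and the next diagonal block. -/
lemma modelLaw_fsq_inv_D_small (hM : 8 ≤ M) {lam Q : ℝ} (hQ : 3 + lam ^ 2 + gaussFour ≤ Q) {j : ℕ}
    (hj : j + 1 < N) {θ : ℝ} (hθ : 0 < θ) (hθ1 : θ ≤ 1) :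
    (modelLaw N M).real {ω | fsq (D (modelMatrix ω).1 lam (j + 2))⁻¹ < θ ^ 3 * M / (768 * Q)}
      ≤ 6 * θ := by
  have hM0 : 0 < M := by omega
  have hM' : (0 : ℝ) < M := by exact_mod_cast hM0
  have hg := gaussFour_add_one_pos
  have hQ0 : 0 < Q := by have := sq_nonneg lam; linarith
  -- The first quarter of the columns, restricted to the other rows; `d` is the excess of rows.
  set P : Finset (Fin M) := Finset.univ.filter fun p => (p : ℕ) < M / 4 with hP
  have hPc : P.card = M / 4 := by
    rw [hP, Fin.card_filter_val_lt]
    omega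
  have hJc : Pᶜ.card = M - M / 4 := by rw [Finset.card_compl, Fintype.card_fin, hPc]
  set d := M - 2 * (M / 4) with hd
  have hdM : (M : ℝ) ≤ 2 * d := by
    have : M ≤ 2 * d := by omega
    exact_mod_cast this
  have hd0 : (0 : ℝ) < d := by linarith
  obtain ⟨G, hG, hGp, hGT⟩ := stdGauss_partial_inverse (m := Fin M) (diagScale_pos hM0)
    (disjoint_compl_right (a := P)) (d := d) (by omega) (by omega) hθ
  rw [hPc] at hGT
  have hPM : ((M / 4 : ℕ) : ℝ) ≤ M / 4 := Nat.cast_div_le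
  have hPM' : (M : ℝ) / 8 ≤ ((M / 4 : ℕ) : ℝ) := by
    have : M ≤ 8 * (M / 4) := by omega
    have : (M : ℝ) ≤ 8 * ((M / 4 : ℕ) : ℝ) := by exact_mod_cast this
    linarith
  have hG1 : (modelLaw N M).real {ω | D (modelMatrix ω).1 lam (j + 1) ∈ G} ≤ 4 * θ := by
    have key := modelLaw_real_le (.inl ⟨j, by omega⟩) (p := 4 * θ) (q := 0) (S := (∅ : Set _))
      (E := {ω : Fin N ⊕ Fin N → Fin M × Fin M → ℝ | D (modelMatrix ω).1 lam (j + 1) ∈ G})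
      (((measurable_pi_of_entries (measurable_D lam _)).comp measurable_modelMatrix) hG)
      (by positivity) (by simp) fun ω _ => by
        obtain ⟨F, hFs, hF⟩ := exists_D_update_eq_symMat ω lam (by omega : j < N)
        simp only [Set.mem_ofPred_eq, hF]
        exact hGp F
    simpa using key
  set S : Set (Fin N ⊕ Fin N → Fin M × Fin M → ℝ) :=
    {ω | (D (modelMatrix ω).1 lam (j + 1)).det = 0} ∪ {ω | D (modelMatrix ω).1 lam (j + 1) ∈ G}
      ∪ {ω | 2 * M / θ < fsq (block (modelMatrix ω).1 (j + 1 + 1) (j + 1 + 1))} with hS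
  have hSp : (modelLaw N M).real S ≤ 5 * θ := by
    have h1 := modelLaw_det_eq_zero hM0 lam (by omega : j < N)
    have h2 := modelLaw_block_large hM0 hj hθ
    refine (measureReal_union_le _ _).trans ?_
    have := measureReal_union_le (μ := modelLaw N M)
      {ω | (D (modelMatrix ω).1 lam (j + 1)).det = 0} {ω | D (modelMatrix ω).1 lam (j + 1) ∈ G}
    linarith
  have hK : Measurable fun ω : Fin N ⊕ Fin N → Fin M × Fin M → ℝ =>
      fsq (D (modelMatrix ω).1 lam (j + 2))⁻¹ :=
    (measurable_fsq_of_entries (measurable_inv_of_entries (measurable_D lam _))).comp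
      measurable_modelMatrix
  have hdet : Measurable fun ω : Fin N ⊕ Fin N → Fin M × Fin M → ℝ =>
      (D (modelMatrix ω).1 lam (j + 2)).det :=
    (measurable_det_of_entries (measurable_D lam _)).comp measurable_modelMatrix
  -- Singular `D_k` have the conventional inverse `0` and are treated separately.
  have key := modelLaw_real_le (.inr ⟨j, by omega⟩) (p := θ) (q := 5 * θ) (S := S)
    (E := {ω : Fin N ⊕ Fin N → Fin M × Fin M → ℝ |
      fsq (D (modelMatrix ω).1 lam (j + 2))⁻¹ < θ ^ 3 * M / (768 * Q)}
      \ {ω | (D (modelMatrix ω).1 lam (j + 2)).det = 0})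
    ((measurableSet_lt hK measurable_const).diff (measurableSet_eq_fun hdet measurable_const))
    hθ.le hSp fun ω hω => by
      simp only [hS, Set.mem_union, Set.mem_ofPred_eq, not_or, not_lt] at hω
      obtain ⟨⟨hω1, hω2⟩, hω3⟩ := hω
      obtain ⟨I, T, hI, hT, hTf⟩ := hGT _ hω2
      have hTf' : fsq T ≤ M / θ ^ 2 := by
        refine hTf.trans ?_
        rw [diagScale_sq hM0, div_le_div_iff₀ (by positivity) (by positivity)]
        have : ((M / 4 : ℕ) : ℝ) ≤ d / 2 := by linarith
        calc ((M / 4 : ℕ) : ℝ) * θ ^ 2 ≤ d / 2 * θ ^ 2 := by gcongr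
          _ = M * (θ ^ 2 * d * (1 / (2 * M))) := by field_simp
      refine (measureReal_mono fun Y hY => ?_).trans
        (stdGauss_fsq_congr_large T hθ (by positivity) hTf')
      simp only [Set.mem_ofPred_eq, Set.mem_sdiff, Fintype.card_fin] at hY ⊢
      by_contra hcon
      rw [not_lt] at hcon
      obtain ⟨hY1, hY2⟩ := hY
      set D' := D (modelMatrix ω).1 lam (j + 1) with hD'
      have hDk : D (modelMatrix (Function.update ω (.inr ⟨j, by omega⟩) Y)).1 lam (j + 2)
          = (block (modelMatrix ω).1 (j + 1 + 1) (j + 1 + 1) - lam • 1)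
            - (-offBlock Y)ᵀ * D'⁻¹ * -offBlock Y := by
        rw [D_succ _ _ (by omega), schurTerm_update ω lam hj, block_modelMatrix _ hj,
          block_modelMatrix _ hj, Function.update_of_ne (by simp)]
      have hlow := card_sq_le_fsq_mul_fsq hDk (nonsing_inv_mul _ (isUnit_iff_ne_zero.2 hY2))
        (nonsing_inv_mul _ (isUnit_iff_ne_zero.2 hω1)) hT
      set K := (D (modelMatrix (Function.update ω (.inr ⟨j, by omega⟩) Y)).1 lam (j + 2))⁻¹ with hKd
      have hup := fsq_sub_sub_le (block (modelMatrix ω).1 (j + 1 + 1) (j + 1 + 1))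
        (lam • (1 : Matrix (Fin M) (Fin M) ℝ)) ((-offBlock Y)ᵀ * T * -offBlock Y)
      rw [fsq_one_smul, offBlock_congr, fsq_smul, Fintype.card_fin, ← offBlock_congr] at hup
      have hI2 : (M : ℝ) ^ 2 / 256 ≤ (I.card : ℝ) ^ 2 := by
        have : (M : ℝ) / 16 ≤ I.card := by linarith
        calc (M : ℝ) ^ 2 / 256 = (M / 16) ^ 2 := by ring
          _ ≤ _ := by gcongr
      have hθ3 : θ ^ 3 ≤ 1 := pow_le_one₀ hθ.le hθ1
      have hθ2 : θ ^ 2 ≤ 1 := pow_le_one₀ hθ.le hθ1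
      have hN : fsq (block (modelMatrix ω).1 (j + 1 + 1) (j + 1 + 1) - lam • 1
          - (-offBlock Y)ᵀ * T * -offBlock Y) ≤ 3 * Q * M / θ ^ 3 := by
        refine hup.trans ?_
        have e1 : (M : ℝ)⁻¹ ^ 2 * fsq ((of fun p q => Y (p, q))ᵀ * T * of fun p q => Y (p, q))
            ≤ (M : ℝ)⁻¹ ^ 2 * ((1 + gaussFour) * M ^ 2 * (M / θ ^ 2) / θ) := by gcongr
        have e2 : (M : ℝ)⁻¹ ^ 2 * ((1 + gaussFour) * M ^ 2 * (M / θ ^ 2) / θ)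
            = (1 + gaussFour) * M / θ ^ 3 := by field_simp
        have e3 : 2 * M / θ ≤ 2 * M / θ ^ 3 := by
          gcongr
          exact pow_le_of_le_one hθ.le hθ1 (by norm_num)
        have e4 : lam ^ 2 * M ≤ lam ^ 2 * M / θ ^ 3 := by
          rw [le_div_iff₀ (by positivity)]
          exact mul_le_of_le_one_right (by positivity) hθ3
        calc _ ≤ 3 * (2 * M / θ ^ 3 + lam ^ 2 * M / θ ^ 3 + (1 + gaussFour) * M / θ ^ 3) := by
              linarith
          _ = 3 * (3 + lam ^ 2 + gaussFour) * M / θ ^ 3 := by ring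
          _ ≤ _ := by gcongr
      have hfin : (M : ℝ) ^ 2 / 256 < θ ^ 3 * M / (768 * Q) * (3 * Q * M / θ ^ 3) :=
        hI2.trans_lt (hlow.trans_lt
          ((mul_le_mul_of_nonneg_left hN (fsq_nonneg K)).trans_lt
            (mul_lt_mul_of_pos_right hY1 (by positivity))))
      refine absurd hfin (not_lt.2 (le_of_eq ?_))
      field_simp
      norm_num
  have h0 := modelLaw_det_eq_zero hM0 lam hj
  have h1 := measureReal_union_le (μ := modelLaw N M)
    ({ω | fsq (D (modelMatrix ω).1 lam (j + 2))⁻¹ < θ ^ 3 * M / (768 * Q)}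
      \ {ω | (D (modelMatrix ω).1 lam (j + 2)).det = 0})
    {ω | (D (modelMatrix ω).1 lam (j + 2)).det = 0}
  refine (measureReal_mono ?_).trans (h1.trans (by linarith))
  rw [Set.sdiff_union_self]
  exact Set.subset_union_left

lemma modelLaw_schurTerm_small (hM : 8 ≤ M) {lam Q : ℝ} (hQ : 3 + lam ^ 2 + gaussFour ≤ Q) {j : ℕ}
    (hj : j + 2 < N) {θ : ℝ} (hθ : 0 < θ) (hθ1 : θ ≤ 1) :
    (modelLaw N M).real {ω | fsq (schurTerm (modelMatrix ω).1 lam (j + 2))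
      < θ ^ 7 * M / (6144 * Q)} ≤ 12 * θ := by
  have hM' : (0 : ℝ) < M := by exact_mod_cast (by omega : 0 < M)
  have hQ0 : 0 < Q := by have := sq_nonneg lam; have := gaussFour_nonneg; linarith
  have key := modelLaw_real_le (.inr ⟨j + 1, by omega⟩) (p := 6 * θ)
    (E := {ω : Fin N ⊕ Fin N → Fin M × Fin M → ℝ | fsq (schurTerm (modelMatrix ω).1 lam (j + 2))
      < θ ^ 7 * M / (6144 * Q)})
    (measurableSet_lt ((measurable_fsq_of_entries
      (measurable_schurTerm lam _)).comp measurable_modelMatrix) measurable_const) (by positivity)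
    (modelLaw_fsq_inv_D_small hM hQ (by omega : j + 1 < N) hθ hθ1) fun ω hω => by
        simp only [Set.mem_ofPred_eq, not_lt] at hω
        simp only [Set.mem_ofPred_eq, schurTerm_update ω lam hj, offBlock_congr, fsq_smul]
        refine (measureReal_mono fun Y hY => ?_).trans
          (stdGauss_fsq_congr_small (D (modelMatrix ω).1 lam (j + 1 + 1))⁻¹
            (by rw [Fintype.card_fin]; omega) hθ)
        simp only [Set.mem_ofPred_eq, Fintype.card_fin] at hY ⊢
        have h3 := mul_lt_mul_of_pos_left hY (by positivity : (0 : ℝ) < M ^ 2)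
        refine lt_of_eq_of_lt ?_ (h3.trans_le ?_)
        · field_simp
        · calc (M : ℝ) ^ 2 * (θ ^ 7 * M / (6144 * Q))
              = θ ^ 4 / 8 * M ^ 2 * (θ ^ 3 * M / (768 * Q)) := by field_simp; norm_num
            _ ≤ _ := by gcongr
  linarith

/-- The set of band matrices that satisfy the hypotheses of `phi_bounds`. -/
def goodSet (N M : ℕ) (lam : ℝ) (k : ℕ) (u : ℝ) : Set (bandSpace N M) :=
  {a | M ≤ fsq (D a.1 lam k) * u} ∩ {a | fsq (D a.1 lam k) ≤ (M : ℝ) ^ 2 * u} ∩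
    {a | M ≤ fsq (schurTerm a.1 lam k) * u} ∩ {a | fsq (schurTerm a.1 lam k) ≤ (M : ℝ) ^ 2 * u} ∩
    {a | fsq (block a.1 k k) ≤ M * u} ∩ {a | fsq (block a.1 (k + 1) (k + 1)) ≤ M * u}

lemma measurableSet_goodSet (lam : ℝ) (k : ℕ) (u : ℝ) : MeasurableSet (goodSet N M lam k u) := by
  have h1 := measurable_fsq_of_entries (measurable_D (N := N) (M := M) lam k)
  have h2 := measurable_fsq_of_entries (measurable_schurTerm (N := N) (M := M) lam k)
  have h3 : ∀ i, Measurable fun a : bandSpace N M => fsq (block a.1 i i) := fun i =>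
    measurable_fsq_of_entries (measurable_block i i)
  exact (((((measurableSet_le measurable_const (h1.mul_const u)).inter
    (measurableSet_le h1 measurable_const)).inter
    (measurableSet_le measurable_const (h2.mul_const u))).inter
    (measurableSet_le h2 measurable_const)).inter
    (measurableSet_le (h3 k) measurable_const)).inter
    (measurableSet_le (h3 (k + 1)) measurable_const)

lemma bandLaw_goodSet {lam Q θ u : ℝ} {k : ℕ} (hM : 8 ≤ M) (hQ : 3 + lam ^ 2 + gaussFour ≤ Q)
    (hk : 1 < k) (hkN : k < N) (hθ : 0 < θ) (hθ1 : θ ≤ 1) (hu : 6144 * Q / θ ^ 12 ≤ u) :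
    1 - 154 * θ ≤ (bandLaw N M).real (goodSet N M lam k u) := by
  obtain ⟨j, rfl⟩ := Nat.exists_eq_add_of_le' hk
  have hM0 : 0 < M := by omega
  have hM' : (8 : ℝ) ≤ M := by exact_mod_cast hM
  have hM1 : (0 : ℝ) < M := by linarith
  have hg := gaussFour_nonneg
  have hl := sq_nonneg lam
  have hQ3 : 3 ≤ Q := by linarith
  have hgQ : 1 + gaussFour ≤ Q := by linarith
  have hθi : ∀ n : ℕ, θ ^ n ≤ 1 := fun n => pow_le_one₀ hθ.le hθ1
  have hu12 : 6144 * Q ≤ u * θ ^ 12 := by rwa [div_le_iff₀ (by positivity)] at hu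
  have hu0 : 0 < u := lt_of_lt_of_le (by positivity) hu
  have hun : ∀ n ≤ 12, 6144 * Q ≤ u * θ ^ n := fun n hn =>
    hu12.trans (mul_le_mul_of_nonneg_left (pow_le_pow_of_le_one hθ.le hθ1 hn) hu0.le)
  set E1 : Set (Fin N ⊕ Fin N → Fin M × Fin M → ℝ) :=
    {ω | fsq (D (modelMatrix ω).1 lam (j + 1 + 1)) < θ ^ 2 * M / 2} with hE1
  set E2 : Set (Fin N ⊕ Fin N → Fin M × Fin M → ℝ) :=
    {ω | fsq (schurTerm (modelMatrix ω).1 lam (j + 2)) < θ ^ 7 * M / (6144 * Q)} with hE2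
  set E3 : Set (Fin N ⊕ Fin N → Fin M × Fin M → ℝ) :=
    {ω | (1 + gaussFour) * (256 * M ^ 2 / θ ^ 12)
      < fsq (schurTerm (modelMatrix ω).1 lam (j + 1))} with hE3
  set E4 : Set (Fin N ⊕ Fin N → Fin M × Fin M → ℝ) :=
    {ω | (1 + gaussFour) * (256 * M ^ 2 / θ ^ 12)
      < fsq (schurTerm (modelMatrix ω).1 lam (j + 1 + 1))} with hE4
  set E5 : Set (Fin N ⊕ Fin N → Fin M × Fin M → ℝ) :=
    {ω | 2 * M / θ < fsq (block (modelMatrix ω).1 (j + 1 + 1) (j + 1 + 1))} with hE5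
  set E6 : Set (Fin N ⊕ Fin N → Fin M × Fin M → ℝ) :=
    {ω | 2 * M / θ < fsq (block (modelMatrix ω).1 (j + 2 + 1) (j + 2 + 1))} with hE6
  have p1 : (modelLaw N M).real E1 ≤ 2 * θ := modelLaw_fsq_D_small hM0 lam (by omega) hθ
  have p2 : (modelLaw N M).real E2 ≤ 12 * θ := modelLaw_schurTerm_small hM hQ hkN hθ hθ1
  have p3 : (modelLaw N M).real E3 ≤ 69 * θ :=
    modelLaw_schurTerm_large hM0 lam (by omega : j + 1 < N) hθ hθ1
  have p4 : (modelLaw N M).real E4 ≤ 69 * θ :=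
    modelLaw_schurTerm_large hM0 lam (by omega : j + 1 + 1 < N) hθ hθ1
  have p5 : (modelLaw N M).real E5 ≤ θ := modelLaw_block_large hM0 (by omega : j + 1 < N) hθ
  have p6 : (modelLaw N M).real E6 ≤ θ := modelLaw_block_large hM0 hkN hθ
  have hbad : (modelLaw N M).real (E1 ∪ E2 ∪ E3 ∪ E4 ∪ E5 ∪ E6) ≤ 154 * θ := by
    have q1 := measureReal_union_le (μ := modelLaw N M) E1 E2
    have q2 := measureReal_union_le (μ := modelLaw N M) (E1 ∪ E2) E3
    have q3 := measureReal_union_le (μ := modelLaw N M) (E1 ∪ E2 ∪ E3) E4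
    have q4 := measureReal_union_le (μ := modelLaw N M) (E1 ∪ E2 ∪ E3 ∪ E4) E5
    have q5 := measureReal_union_le (μ := modelLaw N M) (E1 ∪ E2 ∪ E3 ∪ E4 ∪ E5) E6
    linarith
  have hsub : (modelMatrix ⁻¹' goodSet N M lam (j + 2) u)ᶜ ⊆ E1 ∪ E2 ∪ E3 ∪ E4 ∪ E5 ∪ E6 := by
    intro ω hω
    by_contra hcon
    simp only [Set.mem_union, not_or, hE1, hE2, hE3, hE4, hE5, hE6, Set.mem_ofPred_eq,
      not_lt] at hcon
    obtain ⟨⟨⟨⟨⟨h1, h2⟩, h3⟩, h4⟩, h5⟩, h6⟩ := hcon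
    have hblk : 2 * M / θ ≤ M * u := by
      rw [div_le_iff₀ hθ]
      have := hun 1 (by norm_num)
      rw [pow_one] at this
      nlinarith
    have hZ : (1 + gaussFour) * (256 * M ^ 2 / θ ^ 12) ≤ M ^ 2 * u := by
      rw [← mul_div_assoc, div_le_iff₀ (by positivity)]
      have e1 : (1 + gaussFour) * (256 * (M : ℝ) ^ 2) ≤ Q * (256 * M ^ 2) := by gcongr
      have e2 := mul_le_mul_of_nonneg_left hu12 (sq_nonneg (M : ℝ))
      nlinarith [mul_pos (pow_pos hM1 2) (by linarith : 0 < Q)]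
    refine hω ⟨⟨⟨⟨⟨?_, ?_⟩, ?_⟩, h4.trans hZ⟩, h5.trans hblk⟩, h6.trans hblk⟩
    · have e1 := mul_le_mul_of_nonneg_right h1 hu0.le
      have e2 := mul_le_mul_of_nonneg_left (hun 2 (by norm_num)) hM1.le
      have e3 : (M : ℝ) * 3 ≤ M * Q := by gcongr
      refine le_trans ?_ e1
      linarith
    · have e1 := fsq_sub_sub_le (block (modelMatrix ω).1 (j + 1 + 1) (j + 1 + 1))
        (lam • (1 : Matrix (Fin M) (Fin M) ℝ)) (schurTerm (modelMatrix ω).1 lam (j + 1))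
      rw [← D_succ _ _ (by omega), fsq_one_smul, Fintype.card_fin] at e1
      refine e1.trans ?_
      have e2 : 2 * (M : ℝ) / θ ≤ 256 * M ^ 2 / θ ^ 12 * 1 := by
        rw [mul_one]
        have : θ ^ 12 ≤ θ := pow_le_of_le_one hθ.le hθ1 (by norm_num)
        gcongr
        · norm_num
        · nlinarith
      have e3 : (M : ℝ) ≤ 256 * M ^ 2 / θ ^ 12 := by
        rw [le_div_iff₀ (by positivity)]
        have := mul_le_mul_of_nonneg_left (hθi 12) hM1.le
        nlinarith
      have e4 : lam ^ 2 * (M : ℝ) ≤ lam ^ 2 * (256 * M ^ 2 / θ ^ 12) := by gcongr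
      calc _ ≤ 3 * ((256 * (M : ℝ) ^ 2 / θ ^ 12) * 1 + lam ^ 2 * (256 * M ^ 2 / θ ^ 12)
            + (1 + gaussFour) * (256 * M ^ 2 / θ ^ 12)) := by linarith
        _ = 3 * 256 * M ^ 2 * (2 + lam ^ 2 + gaussFour) / θ ^ 12 := by ring
        _ ≤ 3 * 256 * M ^ 2 * Q / θ ^ 12 := by gcongr; linarith
        _ ≤ M ^ 2 * u := by
          rw [div_le_iff₀ (by positivity)]
          have := mul_le_mul_of_nonneg_left hu12 (sq_nonneg (M : ℝ))
          nlinarith [mul_pos (pow_pos hM1 2) (by linarith : 0 < Q)]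
    · have e1 := mul_le_mul_of_nonneg_right h2 hu0.le
      refine le_trans ?_ e1
      rw [div_mul_eq_mul_div, le_div_iff₀ (by positivity)]
      have := mul_le_mul_of_nonneg_left (hun 7 (by norm_num)) hM1.le
      linarith
  have hmeas := measurableSet_goodSet (N := N) (M := M) lam (j + 2) u
  rw [← map_modelMatrix hM0, map_measureReal_apply measurable_modelMatrix hmeas]
  have h1 := probReal_compl_eq_one_sub (μ := modelLaw N M) (measurable_modelMatrix hmeas)
  have h2 := (measureReal_mono (μ := modelLaw N M) hsub).trans hbad
  linarith

end

end BandMatrix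

theorem lemma3p4 (ε : ℝ) (hε : 0 < ε) :
    ∃ C : ℝ, 1 < C ∧ ∃ c : ℝ, 0 < c ∧ c < 1 ∧
      ∀ lam : ℝ, |lam| < ε⁻¹ → ∀ M N k : ℕ, C ≤ (M : ℝ) → 1 < k → k < N →
        ∃ E : Set (BandMatrix.bandSpace N M), MeasurableSet E ∧
          1 - (M : ℝ) ^ (-c) ≤ (BandMatrix.bandLaw N M).real E ∧
          ∀ a ∈ E,
            (∀ s : ℝ, (M : ℝ) ^ ε ≤ s →
              (M : ℝ) ^ (2 - ε) * s ≤
                BandMatrix.S a.1 lam k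
                  * deriv (BandMatrix.phi a.1 lam k) (BandMatrix.S a.1 lam k * s)) ∧
            (∀ s : ℝ, 0 < s → s ≤ (M : ℝ) ^ (-ε) →
              BandMatrix.S a.1 lam k
                  * deriv (BandMatrix.phi a.1 lam k) (BandMatrix.S a.1 lam k * s) ≤
                -((M : ℝ) ^ (2 - ε) * s ^ (-3 : ℤ))) ∧
            (∀ s : ℝ, 0 < s →
              |BandMatrix.S a.1 lam k ^ 2
                  * iteratedDeriv 2 (BandMatrix.phi a.1 lam k) (BandMatrix.S a.1 lam k * s)| ≤
                (M : ℝ) ^ (3 + ε) * (1 + s ^ (-4 : ℤ))) := by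
  have hg := BandMatrix.gaussFour_nonneg
  set Q := 3 + (ε⁻¹) ^ 2 + BandMatrix.gaussFour with hQ
  have hQ3 : 3 ≤ Q := by have := sq_nonneg ε⁻¹; linarith
  have hR1 : 1 ≤ (6144 * Q) ^ (192 / ε) := Real.one_le_rpow (by linarith) (by positivity)
  -- The parameter `θ = M ^ (-ε / 96)` costs `θ ^ (-12) = M ^ (ε / 8)`, and the constants, of size
  -- at most `6144 Q ≤ M ^ (ε / 192)`, cost less: `u = M ^ (ε / 4)` suffices, and `u ^ 4 = M ^ ε` is
  -- the loss in the bounds. The exceptional probability `154 θ` is at most `M ^ (-ε / 192)`.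
  refine ⟨(6144 * Q) ^ (192 / ε) + 8, by linarith, min (ε / 192) (1 / 2), by positivity,
    (min_le_right _ _).trans_lt (by norm_num), fun lam hlam M N k hC hk hkN => ?_⟩
  have hM8 : (8 : ℝ) ≤ M := by linarith
  have hM8' : 8 ≤ M := by exact_mod_cast hM8
  have hM0 : (0 : ℝ) < M := by linarith
  have hM1 : (1 : ℝ) ≤ M := by linarith
  have hR : 6144 * Q ≤ (M : ℝ) ^ (ε / 192) := by
    have h1 : ((6144 * Q) ^ (192 / ε)) ^ (ε / 192) ≤ (M : ℝ) ^ (ε / 192) :=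
      Real.rpow_le_rpow (by positivity) (by linarith) (by positivity)
    rwa [← Real.rpow_mul (by positivity), show 192 / ε * (ε / 192) = 1 by field_simp,
      Real.rpow_one] at h1
  have hlQ : 3 + lam ^ 2 + BandMatrix.gaussFour ≤ Q := by
    have : lam ^ 2 ≤ ε⁻¹ ^ 2 := sq_le_sq.2 (hlam.le.trans (le_abs_self _))
    linarith
  set θ := (M : ℝ) ^ (-(ε / 96)) with hθ
  set u := (M : ℝ) ^ (ε / 4) with hu
  have hθ0 : 0 < θ := Real.rpow_pos_of_pos hM0 _
  have hθ1 : θ ≤ 1 := Real.rpow_le_one_of_one_le_of_nonpos hM1 (by linarith)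
  have hθ12 : 6144 * Q / θ ^ 12 ≤ u := by
    have e : θ ^ 12 * (M : ℝ) ^ (ε / 8) = 1 := by
      rw [hθ, ← Real.rpow_natCast, ← Real.rpow_mul hM0.le, ← Real.rpow_add hM0]
      norm_num
      ring_nf
      simp
    rw [div_le_iff₀ (by positivity)]
    have e1 : u = (M : ℝ) ^ (ε / 8) * (M : ℝ) ^ (ε / 8) := by
      rw [hu, ← Real.rpow_add hM0]
      congr 1
      ring
    have e2 : (M : ℝ) ^ (ε / 192) ≤ (M : ℝ) ^ (ε / 8) :=
      Real.rpow_le_rpow_of_exponent_le hM1 (by linarith)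
    calc 6144 * Q ≤ (M : ℝ) ^ (ε / 8) * 1 := by linarith
      _ = u * θ ^ 12 := by rw [← e, e1]; ring
  have hu4 : 4 ≤ u := by
    refine le_trans ?_ hθ12
    rw [le_div_iff₀ (by positivity)]
    have : θ ^ 12 ≤ 1 := pow_le_one₀ hθ0.le hθ1
    linarith
  have hu_pow : u ^ 4 = (M : ℝ) ^ ε := by
    rw [hu, ← Real.rpow_natCast, ← Real.rpow_mul hM0.le]
    congr 1
    push_cast
    ring
  have hM2 : (M : ℝ) ^ (2 - ε) = (M : ℝ) ^ 2 / u ^ 4 := by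
    rw [hu_pow, Real.rpow_sub hM0]
    norm_num
  have hM3 : (M : ℝ) ^ (3 + ε) = (M : ℝ) ^ 3 * u ^ 4 := by
    rw [hu_pow, Real.rpow_add hM0]
    norm_num
  refine ⟨BandMatrix.goodSet N M lam k u, BandMatrix.measurableSet_goodSet lam k u, ?_,
    fun a ha => ?_⟩
  · refine le_trans ?_ (BandMatrix.bandLaw_goodSet hM8' hlQ hk hkN hθ0 hθ1 hθ12)
    have e1 : 154 * θ ≤ (M : ℝ) ^ (-(ε / 192)) := by
      calc 154 * θ ≤ (M : ℝ) ^ (ε / 192) * θ := by gcongr; linarith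
        _ = (M : ℝ) ^ (-(ε / 192)) := by
          rw [hθ, ← Real.rpow_add hM0]
          congr 1
          ring
    have e2 : (M : ℝ) ^ (-(ε / 192)) ≤ (M : ℝ) ^ (-(min (ε / 192) (1 / 2))) :=
      Real.rpow_le_rpow_of_exponent_le hM1 (neg_le_neg (min_le_left _ _))
    linarith
  · obtain ⟨⟨⟨⟨⟨h1, h2⟩, h3⟩, h4⟩, h5⟩, h6⟩ := ha
    obtain ⟨b1, b2, b3⟩ := BandMatrix.phi_bounds hk (by omega) hu4 h1 h2 h3 h4 h5 h6
    rw [hM2, hM3, Real.rpow_neg hM0.le, ← hu_pow]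
    have hz3 : ∀ s : ℝ, s ^ (-3 : ℤ) = s⁻¹ ^ 3 := fun s => by
      rw [_root_.zpow_neg, inv_pow]; norm_cast
    have hz4 : ∀ s : ℝ, s ^ (-4 : ℤ) = s⁻¹ ^ 4 := fun s => by
      rw [_root_.zpow_neg, inv_pow]; norm_cast
    simp only [hz3, hz4]
    exact ⟨b1, fun s hs0 hs => b2 s hs0 ((le_inv_comm₀ (by positivity) hs0).2 hs), b3⟩
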